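/- **Setting.** Let $E$ be a Polish space and let $\Theta$ be a compact subset of a real Banach space $B$. For each $\theta\in\Theta$ let $K_\theta$ be a Markov transition kernel on $E$, with $(x,\theta)\mapsto K_\theta(x,A)$ measurable for Borel $A$. Assume that every $K_\theta$ is Feller and mixing: there are $0<\epsilon_\theta\le 1$ and a finite measure $\lambda_\theta$ on $E$ with $\epsilon_\theta\lambda_\theta(A)\le K_\theta(x,A)\le \epsilon_\theta^{-1}\lambda_\theta(A)$ for all $x\in E$ and all Borel $A$. Let $h:E\to\mathbb R^d$ be bounded and continuous, let $\sigma>0$, and let $g$ be the density of $N(0,\sigma^2 I)$ on $\mathbb R^d$. For an initial distribution $m$ on $E$ let $\mathbb P_{m,\theta}$ (expectation $\mathbb E_{m,\theta}$) be the law of the Markov chain $(X_n)_{n\ge0}$ with $X_0\sim m$ and kernel $K_\theta$ together with the observations $Y_n=h(X_n)+V_n$, $n\ge1$, where the $V_n$ are i.i.d. $N(0,\sigma^2I)$ and independent of $X$. Let $Q^n_{m,\theta}$ be the law of $(Y_1,\dots,Y_n)$; it has the Lebesgue density $$q^n_{m,\theta}(y)=\mathbb E_{m,\theta}\Big[\prod_{k=1}^n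 g(y_k-h(X_k))\Big],$$ and $dQ^n_{m,\theta}/dQ^n_{m',\theta'}$ denotes the ratio of these densities. Let $\Psi^\theta_n(m)$ be the optimal filter, that is, the conditional law of $X_n$ given $Y_1,\dots,Y_n$, $$\Psi^\theta_n(m)(f)=\frac{\mathbb E_{m,\theta}\big[f(X_n)\prod_{k=1}^n g(y_k-h(X_k))\big]}{\mathbb E_{m,\theta}\big[\prod_{k=1}^n g(y_k-h(X_k))\big]}\quad\text{at } y_k=Y_k .$$ For a probability measure $u$ on $\Theta$ (the prior) let $\Phi_n(m\otimes u)$ be the optimal filter of the augmented chain $(X_n,\theta_n)$ on $E\times\Theta$, which has kernel $K_{\theta'}(x',dx)\otimes\delta_{\theta'}(d\theta)$, initial distribution $m\otimes u$ and the same observation function $h$. Let $\Psi^u_n(m)$ be the marginal of $\Phi_n(m\otimes u)$ on $E$. Let $\mu_\theta$ be the limiting (weak limit) distribution of the chain with kernel $K_\theta$ and let $\nu_\theta=(\mu_\theta\circ h^{-1})*N(0,\sigma^2I)$ be the limiting distribution of its observations. Write $\mathcal N_\rho(\alpha)$ for the open ball in $\Theta$ of radius $\rho$ around $\alpha$, and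 $L$ for the Lévy–Prokhorov metric. **Theorem.** Let $\alpha\in\Theta$ (the true value), let $u$ be a probability measure on $\Theta$, and let $\mu,\mu'$ be probability measures on $E$. Assume: 1. There are $\epsilon_n>0$ with $\epsilon_n\downarrow0$, and $p:\mathbb N\to[1,\infty)$ with $p(n)/n\to0$, such that $$\limsup_{n\to\infty}\mathbb E_{\mu',\alpha}\left[\left(\frac{\sup_{\theta\in\mathcal N_{\epsilon_n}(\alpha)}\frac{dQ^n_{\mu',\alpha}}{dQ^n_{\mu,\theta}}(Y_1,\dots,Y_n)}{u(\mathcal N_{\epsilon_n}(\alpha))}\right)^{1/p(n)}\right]<\infty .$$ 2. For each $\theta\in\Theta$, the empirical measures $\frac1n\sum_{k=1}^n\delta_{Y_k}$ satisfy, under $\mathbb P_{\mu,\theta}$, the large deviation principle in $\mathcal P(\mathbb R^d)$ (weak topology, speed $n$) with a lower semicontinuous rate function $J_\theta:\mathcal P(\mathbb R^d)\to[0,\infty]$. 3. For every $\eta>0$ there is $\epsilon>0$ such that, for all $\theta\in\Theta$, $L(\nu_\theta,\nu_\alpha)\le\epsilon$ implies $\|\theta-\alpha\|<\eta$. 4.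 $K_\theta$ and $J_\theta$ are continuous in $\theta$: for each bounded continuous $f:E\to\mathbb R$ the map $\theta\mapsto K_\theta f$ is continuous for the supremum norm, and for each $\nu\in\mathcal P(\mathbb R^d)$ the map $\theta\mapsto J_\theta(\nu)$ is continuous. 5. There is a ball $\mathcal N(\alpha)=\mathcal N_r(\alpha)$, $r>0$, such that for every $\theta\in\mathcal N(\alpha)$ the following hold. The kernel has a Fréchet derivative at $\theta$ relative to $\Theta$ in the weak operator sense: there is a bounded linear map $L_\theta$ from $B$ to the bounded operators on $C_b(E)$ such that, for every probability measure $m$ on $E$ and every $f\in C_b(E)$, $$m(K_{\theta'}f)-m(K_\theta f)-m\big(L_\theta[\theta'-\theta]f\big)=o(\|\theta'-\theta\|)\qquad(\theta'\to\theta,\ \theta'\in\Theta).$$ It has a density $\ell_\theta:E\times E\to B^*$ with respect to $K_\theta$: for all $x\in E$, $v\in B$ and $f\in C_b(E)$, the function $\ell_\theta(x,\cdot)[v]$ is $K_\theta(x,\cdot)$-integrable and $L_\theta[v]f(x)=\int f(z)\,\ell_\theta(x,z)[v]\,K_\theta(x,dz)$. The function $\Lambda_\theta(z)=\sup_{x\in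 E}\|\ell_\theta(x,z)\|_{B^*}\in[0,\infty]$ is measurable. Moreover $$\sup_{n\ge1}\ \sup_{\theta,\theta'\in\mathcal N(\alpha)}\Big(\mathbb E_{\mu,\theta}\big[K_{\theta'}(\Lambda_{\theta'}^{\,n+1})(X_{n-1})\big]\Big)^{1/(n+1)}<\infty .$$ 6. The first two moments of $\nu_\alpha$ exist. Then $$\lim_{n\to\infty}\mathbb E_{\mu',\alpha}\big\|\Psi^u_n(\mu)-\Psi^\alpha_n(\mu')\big\|_{tv}=0 .$$ -/

import Mathlib

open MeasureTheory ProbabilityTheory Filter Topology Asymptotics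
open scoped ENNReal NNReal BoundedContinuousFunction

noncomputable section

namespace AdaptiveFilter

/-- The observation space `ℝᵈ`. -/
abbrev Obs (d : ℕ) : Type := EuclideanSpace ℝ (Fin d)

/-! ### Markov chains and hidden Markov models -/

section HiddenMarkov

variable {S : Type*} [MeasurableSpace S]

/-- The joint law of `(X₀, …, Xₙ)` for the homogeneous Markov chain with transition kernel `κ`
and initial distribution `m`. -/
def pathLaw (κ : Kernel S S) (m : Measure S) : (n : ℕ) → Measure (Fin (n + 1) → S)
  | 0 => m.map (fun s _ => s)
  | n + 1 =>
      ((pathLaw κ m n) ⊗ₘ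
        (κ.comap (fun x : Fin (n + 1) → S => x (Fin.last n)) (measurable_pi_apply _))).map
        (fun q => Fin.snoc (α := fun _ => S) q.1 q.2)

/-- The density of the Gaussian law `N(0, σ² I)` on `ℝᵈ`. -/
def gaussDensity {d : ℕ} (σ : ℝ) (v : Obs d) : ℝ≥0∞ :=
  ENNReal.ofReal
    ((2 * Real.pi * σ ^ 2) ^ (-(d : ℝ) / 2) * Real.exp (-‖v‖ ^ 2 / (2 * σ ^ 2)))

/-- The law of one observation noise variable, `N(0, σ² I)`. -/
def noiseLaw (d : ℕ) (σ : ℝ) : Measure (Obs d) := volume.withDensity (gaussDensity σ)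

/-- `∏ₖ g(yₖ - h(xₖ))`, the product over `k = 1, …, n`; the entry `y k` is the observation made
at time `k + 1`, and no observation is made at time `0`. -/
def obsWeight {d : ℕ} (σ : ℝ) (h : S → Obs d) {n : ℕ} (y : Fin n → Obs d)
    (x : Fin (n + 1) → S) : ℝ≥0∞ :=
  ∏ k : Fin n, gaussDensity σ (y k - h (x k.succ))

/-- The density of the law of `(Y₁, …, Yₙ)`, `Yₖ = h(Xₖ) + Vₖ`, with respect to Lebesgue
measure. -/
def obsDensity {d : ℕ} (κ : Kernel S S) (m : Measure S) (σ : ℝ) (h : S → Obs d) (n : ℕ)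
    (y : Fin n → Obs d) : ℝ≥0∞ :=
  ∫⁻ x, obsWeight σ h y x ∂(pathLaw κ m n)

/-- The law of `(Y₁, …, Yₙ)`. -/
def obsLaw {d : ℕ} (κ : Kernel S S) (m : Measure S) (σ : ℝ) (h : S → Obs d) (n : ℕ) :
    Measure (Fin n → Obs d) :=
  volume.withDensity (obsDensity κ m σ h n)

/-- The measure `A ↦ ∫ 1_A(xₙ) ∏ₖ g(yₖ - h(xₖ)) P(dx₀, …, dxₙ)`. -/
def unnormalizedFilter {d : ℕ} (κ : Kernel S S) (m : Measure S) (σ : ℝ) (h : S → Obs d)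
    (n : ℕ) (y : Fin n → Obs d) : Measure S :=
  ((pathLaw κ m n).withDensity (obsWeight σ h y)).map (fun x => x (Fin.last n))

/-- The optimal filter: the conditional law of `Xₙ` given `(Y₁, …, Yₙ) = y`. -/
def optimalFilter {d : ℕ} (κ : Kernel S S) (m : Measure S) (σ : ℝ) (h : S → Obs d)
    (n : ℕ) (y : Fin n → Obs d) : Measure S :=
  (unnormalizedFilter κ m σ h n y Set.univ)⁻¹ • unnormalizedFilter κ m σ h n y

/-- The total variation norm `‖m₁ - m₂‖_tv` of the difference of two probability measures. -/
def tvNorm (m₁ m₂ : Measure S) : ℝ≥0∞ :=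
  2 * ⨆ (A : Set S) (_ : MeasurableSet A), max (m₁ A - m₂ A) (m₂ A - m₁ A)

/-- The mixing condition: `ε λ(A) ≤ κ(x, A) ≤ ε⁻¹ λ(A)`. -/
def IsMixing (κ : Kernel S S) : Prop :=
  ∃ ε : ℝ≥0, 0 < ε ∧ ε ≤ 1 ∧ ∃ lam : Measure S, IsFiniteMeasure lam ∧
    ∀ (x : S) (A : Set S), MeasurableSet A →
      (ε : ℝ≥0∞) * lam A ≤ κ x A ∧ κ x A ≤ (ε : ℝ≥0∞)⁻¹ * lam A

end HiddenMarkov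

section Ergodic

variable {E : Type*} [TopologicalSpace E] [MeasurableSpace E]

/-- The Feller property. -/
def IsFeller (κ : Kernel E E) : Prop :=
  ∀ f : E →ᵇ ℝ, Continuous (fun x => ∫ z, f z ∂(κ x))

/-- `π` is the limiting distribution of the chain: from every initial distribution, the law of
`Xₙ` converges weakly to `π`. -/
def IsLimitingDistribution (κ : Kernel E E) (π : Measure E) : Prop :=
  IsProbabilityMeasure π ∧ ∀ m : Measure E, IsProbabilityMeasure m → ∀ f : E →ᵇ ℝ,
    Tendsto (fun n => ∫ x, f (x (Fin.last n)) ∂(pathLaw κ m n)) atTop (𝓝 (∫ z, f z ∂π))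

open Classical in
/-- The limiting distribution of the chain with kernel `κ` (zero if there is none). -/
def limitingDistribution (κ : Kernel E E) : Measure E :=
  if hκ : ∃ π, IsLimitingDistribution κ π then hκ.choose else 0

/-- The limiting distribution of the observation process: `(π ∘ h⁻¹) ∗ N(0, σ² I)`. -/
def limitingObsLaw {d : ℕ} (κ : Kernel E E) (σ : ℝ) (h : E → Obs d) : Measure (Obs d) :=
  ((limitingDistribution κ).map h).conv (noiseLaw d σ)

end Ergodic

/-! ### Large deviations of the empirical measures -/

/-- The event that the empirical measure `n⁻¹ ∑ₖ δ_{yₖ}` lies in `G`. -/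
def empiricalIn {d : ℕ} (n : ℕ) (G : Set (ProbabilityMeasure (Obs d))) :
    Set (Fin n → Obs d) :=
  {y | ∃ ν ∈ G, (ν : Measure (Obs d)) = (n : ℝ≥0∞)⁻¹ • ∑ k : Fin n, Measure.dirac (y k)}

/-- If `Q n` is the law of `(Y₁, …, Yₙ)`: the empirical measures of `Y` satisfy the large
deviation principle, in the weak topology and at speed `n`, with rate function `J`. -/
def SatisfiesLDP {d : ℕ} (Q : (n : ℕ) → Measure (Fin n → Obs d))
    (J : ProbabilityMeasure (Obs d) → ℝ≥0∞) : Prop :=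
  LowerSemicontinuous J ∧
  (∀ G : Set (ProbabilityMeasure (Obs d)), IsOpen G →
    -(((⨅ ν ∈ G, J ν : ℝ≥0∞)) : EReal) ≤
      liminf (fun n : ℕ => ENNReal.log (Q n (empiricalIn n G)) / ((n : ℝ) : EReal)) atTop) ∧
  (∀ F : Set (ProbabilityMeasure (Obs d)), IsClosed F →
    limsup (fun n : ℕ => ENNReal.log (Q n (empiricalIn n F)) / ((n : ℝ) : EReal)) atTop ≤
      -(((⨅ ν ∈ F, J ν : ℝ≥0∞)) : EReal))

/-! ### Systems that depend on a parameter

The parameter space is a subset `Θ` of a normed space `B`; `K (x, θ)` is the law `K_θ(x, ·)`, so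
that `K.sectL θ` is the kernel `K_θ`. -/

section Parameter

variable {E : Type*} [MeasurableSpace E]

/-- The transition kernel of the chain `(Xₙ, θₙ)`: the parameter is a component of the state
that does not move. -/
def augmentedKernel {T : Type*} [MeasurableSpace T] (K : Kernel (E × T) E) :
    Kernel (E × T) (E × T) :=
  K ×ₖ Kernel.deterministic Prod.snd measurable_snd

/-- The marginal on `E` of the optimal filter of the augmented system with initial
distribution `μ ⊗ u`. -/
def marginalFilter {T : Type*} [MeasurableSpace T] {d : ℕ} (K : Kernel (E × T) E)
    (μ : Measure E) (u : Measure T) (σ : ℝ) (h : E → Obs d) (n : ℕ) (y : Fin n → Obs d) :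
    Measure E :=
  (optimalFilter (augmentedKernel K) (μ.prod u) σ (fun s => h s.1) n y).map Prod.fst

/-- The condition on the mass of the prior `u` near the true value `α`, when the observations
come from the initial law `μ'` and the filter starts from `μ`. -/
def PriorMassCondition {T : Type*} [MeasurableSpace T] [PseudoMetricSpace T] {d : ℕ}
    (K : Kernel (E × T) E) (μ μ' : Measure E) (u : Measure T) (α : T) (σ : ℝ)
    (h : E → Obs d) : Prop :=
  ∃ (ε p : ℕ → ℝ), (∀ n, 0 < ε n) ∧ Antitone ε ∧ Tendsto ε atTop (𝓝 0) ∧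
    (∀ n, 1 ≤ p n) ∧ Tendsto (fun n : ℕ => p n / n) atTop (𝓝 0) ∧
    limsup (fun n : ℕ =>
      ∫⁻ y, ((⨆ θ ∈ Metric.ball α (ε n),
          obsDensity (K.sectL α) μ' σ h n y / obsDensity (K.sectL θ) μ σ h n y)
            / u (Metric.ball α (ε n))) ^ (1 / p n)
        ∂(obsLaw (K.sectL α) μ' σ h n)) atTop < ⊤

variable [TopologicalSpace E]

/-- Continuity of `θ ↦ K_θ` as a family of operators on the bounded continuous functions:
for each `f`, `K_θ f` depends continuously on `θ` in the supremum norm. -/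
def KernelContinuous {T : Type*} [MeasurableSpace T] [TopologicalSpace T]
    (K : Kernel (E × T) E) : Prop :=
  ∀ (f : E →ᵇ ℝ) (θ₀ : T),
    TendstoUniformly (fun (θ : T) (x : E) => ∫ z, f z ∂(K (x, θ)))
      (fun x => ∫ z, f z ∂(K (x, θ₀))) (𝓝 θ₀)

variable {B : Type*} [NormedAddCommGroup B] [NormedSpace ℝ B] [MeasurableSpace B] {Θ : Set B}

/-- `L` is the Fréchet derivative of `θ ↦ K_θ` at `θ₀`, relative to `Θ`, in the weak operator
sense: it gives the derivative of `θ ↦ m(K_θ f)` for all probability measures `m` and all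
bounded continuous `f`. -/
def IsKernelDeriv (K : Kernel (E × Θ) E) (θ₀ : Θ)
    (L : B →L[ℝ] (E →ᵇ ℝ) →L[ℝ] (E →ᵇ ℝ)) : Prop :=
  ∀ m : Measure E, IsProbabilityMeasure m → ∀ f : E →ᵇ ℝ,
    (fun θ : Θ => (∫ x, ∫ z, f z ∂(K (x, θ)) ∂m) - (∫ x, ∫ z, f z ∂(K (x, θ₀)) ∂m)
        - ∫ x, L ((θ : B) - (θ₀ : B)) f x ∂m)
      =o[𝓝 θ₀] (fun θ : Θ => (θ : B) - (θ₀ : B))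

/-- `ℓ x z` is the density at `z`, with values in the dual of `B`, of the derivative
`L(x, ·)` with respect to `K_θ(x, ·)`. -/
def IsKernelDerivDensity (K : Kernel (E × Θ) E) (θ : Θ)
    (L : B →L[ℝ] (E →ᵇ ℝ) →L[ℝ] (E →ᵇ ℝ)) (ℓ : E → E → (B →L[ℝ] ℝ)) : Prop :=
  ∀ (x : E) (v : B), Integrable (fun z => ℓ x z v) (K (x, θ)) ∧
    ∀ f : E →ᵇ ℝ, L v f x = ∫ z, f z * ℓ x z v ∂(K (x, θ))

/-- `Λ(z) = sup_x ‖ℓ(x, z)‖`. -/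
def Lam (ℓ : E → E → (B →L[ℝ] ℝ)) (z : E) : ℝ≥0∞ := ⨆ x : E, ‖ℓ x z‖ₑ

/-- Near `α` the kernel is differentiable, `Λ_θ` is well defined, and
`(𝔼_{μ,θ} K_{θ'}(Λ_{θ'}^{n+1})(X_{n-1}))^{1/(n+1)}` is bounded, uniformly in `n ≥ 1` and in
`θ`, `θ'`. -/
def DerivMomentCondition (K : Kernel (E × Θ) E) (μ : Measure E) (α : Θ) : Prop :=
  ∃ (r : ℝ) (L : Θ → B →L[ℝ] (E →ᵇ ℝ) →L[ℝ] (E →ᵇ ℝ)) (ℓ : Θ → E → E → (B →L[ℝ] ℝ)),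
    0 < r ∧
    (∀ θ ∈ Metric.ball α r, IsKernelDeriv K θ (L θ) ∧ IsKernelDerivDensity K θ (L θ) (ℓ θ) ∧
      Measurable (Lam (ℓ θ))) ∧
    ∃ M : ℝ≥0, ∀ n : ℕ, 0 < n → ∀ θ ∈ Metric.ball α r, ∀ θ' ∈ Metric.ball α r,
      (∫⁻ x, ∫⁻ z, Lam (ℓ θ') z ^ (n + 1) ∂(K (x (Fin.last (n - 1)), θ'))
        ∂(pathLaw (K.sectL θ) μ (n - 1))) ^ (1 / ((n : ℝ) + 1)) ≤ M

end Parameter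

end AdaptiveFilter

end

/-! Fix a ball `N` of radius `δ` around `α`. The augmented unnormalized filter splits into a part
with parameter in `N` and a part with parameter outside; after normalization the second part
contributes at most the posterior mass of `Nᶜ`. For the first part, restart both filters at time `n
- (j + 1)` from whatever they have become. Over the remaining `j + 1` steps, replacing `K_θ` by
`K_α` costs a factor proportional to `(j + 1) δ` times a product of likelihood-ratio bounds, and two
filters that both use `K_α` differ by a quantity geometric in `j`, because `K_α` is mixing. This is
`tvNorm_marginalFilter_le`. Since the signal is bounded, the product has mean at most `C ^ (j + 1)`,
whatever `n` is. So choose `j`, then `δ`, then let `n` tend to infinity; only the posterior mass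
depends on `n`.

Forgetting (`fkFlow_sandwich`): the filter of `K_α` from any two initial laws satisfies `t b ≤ a ≤ T
b` after one step, reweighting by the likelihood preserves such bounds, and each further kernel step
shrinks `T - t` by the factor `1 - ε ^ 2`.

Dependence on the parameter (`IsKernelDeriv.exists_lintegral_le`): weak differentiability at `α`
bounds the difference quotients for each initial law and each test function. Two applications of
Banach–Steinhaus, over `ℓ¹` combinations of point masses and then over test functions, make the
bound uniform, so `K_θ(x, ·)` is Lipschitz at `α` in total variation, uniformly in `x`.

Posterior consistency (`tendsto_posterior_compl_ball`): for `θ₀ ≠ α` the limiting observation laws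
differ, so some bounded continuous `f` and level `b` separate their means. The empirical mean of
`f(Y_k)` is exponentially unlikely to lie below `b` under `α`, or above `b` under parameters near
`θ₀`. Both bounds come from a Poisson inequality turned into an exponential supermartingale; a
strict inequality survives a small change of the kernel, which gives uniformity near `θ₀`. The prior
mass condition bounds the `1 / p(n)` moment of (true density) / (mixture density), so this ratio is
rarely exponentially large, and the posterior mass near `θ₀` vanishes in mean. Compactness covers
the complement of the ball by finitely many such neighbourhoods. -/

namespace AdaptiveFilter

/-! ### Unnormalized filters as a Feynman–Kac recursion -/

section Flow

variable {S : Type*} [MeasurableSpace S]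

/-- The Feynman–Kac flow of unnormalized filters: move with `κ`, then reweight with `g n`. -/
noncomputable def fkFlow (κ : Kernel S S) (m : Measure S) (g : ℕ → S → ℝ≥0∞) : ℕ → Measure S
  | 0 => m
  | n + 1 => ((fkFlow κ m g n).bind κ).withDensity (g n)

lemma fkFlow_zero (κ : Kernel S S) (m : Measure S) (g : ℕ → S → ℝ≥0∞) :
    fkFlow κ m g 0 = m := rfl

/-- The semigroup property is what allows a filter to be restarted at an intermediate time, with
shifted likelihoods. -/
lemma fkFlow_add (κ : Kernel S S) (m : Measure S) (g : ℕ → S → ℝ≥0∞) (i j : ℕ) :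
    fkFlow κ m g (i + j) = fkFlow κ (fkFlow κ m g i) (fun k => g (i + k)) j := by
  induction j with
  | zero => rfl
  | succ j ih => rw [← add_assoc, fkFlow, fkFlow, ih]

lemma lintegral_fkFlow_succ (κ : Kernel S S) (m : Measure S) {g : ℕ → S → ℝ≥0∞}
    (hg : ∀ n, Measurable (g n)) (n : ℕ) {f : S → ℝ≥0∞} (hf : Measurable f) :
    ∫⁻ x, f x ∂(fkFlow κ m g (n + 1)) = ∫⁻ x, ∫⁻ z, g n z * f z ∂(κ x) ∂(fkFlow κ m g n) := by
  rw [fkFlow, lintegral_withDensity_eq_lintegral_mul _ (hg n) hf,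
    Measure.lintegral_bind κ.measurable.aemeasurable ((hg n).mul hf).aemeasurable]
  rfl

lemma fkFlow_congr (κ : Kernel S S) (m : Measure S) {g g' : ℕ → S → ℝ≥0∞} {n : ℕ}
    (hgg : ∀ k < n, g k = g' k) : fkFlow κ m g n = fkFlow κ m g' n := by
  induction n with
  | zero => rfl
  | succ n ih => rw [fkFlow, fkFlow, ih fun k hk => hgg k (by omega), hgg n (by omega)]

lemma fkFlow_add_measure (κ : Kernel S S) (m m' : Measure S) {g : ℕ → S → ℝ≥0∞}
    (hg : ∀ n, Measurable (g n)) (n : ℕ) :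
    fkFlow κ (m + m') g n = fkFlow κ m g n + fkFlow κ m' g n := by
  induction n with
  | zero => rfl
  | succ n ih =>
    ext A hA
    have h1 : Measurable (A.indicator (1 : S → ℝ≥0∞)) := measurable_one.indicator hA
    simp only [Measure.coe_add, Pi.add_apply]
    rw [← lintegral_indicator_one hA, ← lintegral_indicator_one hA, ← lintegral_indicator_one hA,
      lintegral_fkFlow_succ _ _ hg _ h1, lintegral_fkFlow_succ _ _ hg _ h1,
      lintegral_fkFlow_succ _ _ hg _ h1, ih, lintegral_add_measure]

instance isFiniteMeasure_pathLaw (κ : Kernel S S) [IsMarkovKernel κ] (m : Measure S)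
    [IsFiniteMeasure m] (n : ℕ) : IsFiniteMeasure (pathLaw κ m n) := by
  induction n with
  | zero => rw [pathLaw]; infer_instance
  | succ n ih => rw [pathLaw]; infer_instance

lemma measurable_snoc (n : ℕ) :
    Measurable (fun q : (Fin (n + 1) → S) × S => (Fin.snoc (α := fun _ => S) q.1 q.2 :
      Fin (n + 2) → S)) := by
  rw [measurable_pi_iff]
  intro i
  refine Fin.lastCases ?_ (fun i => ?_) i
  · simpa using measurable_snd
  · simp only [Fin.snoc_castSucc]
    exact (measurable_pi_apply i).comp measurable_fst

lemma lintegral_pathLaw_succ (κ : Kernel S S) [IsMarkovKernel κ] (m : Measure S)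
    [IsFiniteMeasure m] (n : ℕ) {F : (Fin (n + 2) → S) → ℝ≥0∞} (hF : Measurable F) :
    ∫⁻ x, F x ∂(pathLaw κ m (n + 1)) = ∫⁻ x, ∫⁻ z, F (Fin.snoc (α := fun _ => S) x z)
      ∂(κ (x (Fin.last n))) ∂(pathLaw κ m n) := by
  rw [pathLaw, lintegral_map hF (measurable_snoc n),
    Measure.lintegral_compProd (f := fun q => F (Fin.snoc (α := fun _ => S) q.1 q.2))
      (hF.comp (measurable_snoc n))]
  rfl

variable {d : ℕ}

lemma measurable_gaussDensity (σ : ℝ) : Measurable (gaussDensity (d := d) σ) := by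
  unfold gaussDensity; fun_prop

lemma measurable_obsWeight (σ : ℝ) {h : S → Obs d} (hh : Measurable h) (n : ℕ) :
    Measurable (fun p : (Fin n → Obs d) × (Fin (n + 1) → S) => obsWeight σ h p.1 p.2) := by
  unfold obsWeight
  refine Finset.measurable_prod _ fun k _ => (measurable_gaussDensity σ).comp ?_
  exact ((measurable_pi_apply k).comp measurable_fst).sub
    (hh.comp ((measurable_pi_apply _).comp measurable_snd))

lemma measurable_obsWeight_right (σ : ℝ) {h : S → Obs d} (hh : Measurable h) (n : ℕ)
    (y : Fin n → Obs d) : Measurable (fun x : Fin (n + 1) → S => obsWeight σ h y x) := by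
  unfold obsWeight
  refine Finset.measurable_prod _ fun k _ => (measurable_gaussDensity σ).comp ?_
  exact measurable_const.sub (hh.comp (measurable_pi_apply _))

lemma lintegral_unnormalizedFilter (κ : Kernel S S) (m : Measure S) (σ : ℝ)
    {h : S → Obs d} (hh : Measurable h) (n : ℕ) (y : Fin n → Obs d) {f : S → ℝ≥0∞}
    (hf : Measurable f) :
    ∫⁻ x, f x ∂(unnormalizedFilter κ m σ h n y)
      = ∫⁻ x, obsWeight σ h y x * f (x (Fin.last n)) ∂(pathLaw κ m n) := by
  have hw : Measurable (obsWeight (n := n) σ h y) :=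
    measurable_obsWeight_right σ hh n y
  have hl : Measurable (fun x : Fin (n + 1) → S => f (x (Fin.last n))) :=
    hf.comp (measurable_pi_apply _)
  have hm : Measurable (fun x : Fin (n + 1) → S => x (Fin.last n)) := measurable_pi_apply _
  rw [unnormalizedFilter, lintegral_map hf hm]
  exact lintegral_withDensity_eq_lintegral_mul _ hw hl

lemma obsDensity_eq (κ : Kernel S S) (m : Measure S) (σ : ℝ)
    {h : S → Obs d} (hh : Measurable h) (n : ℕ) (y : Fin n → Obs d) :
    obsDensity κ m σ h n y = unnormalizedFilter κ m σ h n y Set.univ := by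
  rw [← lintegral_one, lintegral_unnormalizedFilter _ _ _ hh _ _ measurable_const]
  simp [obsDensity]

/-- Likelihood functions of a sequence of observations. -/
noncomputable def likelihood (σ : ℝ) (h : S → Obs d) (y : ℕ → Obs d) (n : ℕ) (x : S) : ℝ≥0∞ :=
  gaussDensity σ (y n - h x)

lemma measurable_likelihood (σ : ℝ) {h : S → Obs d} (hh : Measurable h) (y : ℕ → Obs d) (n : ℕ) :
    Measurable (likelihood σ h y n) :=
  (measurable_gaussDensity σ).comp (measurable_const.sub hh)

/-- The product of likelihoods factors along the path, so the path-space definition obeys a one-step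
recursion; later estimates are inductions on this recursion. -/
lemma unnormalizedFilter_eq_fkFlow (κ : Kernel S S) [IsMarkovKernel κ] (m : Measure S)
    [IsFiniteMeasure m] (σ : ℝ) {h : S → Obs d} (hh : Measurable h) (y : ℕ → Obs d) (n : ℕ) :
    unnormalizedFilter κ m σ h n (fun k => y k) = fkFlow κ m (likelihood σ h y) n := by
  induction n with
  | zero =>
    ext A hA
    rw [← lintegral_indicator_one hA, lintegral_unnormalizedFilter _ _ _ hh _ _
      (measurable_one.indicator hA), pathLaw, lintegral_map (by
        unfold obsWeight; simp only [Finset.univ_eq_empty, Finset.prod_empty, one_mul]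
        exact (measurable_one.indicator hA).comp (measurable_pi_apply _)) (by fun_prop)]
    simp [obsWeight, fkFlow, lintegral_indicator_one hA]
  | succ n ih =>
    ext A hA
    have h1 : Measurable (A.indicator (1 : S → ℝ≥0∞)) := measurable_one.indicator hA
    have hw : Measurable (obsWeight (n := n) σ h fun k => y k) :=
      measurable_obsWeight_right σ hh n _
    have hw' : Measurable (obsWeight (n := n + 1) σ h fun k => y k) :=
      measurable_obsWeight_right σ hh _ _
    have hl := measurable_likelihood σ hh y n
    have hF : Measurable (fun x : Fin (n + 2) → S => obsWeight (n := n + 1) σ h (fun k => y k) x *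
        A.indicator 1 (x (Fin.last (n + 1)))) := hw'.mul (h1.comp (measurable_pi_apply _))
    have hG : Measurable (fun x : S => ∫⁻ z, likelihood σ h y n z * A.indicator 1 z ∂(κ x)) :=
      (hl.mul h1).lintegral_kernel
    rw [← lintegral_indicator_one hA, ← lintegral_indicator_one hA,
      lintegral_fkFlow_succ _ _ (measurable_likelihood σ hh y) _ h1, ← ih,
      lintegral_unnormalizedFilter _ _ _ hh _ _ h1,
      lintegral_unnormalizedFilter _ _ _ hh _ _ hG, lintegral_pathLaw_succ _ _ _ hF]
    refine lintegral_congr fun x => ?_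
    refine Eq.trans ?_ (lintegral_const_mul _ (hl.mul h1))
    refine lintegral_congr fun z => ?_
    rw [obsWeight, Fin.prod_univ_castSucc]
    simp only [Fin.succ_castSucc, Fin.snoc_castSucc, Fin.succ_last, Fin.snoc_last, Fin.val_last,
      Fin.val_castSucc, obsWeight, likelihood]
    rw [mul_assoc]

end Flow

/-- Extension of a finite sequence of observations to an infinite one. -/
noncomputable def extendObs {d n : ℕ} (y : Fin n → Obs d) (k : ℕ) : Obs d :=
  if hk : k < n then y ⟨k, hk⟩ else 0

lemma extendObs_fin {d n : ℕ} (y : Fin n → Obs d) (k : Fin n) : extendObs y k = y k := by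
  simp [extendObs]

/-! ### Integrating out the observations one at a time -/

section Product

variable {S : Type*} [MeasurableSpace S] {d : ℕ}

lemma unnormalizedFilter_eq (κ : Kernel S S) [IsMarkovKernel κ] (m : Measure S)
    [IsFiniteMeasure m] (σ : ℝ) {h : S → Obs d} (hh : Measurable h) {n : ℕ} (y : Fin n → Obs d) :
    unnormalizedFilter κ m σ h n y = fkFlow κ m (likelihood σ h (extendObs y)) n := by
  rw [← unnormalizedFilter_eq_fkFlow κ m σ hh]
  simp only [extendObs_fin]

/-- The filter up to time `n` does not see the last observation `v`, so `v` can be integrated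
separately. -/
lemma lintegral_unnormalizedFilter_snoc (κ : Kernel S S) [IsMarkovKernel κ] (m : Measure S)
    [IsFiniteMeasure m] (σ : ℝ) {h : S → Obs d} (hh : Measurable h) {n : ℕ} (y : Fin n → Obs d)
    (v : Obs d) {f : S → ℝ≥0∞} (hf : Measurable f) :
    ∫⁻ x, f x ∂(unnormalizedFilter κ m σ h (n + 1) (Fin.snoc (α := fun _ => Obs d) y v))
      = ∫⁻ x, ∫⁻ z, gaussDensity σ (v - h z) * f z ∂(κ x) ∂(unnormalizedFilter κ m σ h n y) := by
  rw [unnormalizedFilter_eq κ m σ hh, lintegral_fkFlow_succ _ _ (measurable_likelihood σ hh _) _ hf,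
    unnormalizedFilter_eq κ m σ hh]
  have h1 : extendObs (Fin.snoc (α := fun _ => Obs d) y v) n = v := by
    simp [extendObs, Fin.snoc]
  have h2 : fkFlow κ m (likelihood σ h (extendObs (Fin.snoc (α := fun _ => Obs d) y v))) n
      = fkFlow κ m (likelihood σ h (extendObs y)) n := by
    refine fkFlow_congr _ _ fun k hk => ?_
    ext x
    simp [likelihood, extendObs, Fin.snoc, hk, Nat.lt_succ_of_lt hk]
  rw [h2]
  simp only [likelihood, h1]

lemma measurable_lintegral_unnormalizedFilter (κ : Kernel S S) [IsMarkovKernel κ] (m : Measure S)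
    [IsFiniteMeasure m] (σ : ℝ) {h : S → Obs d} (hh : Measurable h) (n : ℕ)
    {f : S → ℝ≥0∞} (hf : Measurable f) :
    Measurable (fun y => ∫⁻ x, f x ∂(unnormalizedFilter κ m σ h n y)) := by
  simp only [lintegral_unnormalizedFilter κ m σ hh n _ hf]
  have hF : Measurable (fun p : (Fin n → Obs d) × (Fin (n + 1) → S) =>
      obsWeight σ h p.1 p.2 * f (p.2 (Fin.last n))) :=
    (measurable_obsWeight σ hh n).mul (hf.comp ((measurable_pi_apply _).comp measurable_snd))
  exact hF.lintegral_prod_right'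

lemma measurable_obsDensity (κ : Kernel S S) [IsMarkovKernel κ] (m : Measure S)
    [IsFiniteMeasure m] (σ : ℝ) {h : S → Obs d} (hh : Measurable h) (n : ℕ) :
    Measurable (obsDensity κ m σ h n) :=
  (measurable_obsWeight σ hh n).lintegral_prod_right'

lemma lintegral_fin_succ (n : ℕ) (F : (Fin (n + 1) → Obs d) → ℝ≥0∞) (hF : Measurable F) :
    ∫⁻ y, F y = ∫⁻ y : Fin n → Obs d, ∫⁻ v : Obs d, F (Fin.snoc (α := fun _ => Obs d) y v) := by
  have e := (volume_preserving_piFinSuccAbove (fun _ : Fin (n + 1) => Obs d) (Fin.last n)).symm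
  rw [← e.lintegral_comp hF, Measure.volume_eq_prod,
    lintegral_prod_symm' (fun a => F ((MeasurableEquiv.piFinSuccAbove
      (fun _ : Fin (n + 1) => Obs d) (Fin.last n)).symm a)) (hF.comp e.measurable)]
  refine lintegral_congr fun y => lintegral_congr fun v => ?_
  congr 1
  exact Fin.insertNth_last (α := fun _ => Obs d) v y

/-- Product-form functionals of the observations are controlled by a one-step inequality. -/
lemma lintegral_prod_mul_unnormalizedFilter_le (κ : Kernel S S) [IsMarkovKernel κ]
    (m : Measure S) [IsFiniteMeasure m] (σ : ℝ) {h : S → Obs d} (hh : Measurable h)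
    {w : ℕ → Obs d → ℝ≥0∞} (hw : ∀ k, Measurable (w k)) {φ : S → ℝ≥0∞} (hφ : Measurable φ)
    (c : ℕ → ℝ≥0∞)
    (hc : ∀ k x, ∫⁻ z, (φ z * ∫⁻ v : Obs d, gaussDensity σ (v - h z) * w k v) ∂(κ x) ≤ c k * φ x) (n : ℕ) :
    ∫⁻ y : Fin n → Obs d, (∏ k : Fin _, w k (y k)) * ∫⁻ x, φ x ∂(unnormalizedFilter κ m σ h n y)
      ≤ (∏ k ∈ Finset.range n, c k) * ∫⁻ x, φ x ∂m := by
  induction n with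
  | zero =>
    simp [unnormalizedFilter_eq κ m σ hh, fkFlow_zero, volume_pi]
  | succ n ih =>
    have hprod : ∀ n, Measurable fun y : Fin n → Obs d => ∏ k : Fin n, w k (y k) := fun n =>
      Finset.measurable_prod _ fun k _ => (hw k).comp (measurable_pi_apply k)
    have hg : Measurable fun p : S × Obs d => gaussDensity σ (p.2 - h p.1) :=
      (measurable_gaussDensity σ).comp (measurable_snd.sub (hh.comp measurable_fst))
    have hmeas : ∀ n, Measurable fun y : Fin n → Obs d => (∏ k : Fin n, w k (y k)) *
        ∫⁻ x, φ x ∂(unnormalizedFilter κ m σ h n y) := fun n =>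
      (hprod _).mul (measurable_lintegral_unnormalizedFilter κ m σ hh _ hφ)
    rw [lintegral_fin_succ _ _ (hmeas _)]
    -- With the earlier observations fixed, Tonelli moves the integral over the last observation
    -- next to the new state `z`; the resulting inner integral is the left side of `hc`.
    have key : ∀ y : Fin n → Obs d,
        ∫⁻ v, (∏ k : Fin _, w k (Fin.snoc (α := fun _ => Obs d) y v k)) *
          ∫⁻ x, φ x ∂(unnormalizedFilter κ m σ h (n + 1) (Fin.snoc (α := fun _ => Obs d) y v))
        ≤ c n * ((∏ k : Fin _, w k (y k)) * ∫⁻ x, φ x ∂(unnormalizedFilter κ m σ h n y)) := by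
      intro y
      have : SFinite (unnormalizedFilter κ m σ h n y) := by
        unfold unnormalizedFilter; infer_instance
      have hjoint : Measurable fun q : Obs d × S =>
          ∫⁻ z, gaussDensity σ (q.1 - h z) * φ z ∂(κ q.2) := by
        have : Measurable fun r : (Obs d × S) × S => gaussDensity σ (r.1.1 - h r.2) * φ r.2 :=
          ((measurable_gaussDensity σ).comp ((measurable_fst.comp measurable_fst).sub
            (hh.comp measurable_snd))).mul (hφ.comp measurable_snd)
        exact Measurable.lintegral_kernel_prod_right' (κ := κ.comap Prod.snd measurable_snd) this
      calc _ = ∫⁻ v, (∏ k : Fin _, w k (y k)) * (∫⁻ x, (w n v * ∫⁻ z, gaussDensity σ (v - h z) * φ z ∂(κ x))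
              ∂(unnormalizedFilter κ m σ h n y)) := by
            refine lintegral_congr fun v => ?_
            have hv : Measurable fun x => ∫⁻ z, gaussDensity σ (v - h z) * φ z ∂(κ x) :=
              hjoint.comp (measurable_const.prodMk measurable_id)
            rw [lintegral_unnormalizedFilter_snoc κ m σ hh y v hφ, Fin.prod_univ_castSucc,
              lintegral_const_mul _ hv]
            simp [mul_assoc]
        _ = (∏ k : Fin _, w k (y k)) * ∫⁻ x, (∫⁻ v, w n v * ∫⁻ z, gaussDensity σ (v - h z) * φ z ∂(κ x))
              ∂(unnormalizedFilter κ m σ h n y) := by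
            have hm : Measurable fun q : Obs d × S =>
              w n q.1 * ∫⁻ z, gaussDensity σ (q.1 - h z) * φ z ∂(κ q.2) :=
                ((hw n).comp measurable_fst).mul hjoint
            rw [lintegral_const_mul _ hm.lintegral_prod_right', lintegral_lintegral_swap]
            exact hm.aemeasurable
        _ ≤ (∏ k : Fin _, w k (y k)) * ∫⁻ x, c n * φ x ∂(unnormalizedFilter κ m σ h n y) := by
            gcongr with x
            refine le_trans (le_of_eq ?_) (hc n x)
            have h1 : ∀ v, w n v * ∫⁻ z, gaussDensity σ (v - h z) * φ z ∂(κ x)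
                = ∫⁻ z, φ z * (gaussDensity σ (v - h z) * w n v) ∂(κ x) := by
              intro v
              have hz : Measurable fun z => gaussDensity σ (v - h z) * φ z :=
                (hg.comp (measurable_id.prodMk measurable_const)).mul hφ
              rw [← lintegral_const_mul _ hz]
              exact lintegral_congr fun z => by ring
            simp only [h1]
            rw [lintegral_lintegral_swap]
            · refine lintegral_congr fun z => ?_
              have hv : Measurable fun v => gaussDensity σ (v - h z) * w n v :=
                (hg.comp (measurable_const.prodMk measurable_id)).mul (hw n)
              rw [lintegral_const_mul _ hv]
            · refine Measurable.aemeasurable ?_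
              exact (hφ.comp measurable_snd).mul ((hg.comp measurable_swap).mul
                ((hw n).comp measurable_fst))
        _ = _ := by
            rw [lintegral_const_mul _ hφ]; ring
    calc _ ≤ ∫⁻ y : Fin n → Obs d,
          c n * ((∏ k : Fin _, w k (y k)) * ∫⁻ x, φ x ∂(unnormalizedFilter κ m σ h n y)) :=
          lintegral_mono fun y => key y
      _ = c n * ∫⁻ y : Fin n → Obs d, (∏ k : Fin _, w k (y k)) *
            ∫⁻ x, φ x ∂(unnormalizedFilter κ m σ h n y) :=
          lintegral_const_mul _ (hmeas n)
      _ ≤ c n * ((∏ k ∈ Finset.range n, c k) * ∫⁻ x, φ x ∂m) := by gcongr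
      _ = _ := by rw [Finset.prod_range_succ]; ring

end Product

/-! ### Gaussian likelihoods for a bounded signal -/

section Gaussian

variable {d : ℕ}

lemma gaussDensity_pos {σ : ℝ} (hσ : 0 < σ) (v : Obs d) : 0 < gaussDensity σ v := by
  unfold gaussDensity
  rw [ENNReal.ofReal_pos]
  positivity

lemma gaussDensity_ne_top (σ : ℝ) (v : Obs d) : gaussDensity σ v ≠ ⊤ := ENNReal.ofReal_ne_top

lemma gaussDensity_le {σ : ℝ} (hσ : 0 < σ) (v : Obs d) :
    gaussDensity σ v ≤ ENNReal.ofReal ((2 * Real.pi * σ ^ 2) ^ (-(d : ℝ) / 2)) := by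
  unfold gaussDensity
  refine ENNReal.ofReal_le_ofReal (mul_le_of_le_one_right (by positivity) ?_)
  rw [Real.exp_le_one_iff]
  exact div_nonpos_of_nonpos_of_nonneg (by simp) (by positivity)

lemma lintegral_exp_neg_mul_norm_sq {b : ℝ} (hb : 0 < b) :
    ∫⁻ v : Obs d, ENNReal.ofReal (Real.exp (-b * ‖v‖ ^ 2))
      = ENNReal.ofReal ((Real.pi / b) ^ ((d : ℝ) / 2)) := by
  have h0 := GaussianFourier.integral_rexp_neg_mul_sq_norm (V := Obs d) hb
  -- A non-integrable function would have Bochner integral `0`, but the closed formula is positive.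
  have hint : Integrable (fun v : Obs d => Real.exp (-b * ‖v‖ ^ 2)) := by
    by_contra hcon
    rw [integral_undef hcon] at h0
    have : 0 < (Real.pi / b) ^ ((Module.finrank ℝ (Obs d) : ℝ) / 2) := by positivity
    exact this.ne h0
  rw [← ofReal_integral_eq_lintegral_ofReal hint (ae_of_all _ fun v => (Real.exp_pos _).le), h0]
  simp

lemma lintegral_gaussDensity {σ : ℝ} (hσ : 0 < σ) :
    ∫⁻ v : Obs d, gaussDensity σ v = 1 := by
  have h1 : ∀ v : Obs d, gaussDensity σ v = ENNReal.ofReal ((2 * Real.pi * σ ^ 2) ^ (-(d : ℝ) / 2))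
      * ENNReal.ofReal (Real.exp (-(1 / (2 * σ ^ 2)) * ‖v‖ ^ 2)) := by
    intro v
    rw [gaussDensity, ENNReal.ofReal_mul (by positivity)]
    congr 3
    ring
  simp only [h1]
  rw [lintegral_const_mul _ (by fun_prop), lintegral_exp_neg_mul_norm_sq (by positivity),
    ← ENNReal.ofReal_mul (by positivity)]
  have : Real.pi / (1 / (2 * σ ^ 2)) = 2 * Real.pi * σ ^ 2 := by field_simp
  rw [this, ← Real.rpow_add (by positivity)]
  simp [neg_div]

instance isProbabilityMeasure_noiseLaw (d : ℕ) (σ : ℝ) [hσ : Fact (0 < σ)] :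
    IsProbabilityMeasure (noiseLaw d σ) :=
  ⟨by rw [noiseLaw, withDensity_apply _ MeasurableSet.univ, Measure.restrict_univ,
    lintegral_gaussDensity hσ.out]⟩

lemma lintegral_gaussDensity_sub {σ : ℝ} (hσ : 0 < σ) (x : Obs d) :
    ∫⁻ v : Obs d, gaussDensity σ (v - x) = 1 := by
  rw [lintegral_sub_right_eq_self (fun v => gaussDensity σ v) x, lintegral_gaussDensity hσ]

/-- A bound for the likelihood ratios when the signal is bounded by `H`. -/
noncomputable def ratioBound (σ H : ℝ) (y : Obs d) : ℝ≥0∞ :=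
  ENNReal.ofReal (Real.exp ((2 * H * ‖y‖ + H ^ 2) / (2 * σ ^ 2)))

lemma measurable_ratioBound (σ H : ℝ) : Measurable (ratioBound (d := d) σ H) := by
  unfold ratioBound; fun_prop

lemma ratioBound_ne_top (σ H : ℝ) (y : Obs d) : ratioBound σ H y ≠ ⊤ := ENNReal.ofReal_ne_top

lemma ratioBound_ne_zero (σ H : ℝ) (y : Obs d) : ratioBound σ H y ≠ 0 := by
  unfold ratioBound
  rw [Ne, ENNReal.ofReal_eq_zero, not_le]
  positivity

/-- A shift of size at most `H` lowers `‖y‖ ^ 2` by at most `2 * H * ‖y‖ + H ^ 2`. Together with the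
reverse bound, this compares every likelihood with the one at signal `0`. -/
lemma gaussDensity_sub_le {σ H : ℝ} (hσ : 0 < σ) {x : Obs d} (hx : ‖x‖ ≤ H) (y : Obs d) :
    gaussDensity σ (y - x) ≤ gaussDensity σ y * ratioBound σ H y := by
  rw [gaussDensity, gaussDensity, ratioBound, ← ENNReal.ofReal_mul (by positivity)]
  refine ENNReal.ofReal_le_ofReal ?_
  rw [mul_assoc ((2 * Real.pi * σ ^ 2) ^ (-(d : ℝ) / 2)),
    ← Real.exp_add, ← add_div]
  gcongr
  have h1 : ‖y‖ ≤ ‖y - x‖ + ‖x‖ := by simpa using norm_add_le (y - x) x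
  have h2 := norm_nonneg (y - x)
  have h3 := norm_nonneg x
  have h4 := norm_nonneg y
  have h5 : ‖y‖ - H ≤ ‖y - x‖ := by linarith
  rcases le_or_gt H ‖y‖ with h6 | h6
  · nlinarith [mul_self_le_mul_self (sub_nonneg.2 h6) h5]
  · nlinarith

lemma gaussDensity_le_sub {σ H : ℝ} (hσ : 0 < σ) {x : Obs d} (hx : ‖x‖ ≤ H) (y : Obs d) :
    gaussDensity σ y ≤ gaussDensity σ (y - x) * ratioBound σ H y := by
  rw [gaussDensity, gaussDensity, ratioBound, ← ENNReal.ofReal_mul (by positivity)]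
  refine ENNReal.ofReal_le_ofReal ?_
  rw [mul_assoc ((2 * Real.pi * σ ^ 2) ^ (-(d : ℝ) / 2)),
    ← Real.exp_add, ← add_div]
  gcongr
  have h1 : ‖y - x‖ ≤ ‖y‖ + H := (norm_sub_le y x).trans (by linarith)
  nlinarith [mul_self_le_mul_self (norm_nonneg (y - x)) h1]

/-- The ratio bound grows only like the exponential of a multiple of `‖v‖`, so the Gaussian absorbs
its square. The constant is uniform over bounded signals, hence over time. -/
lemma exists_lintegral_ratioBound_sq_le {σ : ℝ} (hσ : 0 < σ) (H : ℝ) :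
    ∃ C : ℝ≥0∞, C ≠ ⊤ ∧ ∀ x : Obs d, ‖x‖ ≤ H →
      ∫⁻ v : Obs d, gaussDensity σ (v - x) * ratioBound σ H v ^ 2 ≤ C := by
  refine ⟨ENNReal.ofReal ((2 * Real.pi * σ ^ 2) ^ (-(d : ℝ) / 2) *
    Real.exp ((21 / 2 * H ^ 2) / σ ^ 2)) *
      ENNReal.ofReal ((Real.pi / (1 / (4 * σ ^ 2))) ^ ((d : ℝ) / 2)),
    ENNReal.mul_ne_top ENNReal.ofReal_ne_top ENNReal.ofReal_ne_top, fun x hx => ?_⟩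
  rw [← lintegral_exp_neg_mul_norm_sq (by positivity), ← lintegral_const_mul _ (by fun_prop)]
  refine lintegral_mono fun v => ?_
  calc gaussDensity σ (v - x) * ratioBound σ H v ^ 2
      ≤ gaussDensity σ v * ratioBound σ H v * ratioBound σ H v ^ 2 := by
        gcongr; exact gaussDensity_sub_le hσ hx v
    _ = gaussDensity σ v * ratioBound σ H v ^ 3 := by ring
    _ ≤ _ := by
        rw [gaussDensity, ratioBound, ← ENNReal.ofReal_pow (by positivity), ← Real.exp_nat_mul,
          ← ENNReal.ofReal_mul (by positivity), ← ENNReal.ofReal_mul (by positivity)]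
        refine ENNReal.ofReal_le_ofReal ?_
        rw [mul_assoc ((2 * Real.pi * σ ^ 2) ^ (-(d : ℝ) / 2)),
          mul_assoc ((2 * Real.pi * σ ^ 2) ^ (-(d : ℝ) / 2)), ← Real.exp_add, ← Real.exp_add]
        refine mul_le_mul_of_nonneg_left (Real.exp_le_exp.2 ?_) (by positivity)
        rw [show -‖v‖ ^ 2 / (2 * σ ^ 2) + ((3 : ℕ) : ℝ) * ((2 * H * ‖v‖ + H ^ 2) / (2 * σ ^ 2))
          = (-‖v‖ ^ 2 / 2 + 3 * H * ‖v‖ + 3 / 2 * H ^ 2) / σ ^ 2 by push_cast; field_simp; ring,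
          show 21 / 2 * H ^ 2 / σ ^ 2 + -(1 / (4 * σ ^ 2)) * ‖v‖ ^ 2
          = (21 / 2 * H ^ 2 - ‖v‖ ^ 2 / 4) / σ ^ 2 by field_simp; ring]
        gcongr
        -- Completing the square trades `3 * H * ‖v‖` for `‖v‖ ^ 2 / 4 + 9 * H ^ 2`; hence `21 / 2 =
        -- 9 + 3 / 2`.
        nlinarith [sq_nonneg (‖v‖ / 2 - 3 * H)]

end Gaussian

/-! ### Mass bounds for Feynman–Kac flows -/

section Flow

variable {S : Type*} [MeasurableSpace S]

lemma fkFlow_smul (κ : Kernel S S) (c : ℝ≥0∞) (m : Measure S) {g : ℕ → S → ℝ≥0∞}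
    (hg : ∀ n, Measurable (g n)) (n : ℕ) :
    fkFlow κ (c • m) g n = c • fkFlow κ m g n := by
  induction n with
  | zero => rfl
  | succ n ih =>
    ext A hA
    have h1 : Measurable (A.indicator (1 : S → ℝ≥0∞)) := measurable_one.indicator hA
    rw [Measure.smul_apply, ← lintegral_indicator_one hA, ← lintegral_indicator_one hA,
      lintegral_fkFlow_succ _ _ hg _ h1, lintegral_fkFlow_succ _ _ hg _ h1, ih,
      lintegral_smul_measure]

lemma fkFlow_univ_succ (κ : Kernel S S) (m : Measure S) {g : ℕ → S → ℝ≥0∞}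
    (hg : ∀ n, Measurable (g n)) (n : ℕ) :
    fkFlow κ m g (n + 1) Set.univ = ∫⁻ x, ∫⁻ z, g n z ∂(κ x) ∂(fkFlow κ m g n) := by
  rw [← lintegral_one, lintegral_fkFlow_succ _ _ hg _ measurable_const]
  simp

lemma fkFlow_univ_le (κ : Kernel S S) [IsMarkovKernel κ] (m : Measure S) {g : ℕ → S → ℝ≥0∞}
    (hg : ∀ n, Measurable (g n)) {G : ℕ → ℝ≥0∞} (hG : ∀ n x, g n x ≤ G n) (n : ℕ) :
    fkFlow κ m g n Set.univ ≤ (∏ k ∈ Finset.range n, G k) * m Set.univ := by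
  induction n with
  | zero => simp [fkFlow_zero]
  | succ n ih =>
    rw [fkFlow_univ_succ κ m hg]
    calc ∫⁻ x, ∫⁻ z, g n z ∂(κ x) ∂(fkFlow κ m g n)
        ≤ ∫⁻ x, ∫⁻ _, G n ∂(κ x) ∂(fkFlow κ m g n) := by gcongr with x z; exact hG n z
      _ = G n * fkFlow κ m g n Set.univ := by simp
      _ ≤ G n * ((∏ k ∈ Finset.range n, G k) * m Set.univ) := by gcongr
      _ = _ := by rw [Finset.prod_range_succ]; ring

lemma le_fkFlow_univ (κ : Kernel S S) [IsMarkovKernel κ] (m : Measure S) {g : ℕ → S → ℝ≥0∞}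
    (hg : ∀ n, Measurable (g n)) {G : ℕ → ℝ≥0∞} (hG : ∀ n x, G n ≤ g n x) (n : ℕ) :
    (∏ k ∈ Finset.range n, G k) * m Set.univ ≤ fkFlow κ m g n Set.univ := by
  induction n with
  | zero => simp [fkFlow_zero]
  | succ n ih =>
    rw [fkFlow_univ_succ κ m hg]
    calc _ = G n * ((∏ k ∈ Finset.range n, G k) * m Set.univ) := by
          rw [Finset.prod_range_succ]; ring
      _ ≤ G n * fkFlow κ m g n Set.univ := by gcongr
      _ = ∫⁻ x, ∫⁻ _, G n ∂(κ x) ∂(fkFlow κ m g n) := by simp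
      _ ≤ _ := by gcongr with x z; exact hG n z

lemma isFiniteMeasure_fkFlow (κ : Kernel S S) [IsMarkovKernel κ] (m : Measure S)
    [IsFiniteMeasure m] {g : ℕ → S → ℝ≥0∞} (hg : ∀ n, Measurable (g n)) {G : ℕ → ℝ≥0∞}
    (hG' : ∀ n, G n ≠ ⊤) (hG : ∀ n x, g n x ≤ G n) (n : ℕ) :
    IsFiniteMeasure (fkFlow κ m g n) :=
  ⟨(fkFlow_univ_le κ m hg hG n).trans_lt (ENNReal.mul_lt_top
    (ENNReal.prod_lt_top fun k _ => (hG' k).lt_top) (measure_lt_top _ _))⟩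

end Flow

/-! ### Mixing kernels forget the initial law -/

section Contraction

variable {S : Type*} [MeasurableSpace S]

/-- The mixing condition in terms of real numbers. -/
def MixingWith (κ : Kernel S S) (ε : ℝ) (lam : Measure S) : Prop :=
  ∀ (x : S) (A : Set S), MeasurableSet A →
    ε * lam.real A ≤ (κ x).real A ∧ ε * (κ x).real A ≤ lam.real A

lemma IsMixing.exists_mixingWith {κ : Kernel S S} [IsMarkovKernel κ] (hκ : IsMixing κ) :
    ∃ (ε : ℝ) (lam : Measure S), 0 < ε ∧ ε ≤ 1 ∧ IsFiniteMeasure lam ∧ MixingWith κ ε lam := by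
  obtain ⟨ε, h0, h1, lam, hfin, h⟩ := hκ
  refine ⟨ε, lam, h0, h1, hfin, fun x A hA => ⟨?_, ?_⟩⟩
  · have := ENNReal.toReal_mono (measure_ne_top _ _) (h x A hA).1
    simpa [ENNReal.toReal_mul, measureReal_def] using this
  · have h2 : (ε : ℝ≥0∞) * κ x A ≤ lam A := by
      have hε : (ε : ℝ≥0∞) ≠ 0 := by simpa using h0.ne'
      calc (ε : ℝ≥0∞) * κ x A ≤ ε * ((ε : ℝ≥0∞)⁻¹ * lam A) := by gcongr; exact (h x A hA).2
        _ = lam A := by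
          rw [← mul_assoc, ENNReal.mul_inv_cancel hε ENNReal.coe_ne_top, one_mul]
    have := ENNReal.toReal_mono (measure_ne_top _ _) h2
    simpa [ENNReal.toReal_mul, measureReal_def] using this

lemma measureReal_bind (κ : Kernel S S) [IsMarkovKernel κ] (a : Measure S) {A : Set S}
    (hA : MeasurableSet A) : (a.bind κ).real A = ∫ x, (κ x).real A ∂a := by
  rw [measureReal_def, Measure.bind_apply hA κ.measurable.aemeasurable, integral_eq_lintegral_of_nonneg_ae]
  · simp
  · exact ae_of_all _ fun x => measureReal_nonneg
  · exact (κ.measurable_coe hA).ennreal_toReal.aestronglyMeasurable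

lemma ofReal_smul_le_iff {a b : Measure S} [IsFiniteMeasure a] [IsFiniteMeasure b] {t : ℝ}
    (ht : 0 ≤ t) : ENNReal.ofReal t • b ≤ a ↔ ∀ A, MeasurableSet A → t * b.real A ≤ a.real A := by
  rw [Measure.le_iff]
  refine forall₂_congr fun A _ => ?_
  rw [Measure.smul_apply, smul_eq_mul, ← ENNReal.toReal_le_toReal
    (ENNReal.mul_ne_top ENNReal.ofReal_ne_top (measure_ne_top _ _)) (measure_ne_top _ _),
    ENNReal.toReal_mul, ENNReal.toReal_ofReal ht]
  rfl

lemma le_ofReal_smul_iff {a b : Measure S} [IsFiniteMeasure a] [IsFiniteMeasure b] {t : ℝ}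
    (ht : 0 ≤ t) : a ≤ ENNReal.ofReal t • b ↔ ∀ A, MeasurableSet A → a.real A ≤ t * b.real A := by
  rw [Measure.le_iff]
  refine forall₂_congr fun A _ => ?_
  rw [Measure.smul_apply, smul_eq_mul, ← ENNReal.toReal_le_toReal (measure_ne_top _ _)
    (ENNReal.mul_ne_top ENNReal.ofReal_ne_top (measure_ne_top _ _)),
    ENNReal.toReal_mul, ENNReal.toReal_ofReal ht]
  rfl

lemma integral_sub_const_kernel (κ : Kernel S S) [IsMarkovKernel κ] (a : Measure S)
    [IsFiniteMeasure a] {A : Set S} (hA : MeasurableSet A) (c : ℝ) :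
    Integrable (fun x => (κ x).real A - c) a ∧
    ∫ x, ((κ x).real A - c) ∂a = (a.bind κ).real A - c * a.real Set.univ := by
  have hi : Integrable (fun x => (κ x).real A) a := by
    refine Integrable.of_bound (κ.measurable_coe hA).ennreal_toReal.aestronglyMeasurable 1
      (ae_of_all _ fun x => ?_)
    rw [Real.norm_of_nonneg measureReal_nonneg]
    exact measureReal_le_one
  refine ⟨hi.sub (integrable_const _), ?_⟩
  rw [integral_sub hi (integrable_const _), measureReal_bind κ a hA, integral_const, smul_eq_mul,
    mul_comm]

lemma withDensity_mono_left {m m' : Measure S} (hm : m ≤ m') (f : S → ℝ≥0∞) :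
    m.withDensity f ≤ m'.withDensity f := by
  refine Measure.le_iff.2 fun A hA => ?_
  rw [withDensity_apply _ hA, withDensity_apply _ hA]
  exact lintegral_mono' (Measure.restrict_mono_measure hm A) le_rfl

variable {κ : Kernel S S} [IsMarkovKernel κ] {ε : ℝ} {lam : Measure S}

/-- The excess `a - t b` is nonnegative, and one kernel step spreads its mass over at least `ε lam`,
which dominates `ε ^ 2` times the normalized image of `b`. So `t` moves the fraction `ε ^ 2` of the
way to the ratio of total masses. `mixing_upper` is the mirror image. -/
lemma mixing_lower (hε : 0 < ε) (hκ : MixingWith κ ε lam) {a b : Measure S} [IsFiniteMeasure a]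
    [IsFiniteMeasure b] {t : ℝ} (ht : 0 ≤ t) (hab : ENNReal.ofReal t • b ≤ a)
    (hb : 0 < b.real Set.univ) {A : Set S} (hA : MeasurableSet A) :
    (t + ε ^ 2 * (a.real Set.univ / b.real Set.univ - t)) * (b.bind κ).real A
      ≤ (a.bind κ).real A := by
  obtain ⟨ia, ea⟩ := integral_sub_const_kernel κ a hA (ε * lam.real A)
  obtain ⟨ib, eb⟩ := integral_sub_const_kernel κ b hA (ε * lam.real A)
  have h1 : t * ∫ x, ((κ x).real A - ε * lam.real A) ∂b
      ≤ ∫ x, ((κ x).real A - ε * lam.real A) ∂a := by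
    have := integral_mono_measure hab
      (ae_of_all _ fun x => sub_nonneg.2 (hκ x A hA).1) ia
    rwa [integral_smul_measure, ENNReal.toReal_ofReal ht, smul_eq_mul] at this
  have h2 : t * b.real Set.univ ≤ a.real Set.univ :=
    (ofReal_smul_le_iff ht).1 hab _ MeasurableSet.univ
  have h3 : ε * (b.bind κ).real A ≤ lam.real A * b.real Set.univ := by
    rw [measureReal_bind κ b hA, ← integral_const_mul]
    calc ∫ x, ε * (κ x).real A ∂b ≤ ∫ _, lam.real A ∂b := by
          refine integral_mono_of_nonneg (ae_of_all _ fun x => by positivity)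
            (integrable_const _) (ae_of_all _ fun x => (hκ x A hA).2)
      _ = _ := by rw [integral_const, smul_eq_mul, mul_comm]
  rw [ea, eb] at h1
  have h4 : a.real Set.univ / b.real Set.univ - t = (a.real Set.univ - t * b.real Set.univ)
      / b.real Set.univ := by field_simp
  have h5 : ε ^ 2 * (a.real Set.univ / b.real Set.univ - t) * (b.bind κ).real A
      ≤ ε * lam.real A * (a.real Set.univ - t * b.real Set.univ) := by
    rw [h4]
    calc _ = ε * (a.real Set.univ - t * b.real Set.univ) *
          ((ε * (b.bind κ).real A) / b.real Set.univ) := by ring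
      _ ≤ ε * (a.real Set.univ - t * b.real Set.univ) * lam.real A := by
          refine mul_le_mul_of_nonneg_left ?_ (mul_nonneg hε.le (sub_nonneg.2 h2))
          rwa [div_le_iff₀ hb]
      _ = _ := by ring
  nlinarith

lemma mixing_upper (hε : 0 < ε) (hκ : MixingWith κ ε lam) {a b : Measure S} [IsFiniteMeasure a]
    [IsFiniteMeasure b] {t : ℝ} (ht : 0 ≤ t) (hab : a ≤ ENNReal.ofReal t • b)
    (hb : 0 < b.real Set.univ) {A : Set S} (hA : MeasurableSet A) :
    (a.bind κ).real A
      ≤ (t - ε ^ 2 * (t - a.real Set.univ / b.real Set.univ)) * (b.bind κ).real A := by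
  obtain ⟨ia, ea⟩ := integral_sub_const_kernel κ a hA (ε * lam.real A)
  obtain ⟨ib, eb⟩ := integral_sub_const_kernel κ b hA (ε * lam.real A)
  have h1 : ∫ x, ((κ x).real A - ε * lam.real A) ∂a
      ≤ t * ∫ x, ((κ x).real A - ε * lam.real A) ∂b := by
    have := integral_mono_measure hab
      (ae_of_all _ fun x => sub_nonneg.2 (hκ x A hA).1) (ib.smul_measure ENNReal.ofReal_ne_top)
    rwa [integral_smul_measure, ENNReal.toReal_ofReal ht, smul_eq_mul] at this
  have h2 : a.real Set.univ ≤ t * b.real Set.univ :=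
    (le_ofReal_smul_iff ht).1 hab _ MeasurableSet.univ
  have h3 : ε * (b.bind κ).real A ≤ lam.real A * b.real Set.univ := by
    rw [measureReal_bind κ b hA, ← integral_const_mul]
    calc ∫ x, ε * (κ x).real A ∂b ≤ ∫ _, lam.real A ∂b := by
          refine integral_mono_of_nonneg (ae_of_all _ fun x => by positivity)
            (integrable_const _) (ae_of_all _ fun x => (hκ x A hA).2)
      _ = _ := by rw [integral_const, smul_eq_mul, mul_comm]
  rw [ea, eb] at h1
  have h4 : t - a.real Set.univ / b.real Set.univ = (t * b.real Set.univ - a.real Set.univ)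
      / b.real Set.univ := by field_simp
  have h5 : ε ^ 2 * (t - a.real Set.univ / b.real Set.univ) * (b.bind κ).real A
      ≤ ε * lam.real A * (t * b.real Set.univ - a.real Set.univ) := by
    rw [h4]
    calc _ = ε * (t * b.real Set.univ - a.real Set.univ) *
          ((ε * (b.bind κ).real A) / b.real Set.univ) := by ring
      _ ≤ ε * (t * b.real Set.univ - a.real Set.univ) * lam.real A := by
          refine mul_le_mul_of_nonneg_left ?_ (mul_nonneg hε.le (sub_nonneg.2 h2))
          rwa [div_le_iff₀ hb]
      _ = _ := by ring
  nlinarith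

/-- Two flows of unnormalized filters become proportional at a geometric rate. -/
lemma fkFlow_sandwich (hε : 0 < ε) (hε1 : ε ≤ 1) [IsFiniteMeasure lam]
    (hκ : MixingWith κ ε lam) {a b : Measure S}
    [IsProbabilityMeasure a] [IsProbabilityMeasure b] {g : ℕ → S → ℝ≥0∞}
    (hg : ∀ n, Measurable (g n)) {G G' : ℕ → ℝ≥0∞} (hG' : ∀ n, G n ≠ ⊤) (hG : ∀ n x, g n x ≤ G n)
    (hG0 : ∀ n, G' n ≠ 0) (hGl : ∀ n x, G' n ≤ g n x) (j : ℕ) :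
    ∃ t T : ℝ, ε ^ 2 ≤ t ∧ T - t ≤ (ε ^ 2)⁻¹ * (1 - ε ^ 2) ^ j ∧
      (∀ A, MeasurableSet A →
        t * (fkFlow κ b g (j + 1)).real A ≤ (fkFlow κ a g (j + 1)).real A ∧
        (fkFlow κ a g (j + 1)).real A ≤ T * (fkFlow κ b g (j + 1)).real A) := by
  have hfin : ∀ (m : Measure S) [IsProbabilityMeasure m] n, IsFiniteMeasure (fkFlow κ m g n) :=
    fun m _ n => isFiniteMeasure_fkFlow κ m hg hG' hG n
  have hpos : ∀ n, 0 < (fkFlow κ b g n).real Set.univ := by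
    intro n
    have := hfin b n
    refine ENNReal.toReal_pos (ne_of_gt (lt_of_lt_of_le ?_ (le_fkFlow_univ κ b hg hGl n)))
      (measure_ne_top _ _)
    simp only [measure_univ, mul_one]
    exact pos_iff_ne_zero.2 (Finset.prod_ne_zero_iff.2 fun k _ => hG0 k)
  -- Multiplying both measures by the same likelihood preserves the two-sided comparison with the
  -- same constants.
  have hstep : ∀ (n : ℕ) (t T : ℝ), 0 ≤ t → 0 ≤ T →
      (∀ A, MeasurableSet A → t * ((fkFlow κ b g n).bind κ).real A
          ≤ ((fkFlow κ a g n).bind κ).real A ∧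
        ((fkFlow κ a g n).bind κ).real A ≤ T * ((fkFlow κ b g n).bind κ).real A) →
      ∀ A, MeasurableSet A →
        t * (fkFlow κ b g (n + 1)).real A ≤ (fkFlow κ a g (n + 1)).real A ∧
        (fkFlow κ a g (n + 1)).real A ≤ T * (fkFlow κ b g (n + 1)).real A := by
    intro n t T ht hT hyp A hA
    have := hfin a n
    have := hfin b n
    have := hfin a (n + 1)
    have := hfin b (n + 1)
    constructor
    · refine (ofReal_smul_le_iff ht).1 ?_ A hA
      rw [fkFlow, fkFlow, ← withDensity_smul_measure]
      exact withDensity_mono_left ((ofReal_smul_le_iff ht).2 fun A hA => (hyp A hA).1) _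
    · refine (le_ofReal_smul_iff hT).1 ?_ A hA
      rw [fkFlow, fkFlow, ← withDensity_smul_measure]
      exact withDensity_mono_left ((le_ofReal_smul_iff hT).2 fun A hA => (hyp A hA).2) _
  have hε2 : 0 < ε ^ 2 := by positivity
  have hε3 : ε ^ 2 ≤ 1 := pow_le_one₀ hε.le hε1
  induction j with
  | zero =>
    -- After one kernel step both laws are comparable to `lam` up to `ε`, hence to each other up to
    -- `ε ^ 2`. This is why the count starts at `j + 1`.
    refine ⟨ε ^ 2, (ε ^ 2)⁻¹, le_rfl, by simp [hε2.le], hstep 0 _ _ hε2.le (by positivity) ?_⟩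
    have key : ∀ (m : Measure S) [IsProbabilityMeasure m] (A : Set S), MeasurableSet A →
        ε * lam.real A ≤ (m.bind κ).real A ∧ ε * (m.bind κ).real A ≤ lam.real A := by
      intro m _ A hA
      obtain ⟨i, -⟩ := integral_sub_const_kernel κ m hA 0
      simp only [sub_zero] at i
      rw [measureReal_bind κ m hA]
      constructor
      · calc ε * lam.real A = ∫ _, ε * lam.real A ∂m := by simp
          _ ≤ _ := integral_mono (integrable_const _) i fun x => (hκ x A hA).1
      · rw [← integral_const_mul]
        calc _ ≤ ∫ _, lam.real A ∂m := integral_mono (i.const_mul _) (integrable_const _)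
              fun x => (hκ x A hA).2
          _ = _ := by simp
    intro A hA
    obtain ⟨a1, a2⟩ := key a A hA
    obtain ⟨b1, b2⟩ := key b A hA
    simp only [fkFlow_zero]
    constructor
    · nlinarith
    · rw [inv_mul_eq_div, le_div_iff₀ hε2]
      nlinarith
  | succ j ih =>
    obtain ⟨t, T, h1, h2, h3⟩ := ih
    have := hfin a (j + 1)
    have := hfin b (j + 1)
    -- The mass ratio `r` lies in `[t, T]`, and both ends move towards it by the fraction `ε ^ 2`;
    -- the gap shrinks by `1 - ε ^ 2` wherever `r` lies.
    set r := (fkFlow κ a g (j + 1)).real Set.univ / (fkFlow κ b g (j + 1)).real Set.univ with hr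
    have htr : t ≤ r := by
      rw [hr, le_div_iff₀ (hpos _)]
      exact (h3 _ MeasurableSet.univ).1
    have hrT : r ≤ T := by
      rw [hr, div_le_iff₀ (hpos _)]
      exact (h3 _ MeasurableSet.univ).2
    have ht0 : 0 ≤ t := hε2.le.trans h1
    have hT0 : 0 ≤ T := ht0.trans (htr.trans hrT)
    refine ⟨t + ε ^ 2 * (r - t), T - ε ^ 2 * (T - r), ?_, ?_, hstep _ _ _ ?_ ?_ ?_⟩
    · nlinarith
    · calc T - ε ^ 2 * (T - r) - (t + ε ^ 2 * (r - t)) = (T - t) * (1 - ε ^ 2) := by ring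
        _ ≤ (ε ^ 2)⁻¹ * (1 - ε ^ 2) ^ j * (1 - ε ^ 2) :=
          mul_le_mul_of_nonneg_right h2 (sub_nonneg.2 hε3)
        _ = _ := by ring
    · nlinarith
    · nlinarith
    · intro A hA
      exact ⟨mixing_lower hε hκ ht0 ((ofReal_smul_le_iff ht0).2 fun A hA => (h3 A hA).1)
          (hpos _) hA,
        mixing_upper hε hκ hT0 ((le_ofReal_smul_iff hT0).2 fun A hA => (h3 A hA).2)
          (hpos _) hA⟩

/-- Exponential forgetting of the initial condition for normalized filters. -/
lemma abs_normalized_fkFlow_sub_le (hε : 0 < ε) (hε1 : ε ≤ 1) [IsFiniteMeasure lam]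
    (hκ : MixingWith κ ε lam) {a b : Measure S}
    [IsProbabilityMeasure a] [IsProbabilityMeasure b] {g : ℕ → S → ℝ≥0∞}
    (hg : ∀ n, Measurable (g n)) {G G' : ℕ → ℝ≥0∞} (hG' : ∀ n, G n ≠ ⊤) (hG : ∀ n x, g n x ≤ G n)
    (hG0 : ∀ n, G' n ≠ 0) (hGl : ∀ n x, G' n ≤ g n x) (j : ℕ) {A : Set S} (hA : MeasurableSet A) :
    |(fkFlow κ a g (j + 1)).real A / (fkFlow κ a g (j + 1)).real Set.univ
      - (fkFlow κ b g (j + 1)).real A / (fkFlow κ b g (j + 1)).real Set.univ|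
      ≤ (ε ^ 2)⁻¹ * (ε ^ 2)⁻¹ * (1 - ε ^ 2) ^ j := by
  obtain ⟨t, T, h1, h2, h3⟩ := fkFlow_sandwich hε hε1 hκ (a := a) (b := b) hg hG' hG hG0 hGl j
  have hpos : ∀ (m : Measure S) [IsProbabilityMeasure m],
      0 < (fkFlow κ m g (j + 1)).real Set.univ := by
    intro m _
    have := isFiniteMeasure_fkFlow κ m hg hG' hG (j + 1)
    refine ENNReal.toReal_pos (ne_of_gt (lt_of_lt_of_le ?_ (le_fkFlow_univ κ m hg hGl _)))
      (measure_ne_top _ _)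
    simp only [measure_univ, mul_one]
    exact pos_iff_ne_zero.2 (Finset.prod_ne_zero_iff.2 fun k _ => hG0 k)
  have := isFiniteMeasure_fkFlow κ b hg hG' hG (j + 1)
  have ha := hpos a
  have hb := hpos b
  obtain ⟨hu1, hu2⟩ := h3 _ MeasurableSet.univ
  obtain ⟨hA1, hA2⟩ := h3 A hA
  set a1 := (fkFlow κ a g (j + 1)).real Set.univ
  set b1 := (fkFlow κ b g (j + 1)).real Set.univ
  set aA := (fkFlow κ a g (j + 1)).real A
  set bA := (fkFlow κ b g (j + 1)).real A
  have hbA : bA ≤ b1 := measureReal_mono (Set.subset_univ _)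
  have hbA0 : 0 ≤ bA := measureReal_nonneg
  have ht : 0 < t := lt_of_lt_of_le (by positivity) h1
  have htT : t ≤ T := le_of_mul_le_mul_right (hu1.trans hu2) hb
  -- Normalization turns the gap `T - t` into the relative gap `(T - t) / t`; since `t ≥ ε ^ 2`,
  -- this costs a second factor `(ε ^ 2)⁻¹`.
  have hmain : (T - t) / t ≤ (ε ^ 2)⁻¹ * (ε ^ 2)⁻¹ * (1 - ε ^ 2) ^ j := by
    calc (T - t) / t ≤ (T - t) / ε ^ 2 := by
          gcongr
      _ ≤ ((ε ^ 2)⁻¹ * (1 - ε ^ 2) ^ j) / ε ^ 2 := by gcongr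
      _ = _ := by ring
  refine le_trans ?_ hmain
  rw [div_sub_div _ _ ha.ne' hb.ne', abs_le]
  constructor
  · rw [le_div_iff₀ (by positivity), ← neg_div, div_mul_eq_mul_div, div_le_iff₀ ht]
    nlinarith [mul_le_mul_of_nonneg_left hA1 hb.le, mul_le_mul_of_nonneg_left hu2 hbA0,
      mul_le_mul_of_nonneg_left hu1 hb.le, mul_nonneg (sub_nonneg.2 htT) hb.le,
      mul_nonneg (sub_nonneg.2 hbA) ha.le]
  · rw [div_le_div_iff₀ (by positivity) ht]
    have hTt := sub_nonneg.2 htT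
    calc (aA * b1 - a1 * bA) * t ≤ (T * bA * b1 - t * b1 * bA) * t := by gcongr
      _ = (T - t) * (t * b1 * bA) := by ring
      _ ≤ (T - t) * (a1 * b1) := by gcongr

end Contraction

/-! ### From the weak derivative to a Lipschitz bound on the kernel -/

/-- Uniform boundedness principle for bounded functions paired with summable ones. -/
lemma exists_bound_of_pairing {ι X : Type*} (t : ι → X → ℝ)
    (hb : ∀ i, ∃ B, ∀ x, |t i x| ≤ B)
    (H : ∀ p : X → ℝ, (∀ x, 0 ≤ p x) → Summable p → ∃ C, ∀ i, |∑' x, p x * t i x| ≤ C) :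
    ∃ C, ∀ i x, |t i x| ≤ C := by
  classical
  choose B hB using hb
  have hsum : ∀ a : lp (fun _ : X => ℝ) 1, Summable fun x => |a x| := fun a => by
    simpa using (memℓp_gen_iff (by simp)).1 (lp.memℓp a)
  have hnorm : ∀ a : lp (fun _ : X => ℝ) 1, ‖a‖ = ∑' x, |a x| := fun a => by
    simp [lp.norm_eq_tsum_rpow (p := 1) (by simp)]
  have hs : ∀ i (p : X → ℝ), (Summable fun x => |p x|) → Summable fun x => p x * t i x := by
    intro i p hp
    refine Summable.of_norm_bounded (hp.mul_right (B i)) fun x => ?_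
    rw [norm_mul, Real.norm_eq_abs, Real.norm_eq_abs]
    exact mul_le_mul_of_nonneg_left (hB i x) (abs_nonneg _)
  -- Each `t i` acts as a functional on `ℓ¹(X)`. A common bound on the operator norms bounds `t i
  -- x`, its value at the unit vector of `x`.
  let T : ι → lp (fun _ : X => ℝ) 1 →L[ℝ] ℝ := fun i =>
    LinearMap.mkContinuous
      { toFun := fun a => ∑' x, a x * t i x
        map_add' := fun a b => by
          rw [← (hs i _ (hsum a)).tsum_add (hs i _ (hsum b))]
          exact tsum_congr fun x => by simp [add_mul]
        map_smul' := fun c a => by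
          rw [RingHom.id_apply, smul_eq_mul, ← tsum_mul_left]
          exact tsum_congr fun x => by simp [mul_assoc] } (B i) (fun a => by
        change ‖∑' x, a x * t i x‖ ≤ _
        rw [hnorm, ← tsum_mul_left]
        refine tsum_of_norm_bounded ((hsum a).mul_left (B i)).hasSum fun x => ?_
        rw [norm_mul, Real.norm_eq_abs, Real.norm_eq_abs, mul_comm]
        exact mul_le_mul_of_nonneg_right (hB i x) (abs_nonneg _))
  have hT : ∀ i a, T i a = ∑' x, a x * t i x := fun i a => rfl
  -- `H` covers only nonnegative weights, which will be masses of measures, so `a` is split into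
  -- positive and negative parts.
  obtain ⟨C, hC⟩ := banach_steinhaus (g := T) (fun a => by
    have h1 : Summable fun x => max (a x) 0 := Summable.of_nonneg_of_le (fun x => le_max_right _ _)
      (fun x => max_le (le_abs_self _) (abs_nonneg _)) (hsum a)
    have h2 : Summable fun x => max (-a x) 0 := Summable.of_nonneg_of_le
      (fun x => le_max_right _ _) (fun x => max_le (neg_le_abs _) (abs_nonneg _)) (hsum a)
    obtain ⟨C1, hC1⟩ := H _ (fun x => le_max_right _ _) h1
    obtain ⟨C2, hC2⟩ := H _ (fun x => le_max_right _ _) h2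
    refine ⟨C1 + C2, fun i => ?_⟩
    have h3 : T i a = ∑' x, max (a x) 0 * t i x - ∑' x, max (-a x) 0 * t i x := by
      rw [hT, ← (hs i _ h1.abs).tsum_sub (hs i _ h2.abs)]
      refine tsum_congr fun x => ?_
      rw [← sub_mul]
      congr 1
      have := max_zero_sub_max_neg_zero_eq_self (a x)
      linarith
    rw [h3]
    exact (norm_sub_le _ _).trans (add_le_add (hC1 i) (hC2 i)))
  refine ⟨C, fun i x => ?_⟩
  have h4 := (T i).le_of_opNorm_le (hC i) (lp.single 1 x (1 : ℝ))
  rw [lp.norm_single (by simp), hT, tsum_eq_single x] at h4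
  · simpa using h4
  · intro z hz
    simp [hz]

section Lipschitz

variable {E : Type*} [TopologicalSpace E] [MeasurableSpace E] [BorelSpace E]

lemma integrable_bcf (P : Measure E) [IsFiniteMeasure P] (f : E →ᵇ ℝ) : Integrable f P :=
  f.integrable P

lemma abs_integral_bcf_le (P : Measure E) [IsProbabilityMeasure P] (f : E →ᵇ ℝ) :
    |∫ z, f z ∂P| ≤ ‖f‖ := by
  simpa using f.norm_integral_le_norm P

variable {B : Type*} [NormedAddCommGroup B] [NormedSpace ℝ B] [MeasurableSpace B] {Θ : Set B}

lemma measurable_integral_kernel {T : Type*} [MeasurableSpace T] (K : Kernel (E × T) E)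
    [IsMarkovKernel K] (f : E →ᵇ ℝ) (θ : T) : Measurable fun x => ∫ z, f z ∂(K (x, θ)) :=
  (StronglyMeasurable.integral_kernel (κ := K.sectL θ)
    (f.continuous.measurable.stronglyMeasurable)).measurable

/-- Near `θ₀` the derivative controls the difference quotient; at distance at least `r` the trivial
bound `2 * ‖f‖ / r` does. The constant still depends on `m` and `f`. General finite measures reduce
to probability measures by scaling. -/
lemma IsKernelDeriv.exists_bound_measure {K : Kernel (E × Θ) E} [IsMarkovKernel K] {θ₀ : Θ}
    {L : B →L[ℝ] (E →ᵇ ℝ) →L[ℝ] (E →ᵇ ℝ)} (hL : IsKernelDeriv K θ₀ L) (m : Measure E)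
    [IsFiniteMeasure m] (f : E →ᵇ ℝ) :
    ∃ C, ∀ θ : Θ, |∫ x, (∫ z, f z ∂(K (x, θ)) - ∫ z, f z ∂(K (x, θ₀))) ∂m|
      ≤ C * dist θ θ₀ := by
  have hint : ∀ (P : Measure E) [IsFiniteMeasure P] θ,
      Integrable (fun x => ∫ z, f z ∂(K (x, θ))) P := fun P _ θ =>
    Integrable.of_bound (measurable_integral_kernel K f θ).aestronglyMeasurable ‖f‖
      (ae_of_all _ fun x => abs_integral_bcf_le _ f)
  set Lf : B →L[ℝ] (E →ᵇ ℝ) := (ContinuousLinearMap.apply ℝ _ f).comp L with hLf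
  have hprob : ∀ (P : Measure E) [IsProbabilityMeasure P],
      ∃ C, ∀ θ : Θ, |∫ x, (∫ z, f z ∂(K (x, θ)) - ∫ z, f z ∂(K (x, θ₀))) ∂P|
        ≤ C * dist θ θ₀ := by
    intro P _
    have h1 := (hL P inferInstance f).bound one_pos
    obtain ⟨r, hr, hball⟩ := Metric.eventually_nhds_iff.1 h1
    refine ⟨max (1 + ‖Lf‖) (2 * ‖f‖ / r), fun θ => ?_⟩
    rw [integral_sub (hint P θ) (hint P θ₀)]
    rcases lt_or_ge (dist θ θ₀) r with hd | hd
    · have h2 := hball hd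
      rw [one_mul, ← dist_eq_norm (θ : B), Real.norm_eq_abs, ← Subtype.dist_eq] at h2
      have h3 : |∫ x, L ((θ : B) - (θ₀ : B)) f x ∂P| ≤ ‖Lf‖ * dist θ θ₀ := by
        refine (abs_integral_bcf_le _ _).trans ?_
        rw [Subtype.dist_eq, dist_eq_norm]
        exact Lf.le_opNorm _
      calc _ ≤ dist θ θ₀ + ‖Lf‖ * dist θ θ₀ := by
            rw [abs_le] at *
            constructor <;> linarith [h2.1, h2.2, h3.1, h3.2]
        _ = (1 + ‖Lf‖) * dist θ θ₀ := by ring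
        _ ≤ _ := by gcongr; exact le_max_left _ _
    · have h3 : ∀ θ, |∫ x, ∫ z, f z ∂(K (x, θ)) ∂P| ≤ ‖f‖ := fun θ => by
        refine (norm_integral_le_of_norm_le_const (C := ‖f‖)
          (f := fun x => ∫ z, f z ∂(K (x, θ))) (ae_of_all _ fun x => abs_integral_bcf_le (K (x, θ)) f)).trans ?_
        simp
      calc _ ≤ ‖f‖ + ‖f‖ := (abs_sub _ _).trans (add_le_add (h3 θ) (h3 θ₀))
        _ = 2 * ‖f‖ / r * r := by field_simp; ring
        _ ≤ max (1 + ‖Lf‖) (2 * ‖f‖ / r) * dist θ θ₀ := by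
          gcongr
          exact le_max_right _ _
  rcases eq_or_ne m 0 with rfl | hm
  · exact ⟨0, fun θ => by simp⟩
  · have : NeZero m := ⟨hm⟩
    obtain ⟨C, hC⟩ := hprob ((m Set.univ)⁻¹ • m)
    refine ⟨m.real Set.univ * C, fun θ => ?_⟩
    have h5 := hC θ
    rw [integral_smul_measure, smul_eq_mul, abs_mul, ENNReal.toReal_inv, abs_of_nonneg (by
      positivity)] at h5
    have h6 : 0 < m.real Set.univ := by simp [measureReal_def, ENNReal.toReal_pos_iff, hm,
      pos_iff_ne_zero]
    rw [← measureReal_def, inv_mul_le_iff₀ h6] at h5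
    linarith

/-- Any nonnegative summable weight on `E` is a finite discrete measure, so the bound for each
measure supplies the pairings required by `exists_bound_of_pairing`, which makes the constant
uniform in `x`. -/
lemma IsKernelDeriv.exists_bound_function {K : Kernel (E × Θ) E} [IsMarkovKernel K] {θ₀ : Θ}
    {L : B →L[ℝ] (E →ᵇ ℝ) →L[ℝ] (E →ᵇ ℝ)} (hL : IsKernelDeriv K θ₀ L) (f : E →ᵇ ℝ) :
    ∃ C, ∀ (θ : Θ) (x : E), |∫ z, f z ∂(K (x, θ)) - ∫ z, f z ∂(K (x, θ₀))| ≤ C * dist θ θ₀ := by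
  set t : {θ : Θ // θ ≠ θ₀} → E → ℝ := fun θ x =>
    (dist θ.1 θ₀)⁻¹ * (∫ z, f z ∂(K (x, θ.1)) - ∫ z, f z ∂(K (x, θ₀))) with ht
  have htm : ∀ θ, Measurable (t θ) := fun θ =>
    ((measurable_integral_kernel K f _).sub (measurable_integral_kernel K f _)).const_mul _
  have htb : ∀ θ x, |t θ x| ≤ (dist θ.1 θ₀)⁻¹ * (2 * ‖f‖) := by
    intro θ x
    rw [ht, abs_mul, abs_of_nonneg (by positivity)]
    gcongr
    refine (abs_sub _ _).trans ?_
    linarith [abs_integral_bcf_le (K (x, θ.1)) f, abs_integral_bcf_le (K (x, θ₀)) f]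
  obtain ⟨C, hC⟩ := exists_bound_of_pairing t (fun θ => ⟨_, htb θ⟩) (by
    intro p hp hsp
    let m : Measure E := Measure.sum fun x => ENNReal.ofReal (p x) • Measure.dirac x
    have hfin : IsFiniteMeasure m := ⟨by
      rw [Measure.sum_apply _ MeasurableSet.univ]
      simp only [Measure.smul_apply, measure_univ, smul_eq_mul, mul_one]
      exact hsp.tsum_ofReal_lt_top⟩
    obtain ⟨C, hC⟩ := hL.exists_bound_measure m f
    refine ⟨C, fun θ => ?_⟩
    have hi : Integrable (t θ) m := Integrable.of_bound (htm θ).aestronglyMeasurable _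
      (ae_of_all _ (htb θ))
    have h1 : ∑' x, p x * t θ x = ∫ x, t θ x ∂m := by
      rw [integral_sum_measure hi]
      refine tsum_congr fun x => ?_
      rw [integral_smul_measure, integral_dirac' _ _ (htm θ).stronglyMeasurable,
        ENNReal.toReal_ofReal (hp x), smul_eq_mul]
    have hd : 0 < dist θ.1 θ₀ := dist_pos.2 θ.2
    rw [h1, ht, integral_const_mul, abs_mul, abs_of_nonneg (by positivity), inv_mul_le_iff₀ hd,
      mul_comm]
    exact hC θ.1)
  refine ⟨C, fun θ x => ?_⟩
  rcases eq_or_ne θ θ₀ with rfl | hθ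
  · simp
  · have h1 := hC ⟨θ, hθ⟩ x
    have hd : 0 < dist θ θ₀ := dist_pos.2 hθ
    rw [ht, abs_mul, abs_of_nonneg (by positivity), inv_mul_le_iff₀ hd, mul_comm] at h1
    exact h1

/-- For each pair `(θ, x)` the difference quotient is a functional of `f`, and the family is
pointwise bounded; Banach–Steinhaus makes the constant linear in `‖f‖`. -/
lemma IsKernelDeriv.exists_bound {K : Kernel (E × Θ) E} [IsMarkovKernel K] {θ₀ : Θ}
    {L : B →L[ℝ] (E →ᵇ ℝ) →L[ℝ] (E →ᵇ ℝ)} (hL : IsKernelDeriv K θ₀ L) :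
    ∃ C : ℝ≥0, ∀ (f : E →ᵇ ℝ) (θ : Θ) (x : E),
      |∫ z, f z ∂(K (x, θ)) - ∫ z, f z ∂(K (x, θ₀))| ≤ C * dist θ θ₀ * ‖f‖ := by
  let T : {θ : Θ // θ ≠ θ₀} × E → (E →ᵇ ℝ) →L[ℝ] ℝ := fun i =>
    LinearMap.mkContinuous
      { toFun := fun f => (dist i.1.1 θ₀)⁻¹ *
          (∫ z, f z ∂(K (i.2, i.1.1)) - ∫ z, f z ∂(K (i.2, θ₀)))
        map_add' := fun f g => by
          simp only [BoundedContinuousFunction.coe_add, Pi.add_apply]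
          rw [integral_add (integrable_bcf _ f) (integrable_bcf _ g),
            integral_add (integrable_bcf _ f) (integrable_bcf _ g)]
          ring
        map_smul' := fun c f => by
          simp only [BoundedContinuousFunction.coe_smul, smul_eq_mul, integral_const_mul,
            RingHom.id_apply]
          ring } ((dist i.1.1 θ₀)⁻¹ * 2) (fun f => by
        change ‖(dist i.1.1 θ₀)⁻¹ *
          (∫ z, f z ∂(K (i.2, i.1.1)) - ∫ z, f z ∂(K (i.2, θ₀)))‖ ≤ _
        rw [Real.norm_eq_abs, abs_mul, abs_of_nonneg (by positivity), mul_assoc]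
        gcongr
        refine (abs_sub _ _).trans ?_
        linarith [abs_integral_bcf_le (K (i.2, i.1.1)) f, abs_integral_bcf_le (K (i.2, θ₀)) f])
  have hT : ∀ i f, T i f = (dist i.1.1 θ₀)⁻¹ *
      (∫ z, f z ∂(K (i.2, i.1.1)) - ∫ z, f z ∂(K (i.2, θ₀))) := fun i f => rfl
  obtain ⟨C, hC⟩ := banach_steinhaus (g := T) (fun f => by
    obtain ⟨C, hC⟩ := hL.exists_bound_function f
    refine ⟨C, fun i => ?_⟩
    have hd : 0 < dist i.1.1 θ₀ := dist_pos.2 i.1.2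
    rw [hT, Real.norm_eq_abs, abs_mul, abs_of_nonneg (by positivity), inv_mul_le_iff₀ hd, mul_comm]
    exact hC _ _)
  refine ⟨C.toNNReal, fun f θ x => ?_⟩
  rcases eq_or_ne θ θ₀ with rfl | hθ
  · simp
  · have hd : 0 < dist θ θ₀ := dist_pos.2 hθ
    have h1 := (T (⟨θ, hθ⟩, x)).le_of_opNorm_le (hC _) f
    rw [hT, Real.norm_eq_abs, abs_mul, abs_of_nonneg (by positivity), inv_mul_le_iff₀ hd] at h1
    calc _ ≤ dist θ θ₀ * (C * ‖f‖) := h1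
      _ ≤ dist θ θ₀ * (C.toNNReal * ‖f‖) := by gcongr; exact Real.le_coe_toNNReal C
      _ = _ := by ring

end Lipschitz

/-! ### From continuous test functions to sets and measurable functions -/

section SetsToFunctions

variable {E : Type*} [TopologicalSpace E] [PolishSpace E] [MeasurableSpace E] [BorelSpace E]

/-- Indicators of closed sets are limits of thickened indicators, which are continuous with norm at
most `1`; inner regularity by closed sets then reaches Borel sets. -/
lemma measure_le_add_of_integral_le {P Q : Measure E} [IsProbabilityMeasure P]
    [IsProbabilityMeasure Q] {c : ℝ} (hc : 0 ≤ c)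
    (H : ∀ f : E →ᵇ ℝ, ∫ z, f z ∂P - ∫ z, f z ∂Q ≤ c * ‖f‖) {A : Set E} (hA : MeasurableSet A) :
    P A ≤ Q A + ENNReal.ofReal c := by
  let := TopologicalSpace.upgradeIsCompletelyMetrizable E
  have hclosed : ∀ F : Set E, IsClosed F → P.real F ≤ Q.real F + c := by
    intro F hF
    have hpos : ∀ n : ℕ, (0 : ℝ) < 1 / ((n : ℝ) + 1) := fun n => by positivity
    have hlim := tendsto_one_div_add_atTop_nhds_zero_nat (𝕜 := ℝ)
    refine le_of_tendsto_of_tendsto'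
      (tendsto_integral_thickenedIndicator_of_isClosed P hF hpos hlim)
      ((tendsto_integral_thickenedIndicator_of_isClosed Q hF hpos hlim).add_const c) fun n => ?_
    let f : E →ᵇ ℝ := BoundedContinuousFunction.ofNormedAddCommGroup
      (fun x => (thickenedIndicator (hpos n) F x : ℝ)) (by fun_prop) 1 (fun x => by
        simpa using thickenedIndicator_le_one (hpos n) F x)
    have hf : ‖f‖ ≤ 1 := BoundedContinuousFunction.norm_ofNormedAddCommGroup_le _ zero_le_one _
    have h1 := H f
    have h2 : c * ‖f‖ ≤ c := mul_le_of_le_one_right hc hf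
    have h3 : ∀ m : Measure E, ∫ z, f z ∂m = ∫ z, (thickenedIndicator (hpos n) F z : ℝ) ∂m :=
      fun m => rfl
    rw [h3, h3] at h1
    linarith
  rw [hA.measure_eq_iSup_isClosed_of_ne_top (measure_ne_top P A)]
  refine iSup₂_le fun F hFA => iSup_le fun hF => ?_
  have h1 : P F ≤ Q F + ENNReal.ofReal c := by
    rw [← ENNReal.ofReal_toReal (measure_ne_top P F), ← ENNReal.ofReal_toReal (measure_ne_top Q F),
      ← ENNReal.ofReal_add ENNReal.toReal_nonneg hc]
    exact ENNReal.ofReal_le_ofReal (hclosed F hF)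
  exact h1.trans (by gcongr)

/-- Layer cake: only levels in `(0, 1]` count, and that interval has length `1`, so the error `c` is
not multiplied. -/
lemma lintegral_le_add_of_measure_le {S : Type*} [MeasurableSpace S] {P Q : Measure S} {c : ℝ≥0∞}
    (H : ∀ A, MeasurableSet A → P A ≤ Q A + c) {f : S → ℝ≥0∞} (hf : Measurable f)
    (hf1 : ∀ x, f x ≤ 1) : ∫⁻ x, f x ∂P ≤ ∫⁻ x, f x ∂Q + c := by
  have hrep : ∀ m : Measure S, ∫⁻ x, f x ∂m
      = ∫⁻ t in Set.Ioc (0 : ℝ) 1, m {x | t ≤ (f x).toReal} := by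
    intro m
    have h1 : ∀ x, f x = ENNReal.ofReal (f x).toReal := fun x =>
      (ENNReal.ofReal_toReal ((hf1 x).trans_lt ENNReal.one_lt_top).ne).symm
    have h2 : ∫⁻ x, f x ∂m = ∫⁻ x, ENNReal.ofReal (f x).toReal ∂m := lintegral_congr h1
    rw [h2, lintegral_eq_lintegral_meas_le m (ae_of_all _ fun x => ENNReal.toReal_nonneg)
      hf.ennreal_toReal.aemeasurable, ← Set.Ioc_union_Ioi_eq_Ioi (zero_le_one (α := ℝ)),
      lintegral_union measurableSet_Ioi (Set.Ioc_disjoint_Ioi le_rfl)]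
    have h3 : ∫⁻ t in Set.Ioi (1 : ℝ), m {x | t ≤ (f x).toReal} = 0 := by
      rw [setLIntegral_congr_fun (g := fun _ => 0) measurableSet_Ioi]
      · simp
      · intro t ht
        have : {x | t ≤ (f x).toReal} = ∅ := by
          ext x
          simp only [Set.mem_ofPred_eq, Set.mem_empty_iff_false, iff_false, not_le]
          refine lt_of_le_of_lt ?_ ht
          exact ENNReal.toReal_le_of_le_ofReal zero_le_one (by simpa using hf1 x)
        simp [this]
    rw [h3, add_zero]
  rw [hrep, hrep]
  calc _ ≤ ∫⁻ t in Set.Ioc (0 : ℝ) 1, (Q {x | t ≤ (f x).toReal} + c) :=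
        lintegral_mono fun t => H _ (measurableSet_le measurable_const hf.ennreal_toReal)
    _ = _ := by
        rw [lintegral_add_right _ measurable_const]
        simp

end SetsToFunctions

/-! ### Flows with slightly different kernels -/

section Perturbation

variable {S E : Type*} [MeasurableSpace S] [MeasurableSpace E]

lemma fkFlow_apply_eq_zero (κ : Kernel S S) {m : Measure S} {g : ℕ → S → ℝ≥0∞}
    {V : Set S} (hV : MeasurableSet V) (hm : m Vᶜ = 0) (hκV : ∀ x ∈ V, κ x Vᶜ = 0) (n : ℕ) : fkFlow κ m g n Vᶜ = 0 := by
  induction n with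
  | zero => exact hm
  | succ n ih =>
    rw [fkFlow]
    refine withDensity_absolutelyContinuous _ _ ?_
    rw [Measure.bind_apply hV.compl κ.measurable.aemeasurable, lintegral_eq_zero_iff
      (κ.measurable_coe hV.compl)]
    have : ∀ᵐ x ∂(fkFlow κ m g n), x ∈ V := ih
    filter_upwards [this] with x hx using hκV x hx

/-- Two flows whose kernels agree up to `δ` in total variation stay close. -/
lemma lintegral_fkFlow_perturb (κ : Kernel S S) [IsMarkovKernel κ] (κ' : Kernel E E)
    [IsMarkovKernel κ'] {pr : S → E} (hpr : Measurable pr) (m : Measure S)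
    {g : ℕ → E → ℝ≥0∞} (hg : ∀ n, Measurable (g n)) {G : ℕ → ℝ≥0∞} (hG0 : ∀ n, G n ≠ 0)
    (hG' : ∀ n, G n ≠ ⊤) (hG : ∀ n x, g n x ≤ G n) {V : Set S} (hV : MeasurableSet V)
    (hm : m Vᶜ = 0) (hκV : ∀ x ∈ V, κ x Vᶜ = 0) {δ : ℝ≥0∞}
    (hδ : ∀ x ∈ V, ∀ f : E → ℝ≥0∞, Measurable f → (∀ z, f z ≤ 1) →
      ∫⁻ z, f (pr z) ∂(κ x) ≤ ∫⁻ z, f z ∂(κ' (pr x)) + δ ∧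
      ∫⁻ z, f z ∂(κ' (pr x)) ≤ ∫⁻ z, f (pr z) ∂(κ x) + δ) (j : ℕ)
    {f : E → ℝ≥0∞} (hf : Measurable f) (hf1 : ∀ z, f z ≤ 1) :
    ∫⁻ x, f (pr x) ∂(fkFlow κ m (fun n x => g n (pr x)) j)
      ≤ ∫⁻ x, f x ∂(fkFlow κ' (m.map pr) g j)
        + j * δ * ((∏ k ∈ Finset.range j, G k) * m Set.univ) ∧
    ∫⁻ x, f x ∂(fkFlow κ' (m.map pr) g j)
      ≤ ∫⁻ x, f (pr x) ∂(fkFlow κ m (fun n x => g n (pr x)) j)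
        + j * δ * ((∏ k ∈ Finset.range j, G k) * m Set.univ) := by
  have hgp : ∀ n, Measurable fun x => g n (pr x) := fun n => (hg n).comp hpr
  induction j generalizing f with
  | zero => simp [fkFlow_zero, lintegral_map hf hpr]
  | succ j ih =>
    set Gp := (∏ k ∈ Finset.range j, G k) * m Set.univ with hGp
    have hGs : (∏ k ∈ Finset.range (j + 1), G k) * m Set.univ = G j * Gp := by
      rw [Finset.prod_range_succ, hGp]; ring
    -- rescale `g j * f` to take values in `[0, 1]`
    set F : E → ℝ≥0∞ := fun z => (G j)⁻¹ * (g j z * f z) with hF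
    have hFm : Measurable F := ((hg j).mul hf).const_mul _
    have hGF : ∀ z, g j z * f z = G j * F z := fun z => by
      rw [hF, ← mul_assoc, ENNReal.mul_inv_cancel (hG0 j) (hG' j), one_mul]
    have hF1 : ∀ z, F z ≤ 1 := fun z => by
      calc F z ≤ (G j)⁻¹ * (G j * 1) := by
            simp only [hF]; gcongr
            · exact hG j z
            · exact hf1 z
        _ = 1 := by rw [mul_one, ENNReal.inv_mul_cancel (hG0 j) (hG' j)]
    set F' : E → ℝ≥0∞ := fun x => ∫⁻ z, F z ∂(κ' x) with hF'
    have hF'm : Measurable F' := hFm.lintegral_kernel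
    have hF'1 : ∀ x, F' x ≤ 1 := fun x => by
      calc F' x ≤ ∫⁻ _, 1 ∂(κ' x) := lintegral_mono hF1
        _ = 1 := by simp
    have hae : ∀ᵐ x ∂(fkFlow κ m (fun n x => g n (pr x)) j), x ∈ V :=
      fkFlow_apply_eq_zero κ hV hm hκV j
    have hmass : fkFlow κ m (fun n x => g n (pr x)) j Set.univ ≤ Gp :=
      fkFlow_univ_le κ m hgp (fun n x => hG n (pr x)) j
    have hFp : Measurable fun z => F (pr z) := hFm.comp hpr
    have e1 : ∫⁻ x, f (pr x) ∂(fkFlow κ m (fun n x => g n (pr x)) (j + 1))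
        = G j * ∫⁻ x, ∫⁻ z, F (pr z) ∂(κ x) ∂(fkFlow κ m (fun n x => g n (pr x)) j) := by
      rw [lintegral_fkFlow_succ κ m hgp j (f := fun x => f (pr x)) (hf.comp hpr),
        ← lintegral_const_mul _ hFp.lintegral_kernel]
      refine lintegral_congr fun x => ?_
      rw [← lintegral_const_mul _ hFp]
      exact lintegral_congr fun z => hGF (pr z)
    have e2 : ∫⁻ x, f x ∂(fkFlow κ' (m.map pr) g (j + 1))
        = G j * ∫⁻ x, F' x ∂(fkFlow κ' (m.map pr) g j) := by
      rw [lintegral_fkFlow_succ κ' _ hg j hf, ← lintegral_const_mul _ hF'm]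
      refine lintegral_congr fun x => ?_
      rw [← lintegral_const_mul _ hFm]
      exact lintegral_congr fun z => hGF z
    obtain ⟨ih1, ih2⟩ := ih hF'm hF'1
    have hfinal : G j * (j * δ * Gp + δ * Gp) = ((j + 1 : ℕ) : ℝ≥0∞) * δ * (G j * Gp) := by
      push_cast; ring
    have hF'p : Measurable fun x => F' (pr x) := hF'm.comp hpr
    rw [e1, e2, hGs, ← hfinal, ← mul_add, ← mul_add]
    constructor
    · gcongr
      calc ∫⁻ x, ∫⁻ z, F (pr z) ∂(κ x) ∂(fkFlow κ m (fun n x => g n (pr x)) j)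
          ≤ ∫⁻ x, (F' (pr x) + δ) ∂(fkFlow κ m (fun n x => g n (pr x)) j) := by
            refine lintegral_mono_ae ?_
            filter_upwards [hae] with x hx using (hδ x hx F hFm hF1).1
        _ = ∫⁻ x, F' (pr x) ∂(fkFlow κ m (fun n x => g n (pr x)) j)
            + δ * fkFlow κ m (fun n x => g n (pr x)) j Set.univ := by
            rw [lintegral_add_left hF'p, lintegral_const]
        _ ≤ (∫⁻ x, F' x ∂(fkFlow κ' (m.map pr) g j) + j * δ * Gp) + δ * Gp := by gcongr
        _ = _ := by ring
    · gcongr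
      calc ∫⁻ x, F' x ∂(fkFlow κ' (m.map pr) g j)
          ≤ ∫⁻ x, F' (pr x) ∂(fkFlow κ m (fun n x => g n (pr x)) j) + j * δ * Gp := ih2
        _ ≤ ∫⁻ x, (∫⁻ z, F (pr z) ∂(κ x) + δ) ∂(fkFlow κ m (fun n x => g n (pr x)) j)
            + j * δ * Gp := by
            gcongr ?_ + _
            refine lintegral_mono_ae ?_
            filter_upwards [hae] with x hx using (hδ x hx F hFm hF1).2
        _ = ∫⁻ x, ∫⁻ z, F (pr z) ∂(κ x) ∂(fkFlow κ m (fun n x => g n (pr x)) j)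
            + δ * fkFlow κ m (fun n x => g n (pr x)) j Set.univ + j * δ * Gp := by
            rw [lintegral_add_right _ measurable_const, lintegral_const]
        _ ≤ ∫⁻ x, ∫⁻ z, F (pr z) ∂(κ x) ∂(fkFlow κ m (fun n x => g n (pr x)) j)
            + δ * Gp + j * δ * Gp := by gcongr
        _ = _ := by ring

/-- The normalized flows are close as well. -/
lemma abs_normalized_perturb (κ : Kernel S S) [IsMarkovKernel κ] (κ' : Kernel E E)
    [IsMarkovKernel κ'] {pr : S → E} (hpr : Measurable pr) (m : Measure S)
    [IsProbabilityMeasure m]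
    {g : ℕ → E → ℝ≥0∞} (hg : ∀ n, Measurable (g n)) {g₀ W : ℕ → ℝ≥0∞} (hg0 : ∀ n, g₀ n ≠ 0)
    (hg0' : ∀ n, g₀ n ≠ ⊤) (hW0 : ∀ n, W n ≠ 0) (hW : ∀ n, W n ≠ ⊤)
    (hG : ∀ n x, g n x ≤ g₀ n * W n) (hG2 : ∀ n x, g₀ n ≤ g n x * W n)
    {V : Set S} (hV : MeasurableSet V)
    (hm : m Vᶜ = 0) (hκV : ∀ x ∈ V, κ x Vᶜ = 0) {δ : ℝ≥0∞} (hδ' : δ ≠ ⊤)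
    (hδ : ∀ x ∈ V, ∀ f : E → ℝ≥0∞, Measurable f → (∀ z, f z ≤ 1) →
      ∫⁻ z, f (pr z) ∂(κ x) ≤ ∫⁻ z, f z ∂(κ' (pr x)) + δ ∧
      ∫⁻ z, f z ∂(κ' (pr x)) ≤ ∫⁻ z, f (pr z) ∂(κ x) + δ) (j : ℕ)
    {A : Set E} (hA : MeasurableSet A) :
    |(fkFlow κ m (fun n x => g n (pr x)) j).real (pr ⁻¹' A)
        / (fkFlow κ m (fun n x => g n (pr x)) j).real Set.univ
      - (fkFlow κ' (m.map pr) g j).real A / (fkFlow κ' (m.map pr) g j).real Set.univ|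
      ≤ (2 * j * δ * ∏ k ∈ Finset.range j, W k ^ 2).toReal := by
  have hgp : ∀ n, Measurable fun x => g n (pr x) := fun n => (hg n).comp hpr
  have : IsProbabilityMeasure (m.map pr) := Measure.isProbabilityMeasure_map hpr.aemeasurable
  have hGt : ∀ n, g₀ n * W n ≠ ⊤ := fun n => ENNReal.mul_ne_top (hg0' n) (hW n)
  have hG0 : ∀ n, g₀ n * W n ≠ 0 := fun n => mul_ne_zero (hg0 n) (hW0 n)
  have hlow0 : ∀ n, g₀ n / W n ≠ 0 := fun n => (ENNReal.div_pos (hg0 n) (hW n)).ne'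
  have hlow : ∀ n x, g₀ n / W n ≤ g n x := fun n x =>
    ENNReal.div_le_of_le_mul (hG2 n x)
  have fa := isFiniteMeasure_fkFlow κ m hgp hGt (fun n x => hG n (pr x)) j
  have fb := isFiniteMeasure_fkFlow κ' (m.map pr) hg hGt hG j
  set a := fkFlow κ m (fun n x => g n (pr x)) j with ha
  set b := fkFlow κ' (m.map pr) g j with hb
  set D := (j * δ * (∏ k ∈ Finset.range j, (g₀ k * W k))) with hD
  have hDt : D ≠ ⊤ := ENNReal.mul_ne_top (ENNReal.mul_ne_top (by simp) hδ')
    (ENNReal.prod_ne_top fun k _ => hGt k)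
  have key : ∀ A : Set E, MeasurableSet A → a.real (pr ⁻¹' A) ≤ b.real A + D.toReal ∧
      b.real A ≤ a.real (pr ⁻¹' A) + D.toReal := by
    intro A hA
    have h1 := lintegral_fkFlow_perturb κ κ' hpr m hg hG0 hGt hG hV hm hκV hδ j
      (f := A.indicator 1) (measurable_one.indicator hA)
      (fun z => Set.indicator_le_self' (by simp) z)
    have h2 : ∫⁻ x, A.indicator 1 (pr x) ∂a = a (pr ⁻¹' A) := by
      rw [← lintegral_indicator_one (hpr hA)]
      rfl
    rw [lintegral_indicator_one hA, ← ha, h2, measure_univ, mul_one, ← hb, ← hD] at h1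
    constructor
    · rw [measureReal_def, measureReal_def, ← ENNReal.toReal_add (measure_ne_top _ _) hDt]
      exact ENNReal.toReal_mono (ENNReal.add_ne_top.2 ⟨measure_ne_top _ _, hDt⟩) h1.1
    · rw [measureReal_def, measureReal_def, ← ENNReal.toReal_add (measure_ne_top _ _) hDt]
      exact ENNReal.toReal_mono (ENNReal.add_ne_top.2 ⟨measure_ne_top _ _, hDt⟩) h1.2
  have hbl : (∏ k ∈ Finset.range j, (g₀ k / W k)) ≤ b Set.univ := by
    simpa using le_fkFlow_univ κ' (m.map pr) hg hlow j
  have hal : (∏ k ∈ Finset.range j, (g₀ k / W k)) ≤ a Set.univ := by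
    simpa using le_fkFlow_univ κ m hgp (fun n x => hlow n (pr x)) j
  have hp0 : (∏ k ∈ Finset.range j, (g₀ k / W k)) ≠ 0 :=
    Finset.prod_ne_zero_iff.2 fun k _ => hlow0 k
  have hb1 : 0 < b.real Set.univ :=
    ENNReal.toReal_pos ((pos_iff_ne_zero.2 hp0).trans_le hbl).ne' (measure_ne_top _ _)
  have ha1 : 0 < a.real Set.univ :=
    ENNReal.toReal_pos ((pos_iff_ne_zero.2 hp0).trans_le hal).ne' (measure_ne_top _ _)
  -- The error carries `∏ g₀ W`, while the mass is at least `∏ g₀ / W`. Their quotient is `∏ W ^ 2`,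
  -- free of the Gaussian reference values.
  have hDb : D.toReal / b.real Set.univ
      ≤ (j * δ * ∏ k ∈ Finset.range j, W k ^ 2).toReal := by
    rw [div_le_iff₀ hb1, measureReal_def, ← ENNReal.toReal_mul]
    refine ENNReal.toReal_mono (ENNReal.mul_ne_top (ENNReal.mul_ne_top (ENNReal.mul_ne_top
      (by simp) hδ') (ENNReal.prod_ne_top fun k _ => ENNReal.pow_ne_top (hW k)))
      (measure_ne_top _ _)) ?_
    calc D = j * δ * (∏ k ∈ Finset.range j, W k ^ 2) * ∏ k ∈ Finset.range j, (g₀ k / W k) := by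
          rw [hD, mul_assoc _ (∏ k ∈ Finset.range j, W k ^ 2), ← Finset.prod_mul_distrib]
          congr 1
          refine Finset.prod_congr rfl fun k _ => ?_
          rw [pow_two, mul_assoc, ENNReal.mul_div_cancel (hW0 k) (hW k), mul_comm]
      _ ≤ _ := by gcongr
  obtain ⟨u1, u2⟩ := key _ MeasurableSet.univ
  rw [Set.preimage_univ] at u1 u2
  obtain ⟨A1, A2⟩ := key A hA
  have hAle : a.real (pr ⁻¹' A) ≤ a.real Set.univ := measureReal_mono (Set.subset_univ _)
  have h2D : (2 * j * δ * ∏ k ∈ Finset.range j, W k ^ 2).toReal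
      = 2 * (j * δ * ∏ k ∈ Finset.range j, W k ^ 2).toReal := by
    rw [show 2 * j * δ * ∏ k ∈ Finset.range j, W k ^ 2
      = 2 * (j * δ * ∏ k ∈ Finset.range j, W k ^ 2) by ring, ENNReal.toReal_mul]
    simp
  rw [h2D]
  -- The factor `2` arises because numerator and normalizing mass are each off by at most `D`.
  refine le_trans ?_ (mul_le_mul_of_nonneg_left hDb zero_le_two)
  set r := a.real (pr ⁻¹' A) / a.real Set.univ with hr
  have hr0 : 0 ≤ r := by positivity
  have hr1 : r ≤ 1 := (div_le_one ha1).2 hAle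
  have hra : a.real (pr ⁻¹' A) = r * a.real Set.univ := by rw [hr]; field_simp
  have hD0 : 0 ≤ D.toReal := ENNReal.toReal_nonneg
  have : r - b.real A / b.real Set.univ = (r * b.real Set.univ - b.real A) / b.real Set.univ := by
    field_simp
  rw [this, abs_div, abs_of_pos hb1, ← mul_div_assoc]
  gcongr
  rw [hra] at A1 A2
  rw [abs_le]
  constructor
  · nlinarith [mul_le_mul_of_nonneg_left u1 hr0, mul_le_mul_of_nonneg_right hr1 hD0]
  · nlinarith [mul_le_mul_of_nonneg_left u2 hr0, mul_le_mul_of_nonneg_right hr1 hD0]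

end Perturbation

/-! ### Existence of the limiting distribution and uniform convergence -/

section Ergodic

variable {E : Type*} [TopologicalSpace E] [MeasurableSpace E] [BorelSpace E]

/-- The action of a Feller kernel on bounded continuous functions. -/
noncomputable def fellerOp {κ : Kernel E E} [IsMarkovKernel κ] (hF : IsFeller κ) (f : E →ᵇ ℝ) :
    E →ᵇ ℝ :=
  BoundedContinuousFunction.ofNormedAddCommGroup (fun x => ∫ z, f z ∂(κ x)) (hF f) ‖f‖
    (fun x => abs_integral_bcf_le (κ x) f)

variable {κ : Kernel E E} [IsMarkovKernel κ] (hF : IsFeller κ)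

lemma fellerOp_apply (f : E →ᵇ ℝ) (x : E) : fellerOp hF f x = ∫ z, f z ∂(κ x) := rfl

instance isProbabilityMeasure_pathLaw {S : Type*} [MeasurableSpace S] (κ : Kernel S S)
    [IsMarkovKernel κ] (m : Measure S) [IsProbabilityMeasure m] (n : ℕ) :
    IsProbabilityMeasure (pathLaw κ m n) := by
  induction n with
  | zero =>
    rw [pathLaw]
    exact Measure.isProbabilityMeasure_map (by fun_prop)
  | succ n ih =>
    rw [pathLaw]
    exact Measure.isProbabilityMeasure_map (measurable_snoc n).aemeasurable

lemma integral_pathLaw (m : Measure E) [IsProbabilityMeasure m] (n : ℕ) (f : E →ᵇ ℝ) :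
    ∫ x, f (x (Fin.last n)) ∂(pathLaw κ m n) = ∫ x, ((fellerOp hF)^[n] f) x ∂m := by
  induction n generalizing f with
  | zero =>
    rw [pathLaw, integral_map (by fun_prop)]
    · rfl
    · exact (f.continuous.measurable.comp (measurable_pi_apply _)).aestronglyMeasurable
  | succ n ih =>
    have hm : Measurable fun x : Fin (n + 2) → E => f (x (Fin.last (n + 1))) :=
      f.continuous.measurable.comp (measurable_pi_apply _)
    rw [Function.iterate_succ_apply, ← ih, pathLaw,
      integral_map (measurable_snoc n).aemeasurable hm.aestronglyMeasurable]
    rw [Measure.integral_compProd]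
    · simp only [Fin.snoc_last, Kernel.comap_apply, fellerOp_apply]
    · refine Integrable.of_bound (hm.comp (measurable_snoc n)).aestronglyMeasurable ‖f‖
        (ae_of_all _ fun x => f.norm_coe_le_norm _)

/-- Doeblin's argument: the part `ε lam` of `κ x` is common to all `x`, and only the remaining mass
`1 - ε lam(E)` sees the oscillation of `f`. -/
lemma fellerOp_osc {ε : ℝ} {lam : Measure E} [IsFiniteMeasure lam] (hε : 0 < ε)
    (hκ : MixingWith κ ε lam) {f : E →ᵇ ℝ} {a b : ℝ} (hab : ∀ x, f x ∈ Set.Icc a b) :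
    ∃ a' b', b' - a' = (1 - ε * lam.real Set.univ) * (b - a) ∧
      ∀ x, fellerOp hF f x ∈ Set.Icc a' b' := by
  have hle : ∀ x, ENNReal.ofReal ε • lam ≤ κ x := fun x =>
    (ofReal_smul_le_iff hε.le).2 fun A hA => (hκ x A hA).1
  refine ⟨ε * ∫ z, f z ∂lam + (1 - ε * lam.real Set.univ) * a,
    ε * ∫ z, f z ∂lam + (1 - ε * lam.real Set.univ) * b, by ring, fun x => ?_⟩
  rw [fellerOp_apply]
  have i1 := integrable_bcf (κ x) f
  have i2 := integrable_bcf lam f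
  constructor
  · have h1 := integral_mono_measure (hle x) (f := fun z => f z - a)
      (ae_of_all _ fun z => sub_nonneg.2 (hab z).1) (i1.sub (integrable_const _))
    rw [integral_smul_measure, integral_sub i1 (integrable_const _),
      integral_sub i2 (integrable_const _), ENNReal.toReal_ofReal hε.le] at h1
    simp only [integral_const, smul_eq_mul, probReal_univ] at h1
    linarith
  · have h1 := integral_mono_measure (hle x) (f := fun z => b - f z)
      (ae_of_all _ fun z => sub_nonneg.2 (hab z).2) ((integrable_const _).sub i1)
    rw [integral_smul_measure, integral_sub (integrable_const _) i1,
      integral_sub (integrable_const _) i2, ENNReal.toReal_ofReal hε.le] at h1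
    simp only [integral_const, smul_eq_mul, probReal_univ] at h1
    linarith

/-- The oscillation of the iterates decays geometrically, and averaging by a Markov kernel never
leaves an interval once it has been entered. -/
lemma exists_interval_iterate (hM : IsMixing κ) (hne : Nonempty E) (f : E →ᵇ ℝ) :
    ∃ a b : ℕ → ℝ, Tendsto (fun n => b n - a n) atTop (𝓝 0) ∧
      ∀ n k, n ≤ k → ∀ x, ((fellerOp hF)^[k] f) x ∈ Set.Icc (a n) (b n) := by
  obtain ⟨ε, lam, hε, hε1, hfin, hκ⟩ := hM.exists_mixingWith
  set c := ε * lam.real Set.univ with hc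
  obtain ⟨x₀⟩ := hne
  have hu := hκ x₀ Set.univ MeasurableSet.univ
  simp only [probReal_univ, mul_one] at hu
  have hc0 : 0 < c := mul_pos hε (hε.trans_le hu.2)
  have hstep : ∀ n, ∃ p : ℝ × ℝ, p.2 - p.1 = (1 - c) ^ n * (2 * ‖f‖) ∧
      ∀ x, ((fellerOp hF)^[n] f) x ∈ Set.Icc p.1 p.2 := by
    intro n
    induction n with
    | zero =>
      refine ⟨(-‖f‖, ‖f‖), by simp; ring, fun x => ?_⟩
      exact abs_le.1 (f.norm_coe_le_norm x)
    | succ n ih =>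
      obtain ⟨p, hp, hpx⟩ := ih
      obtain ⟨a', b', h1, h2⟩ := fellerOp_osc hF hε hκ hpx
      refine ⟨(a', b'), ?_, fun x => ?_⟩
      · rw [h1, hp, pow_succ]; ring
      · rw [Function.iterate_succ_apply']
        exact h2 x
  choose p hp hpx using hstep
  refine ⟨fun n => (p n).1, fun n => (p n).2, ?_, fun n k hnk => ?_⟩
  · simp only [hp]
    rw [← zero_mul (2 * ‖f‖)]
    exact (tendsto_pow_atTop_nhds_zero_of_lt_one (by linarith [hu.1]) (by linarith)).mul_const _
  · obtain ⟨j, rfl⟩ := Nat.exists_eq_add_of_le hnk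
    induction j with
    | zero => exact hpx n
    | succ j ih =>
      intro x
      rw [← add_assoc, Function.iterate_succ_apply', fellerOp_apply]
      have ih' := ih (Nat.le_add_right _ _)
      have i1 := integrable_bcf (κ x) ((fellerOp hF)^[n + j] f)
      constructor
      · simpa using integral_mono (integrable_const (p n).1) i1 fun z => (ih' z).1
      · simpa using integral_mono i1 (integrable_const (p n).2) fun z => (ih' z).2

lemma integral_mem_Icc_of_forall {P : Measure E} [IsProbabilityMeasure P] {f : E →ᵇ ℝ} {a b : ℝ}
    (h : ∀ x, f x ∈ Set.Icc a b) : ∫ x, f x ∂P ∈ Set.Icc a b := by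
  have i1 := integrable_bcf P f
  exact ⟨by simpa using integral_mono (integrable_const a) i1 fun z => (h z).1,
    by simpa using integral_mono i1 (integrable_const b) fun z => (h z).2⟩

variable [PolishSpace E]

/-- All laws after time `0` are dominated by one multiple of the finite measure `lam`, hence tight,
so Prokhorov gives a cluster point. The shrinking intervals of `exists_interval_iterate` contain its
integrals and those of every chain, which forces convergence from every initial law. -/
lemma exists_isLimitingDistribution (hF : IsFeller κ) (hM : IsMixing κ) (m : Measure E) [IsProbabilityMeasure m] :
    ∃ π, IsLimitingDistribution κ π := by
  have hne : Nonempty E := nonempty_of_isProbabilityMeasure m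
  let law : ℕ → ProbabilityMeasure E := fun n =>
    ⟨(pathLaw κ m (n + 1)).map (fun x => x (Fin.last (n + 1))),
      Measure.isProbabilityMeasure_map (measurable_pi_apply _).aemeasurable⟩
  have hlaw : ∀ n (f : E →ᵇ ℝ), ∫ x, f x ∂(law n : Measure E)
      = ∫ x, ((fellerOp hF)^[n + 1] f) x ∂m := by
    intro n f
    rw [← integral_pathLaw hF]
    exact integral_map (measurable_pi_apply _).aemeasurable
      f.continuous.measurable.aestronglyMeasurable
  have htight : IsTightMeasureSet {((μ : ProbabilityMeasure E) : Measure E) | μ ∈ Set.range law} := by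
    obtain ⟨ε, hε, -, lam, hfin, hmix⟩ := hM
    rw [isTightMeasureSet_iff_exists_isCompact_measure_compl_le]
    intro δ hδ
    have hε0 : (ε : ℝ≥0∞) ≠ 0 := by simpa using hε.ne'
    obtain ⟨C, hC, hC'⟩ := isTightMeasureSet_iff_exists_isCompact_measure_compl_le.1
      (isTightMeasureSet_singleton (μ := lam)) (ε * δ) (ENNReal.mul_pos hε0 hδ.ne')
    refine ⟨C, hC, ?_⟩
    rintro _ ⟨_, ⟨n, rfl⟩, rfl⟩
    have hCm : MeasurableSet Cᶜ := hC.isClosed.measurableSet.compl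
    have hind : Measurable fun x : Fin (n + 2) → E =>
        Set.indicator Cᶜ (1 : E → ℝ≥0∞) (x (Fin.last (n + 1))) :=
      (measurable_one.indicator hCm).comp (measurable_pi_apply _)
    change ((pathLaw κ m (n + 1)).map (fun x => x (Fin.last (n + 1)))) Cᶜ ≤ δ
    rw [← lintegral_indicator_one hCm, lintegral_map (measurable_one.indicator hCm)
      (measurable_pi_apply _), lintegral_pathLaw_succ κ m n hind]
    simp only [Fin.snoc_last]
    calc _ ≤ ∫⁻ _, δ ∂(pathLaw κ m n) := by
          refine lintegral_mono fun x => ?_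
          rw [lintegral_indicator_one hCm]
          calc _ ≤ (ε : ℝ≥0∞)⁻¹ * lam Cᶜ := (hmix _ _ hCm).2
            _ ≤ (ε : ℝ≥0∞)⁻¹ * (ε * δ) := by gcongr; exact hC' lam rfl
            _ = δ := by rw [← mul_assoc, ENNReal.inv_mul_cancel hε0 ENNReal.coe_ne_top, one_mul]
      _ = δ := by simp
  have hcomp := isCompact_closure_of_isTightMeasureSet htight
  obtain ⟨π, -, hπ⟩ := hcomp.exists_mapClusterPt (f := atTop) (u := law)
    (by
      rw [le_principal_iff, mem_map]
      exact Eventually.of_forall fun n => subset_closure ⟨n, rfl⟩)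
  refine ⟨π, inferInstance, fun m' _ f => ?_⟩
  obtain ⟨a, b, hab, hmem⟩ := exists_interval_iterate hF hM hne f
  have h1 : ∀ n, ∫ x, f x ∂(π : Measure E) ∈ Set.Icc (a n) (b n) := by
    intro n
    have hclosed : IsClosed {ν : ProbabilityMeasure E | ∫ x, f x ∂(ν : Measure E) ∈
        Set.Icc (a n) (b n)} := isClosed_Icc.preimage
          (ProbabilityMeasure.continuous_integral_boundedContinuousFunction f)
    refine hclosed.mem_of_mapClusterPt hπ ?_
    filter_upwards [eventually_ge_atTop n] with k hk
    rw [hlaw]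
    exact integral_mem_Icc_of_forall (hmem n (k + 1) (by omega))
  have h2 : ∀ n, ∫ x, f (x (Fin.last n)) ∂(pathLaw κ m' n) ∈ Set.Icc (a n) (b n) := by
    intro n
    rw [integral_pathLaw hF]
    exact integral_mem_Icc_of_forall (hmem n n le_rfl)
  rw [tendsto_iff_dist_tendsto_zero]
  refine squeeze_zero (fun n => dist_nonneg) (fun n => ?_) hab
  exact Real.dist_le_of_mem_Icc (h2 n) (h1 n)

lemma isLimitingDistribution_limitingDistribution (hF : IsFeller κ) (hM : IsMixing κ) (m : Measure E)
    [IsProbabilityMeasure m] : IsLimitingDistribution κ (limitingDistribution κ) := by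
  have hex := exists_isLimitingDistribution hF hM m
  rw [limitingDistribution, dif_pos hex]
  exact hex.choose_spec

lemma exists_abs_iterate_sub_le (hM : IsMixing κ) (m : Measure E)
    [IsProbabilityMeasure m] (f : E →ᵇ ℝ) {η : ℝ} (hη : 0 < η) :
    ∃ n, ∀ x, |((fellerOp hF)^[n] f) x - ∫ z, f z ∂(limitingDistribution κ)| ≤ η := by
  have hlim := isLimitingDistribution_limitingDistribution hF hM m
  have hne : Nonempty E := nonempty_of_isProbabilityMeasure m
  obtain ⟨a, b, hab, hmem⟩ := exists_interval_iterate hF hM hne f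
  obtain ⟨n, hn⟩ := ((tendsto_order.1 hab).2 η hη).exists
  refine ⟨n, fun x => ?_⟩
  have h1 : ∫ z, f z ∂(limitingDistribution κ) ∈ Set.Icc (a n) (b n) := by
    refine isClosed_Icc.mem_of_tendsto (hlim.2 m inferInstance f) ?_
    filter_upwards [eventually_ge_atTop n] with k hk
    rw [integral_pathLaw hF]
    exact integral_mem_Icc_of_forall (hmem n k hk)
  exact (Real.dist_le_of_mem_Icc (hmem n n le_rfl x) h1).trans hn.le

end Ergodic

/-! ### The kernel with a frozen parameter -/

section Augmented

variable {E T : Type*} [MeasurableSpace E] [MeasurableSpace T]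

instance isMarkovKernel_augmentedKernel (K : Kernel (E × T) E) [IsMarkovKernel K] :
    IsMarkovKernel (augmentedKernel K) := by
  unfold augmentedKernel; infer_instance

lemma lintegral_augmentedKernel (K : Kernel (E × T) E) [IsMarkovKernel K] (p : E × T)
    {F : E × T → ℝ≥0∞} (hF : Measurable F) :
    ∫⁻ q, F q ∂(augmentedKernel K p) = ∫⁻ z, F (z, p.2) ∂(K p) := by
  rw [augmentedKernel, Kernel.prod_apply, lintegral_prod _ hF.aemeasurable]
  refine lintegral_congr fun z => ?_
  rw [Kernel.deterministic_apply]
  exact lintegral_dirac' (f := fun y => F (z, y)) p.2 (hF.comp measurable_prodMk_left)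

lemma augmentedKernel_snd_preimage (K : Kernel (E × T) E) [IsMarkovKernel K] (p : E × T)
    {U : Set T} (hU : MeasurableSet U) (hp : p.2 ∉ U) :
    augmentedKernel K p (Prod.snd ⁻¹' U) = 0 := by
  rw [← lintegral_indicator_one (measurable_snd hU),
    lintegral_augmentedKernel K p (measurable_one.indicator (measurable_snd hU))]
  simp [Set.indicator, hp]

end Augmented

/-! ### Exponential bounds for empirical means of the observations -/

section Exponential

/-- Apply `exp z ≤ 1 + z + z ^ 2` for `|z| ≤ 1` to the centred variable: the linear term integrates
to `0`, and `1 + v ≤ exp v` closes the bound. -/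
lemma lintegral_exp_mul_le {S : Type*} [MeasurableSpace S] (P : Measure S)
    [IsProbabilityMeasure P] {X : S → ℝ} (hX : Measurable X) {M : ℝ} (hM : ∀ x, |X x| ≤ M)
    {s : ℝ} (hs : 0 ≤ s) (hsM : 2 * (s * M) ≤ 1) :
    ∫⁻ x, ENNReal.ofReal (Real.exp (s * X x)) ∂P
      ≤ ENNReal.ofReal (Real.exp (s * ∫ x, X x ∂P + 4 * s ^ 2 * M ^ 2)) := by
  have hiX : Integrable X P := Integrable.of_bound hX.aestronglyMeasurable M (ae_of_all _ hM)
  set e := ∫ x, X x ∂P with he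
  have heM : |e| ≤ M := by
    have := norm_integral_le_of_norm_le_const (μ := P) (f := X) (C := M) (ae_of_all _ hM)
    simpa using this
  have hb : ∀ x, |s * (X x - e)| ≤ 2 * (s * M) := by
    intro x
    rw [abs_mul, abs_of_nonneg hs]
    calc s * |X x - e| ≤ s * (M + M) := by
          gcongr; exact (abs_sub _ _).trans (add_le_add (hM x) heM)
      _ = _ := by ring
  have hpt : ∀ x, Real.exp (s * X x) ≤
      Real.exp (s * e) * (1 + s * (X x - e) + 4 * s ^ 2 * M ^ 2) := by
    intro x
    have h1 := Real.abs_exp_sub_one_sub_id_le ((hb x).trans hsM)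
    have h2 := (abs_le.1 h1).2
    have h3 : (s * (X x - e)) ^ 2 ≤ (2 * (s * M)) ^ 2 := sq_le_sq' (by
      linarith [(abs_le.1 (hb x)).1]) (abs_le.1 (hb x)).2
    calc Real.exp (s * X x) = Real.exp (s * e) * Real.exp (s * (X x - e)) := by
          rw [← Real.exp_add]; congr 1; ring
      _ ≤ _ := by
          gcongr
          nlinarith
  have hi2 : Integrable (fun x => Real.exp (s * e) * (1 + s * (X x - e) + 4 * s ^ 2 * M ^ 2)) P :=
    ((((integrable_const 1).add ((hiX.sub (integrable_const e)).const_mul s)).add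
      (integrable_const _)).const_mul _)
  have hnn : ∀ x, 0 ≤ Real.exp (s * e) * (1 + s * (X x - e) + 4 * s ^ 2 * M ^ 2) := fun x =>
    (Real.exp_pos _).le.trans (hpt x)
  calc _ ≤ ∫⁻ x, ENNReal.ofReal (Real.exp (s * e) * (1 + s * (X x - e) + 4 * s ^ 2 * M ^ 2)) ∂P :=
        lintegral_mono fun x => ENNReal.ofReal_le_ofReal (hpt x)
    _ = ENNReal.ofReal (∫ x, Real.exp (s * e) * (1 + s * (X x - e) + 4 * s ^ 2 * M ^ 2) ∂P) :=
        (ofReal_integral_eq_lintegral_ofReal hi2 (ae_of_all _ hnn)).symm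
    _ ≤ _ := by
        refine ENNReal.ofReal_le_ofReal ?_
        have i1 : Integrable (fun x => s * (X x - e)) P := (hiX.sub (integrable_const e)).const_mul s
        have i2 : Integrable (fun x => 1 + s * (X x - e)) P := (integrable_const _).add i1
        rw [integral_const_mul, integral_add i2 (integrable_const _),
          integral_add (integrable_const _) i1,
          integral_const_mul, integral_sub hiX (integrable_const e), Real.exp_add]
        simp only [integral_const, probReal_univ, smul_eq_mul, one_mul, ← he, sub_self, mul_zero,
          add_zero]
        gcongr
        linarith [Real.add_one_le_exp (4 * s ^ 2 * M ^ 2)]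

variable {E : Type*} [TopologicalSpace E] [FirstCountableTopology E] [MeasurableSpace E]
  [BorelSpace E] {d : ℕ}

/-- The mean of `f(Yₙ)` conditionally on `Xₙ = x`. -/
noncomputable def obsMean (σ : ℝ) [Fact (0 < σ)] (h : E →ᵇ Obs d) (f : Obs d →ᵇ ℝ) : E →ᵇ ℝ :=
  BoundedContinuousFunction.ofNormedAddCommGroup (fun x => ∫ v, f (h x + v) ∂(noiseLaw d σ))
    (by
      refine continuous_of_dominated (bound := fun _ => ‖f‖) (fun x => ?_) (fun x => ?_)
        (integrable_const _) (ae_of_all _ fun v => ?_)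
      · exact (f.continuous.comp (continuous_const.add continuous_id)).aestronglyMeasurable
      · exact ae_of_all _ fun v => f.norm_coe_le_norm _
      · exact f.continuous.comp (h.continuous.add continuous_const)) ‖f‖
    (fun x => by
      simpa using norm_integral_le_of_norm_le_const (μ := noiseLaw d σ)
        (f := fun v => f (h x + v)) (C := ‖f‖) (ae_of_all _ fun v => f.norm_coe_le_norm _))

lemma obsMean_apply {E : Type*} [TopologicalSpace E] [FirstCountableTopology E] {d : ℕ}
    (σ : ℝ) [Fact (0 < σ)] (h : E →ᵇ Obs d) (f : Obs d →ᵇ ℝ) (x : E) :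
    obsMean σ h f x = ∫ v, f (h x + v) ∂(noiseLaw d σ) := rfl

lemma integral_limitingObsLaw (σ : ℝ) [Fact (0 < σ)] (h : E →ᵇ Obs d) (f : Obs d →ᵇ ℝ)
    (κ : Kernel E E) [IsFiniteMeasure (limitingDistribution κ)] :
    ∫ y, f y ∂(limitingObsLaw κ σ h) = ∫ x, obsMean σ h f x ∂(limitingDistribution κ) := by
  rw [limitingObsLaw, integral_conv (f.integrable _), integral_map h.continuous.measurable.aemeasurable]
  · rfl
  · refine StronglyMeasurable.aestronglyMeasurable ?_
    refine StronglyMeasurable.integral_prod_right' (f := fun p : Obs d × Obs d => f (p.1 + p.2)) ?_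
    exact (f.continuous.comp (continuous_fst.add continuous_snd)).stronglyMeasurable

lemma lintegral_gaussDensity_mul_exp_le {E : Type*} [TopologicalSpace E]
    [FirstCountableTopology E] {d : ℕ} (σ : ℝ) [hσ : Fact (0 < σ)] (h : E →ᵇ Obs d)
    (f : Obs d →ᵇ ℝ) (b : ℝ) {s : ℝ} (hs : 0 ≤ s) (hsf : 2 * (s * ‖f‖) ≤ 1) (x : E) :
    ∫⁻ v, gaussDensity σ (v - h x) * ENNReal.ofReal (Real.exp (s * (f v - b)))
      ≤ ENNReal.ofReal (Real.exp (s * (obsMean σ h f x - b) + 4 * s ^ 2 * ‖f‖ ^ 2)) := by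
  have h1 : ∫⁻ v, gaussDensity σ (v - h x) * ENNReal.ofReal (Real.exp (s * (f v - b)))
      = ∫⁻ v, ENNReal.ofReal (Real.exp (s * (f (h x + v) - b))) ∂(noiseLaw d σ) := by
    have hm : Measurable fun v => ENNReal.ofReal (Real.exp (s * (f (h x + v) - b))) := by
      have := f.continuous
      exact (by fun_prop : Continuous fun v => Real.exp (s * (f (h x + v) - b))).measurable.ennreal_ofReal
    rw [noiseLaw, lintegral_withDensity_eq_lintegral_mul _ (measurable_gaussDensity σ) hm,
      ← lintegral_add_right_eq_self (fun v => gaussDensity σ (v - h x) * _) (h x)]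
    simp [add_comm (h x)]
  have hmX : Measurable fun v => f (h x + v) :=
    (f.continuous.comp (continuous_const.add continuous_id)).measurable
  have h2 := lintegral_exp_mul_le (noiseLaw d σ) hmX (M := ‖f‖)
    (fun v => f.norm_coe_le_norm _) hs hsf
  have hme : Measurable fun v => ENNReal.ofReal (Real.exp (s * f (h x + v))) := by fun_prop
  rw [h1]
  calc _ = ∫⁻ v, ENNReal.ofReal (Real.exp (-(s * b))) *
        ENNReal.ofReal (Real.exp (s * f (h x + v))) ∂(noiseLaw d σ) := by
        refine lintegral_congr fun v => ?_
        rw [← ENNReal.ofReal_mul (Real.exp_pos _).le, ← Real.exp_add]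
        congr 2; ring
    _ = ENNReal.ofReal (Real.exp (-(s * b))) *
        ∫⁻ v, ENNReal.ofReal (Real.exp (s * f (h x + v))) ∂(noiseLaw d σ) :=
        lintegral_const_mul _ hme
    _ ≤ ENNReal.ofReal (Real.exp (-(s * b))) * ENNReal.ofReal (Real.exp
        (s * ∫ v, f (h x + v) ∂(noiseLaw d σ) + 4 * s ^ 2 * ‖f‖ ^ 2)) := by gcongr
    _ = _ := by
        rw [← ENNReal.ofReal_mul (Real.exp_pos _).le, ← Real.exp_add, obsMean_apply]
        congr 2; ring

/-- Exponential bound for the empirical means of `f(Yₖ)`, from an approximate solution `G` of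
the Poisson inequality on a set `V` that the chain neither enters nor leaves. -/
lemma lintegral_exp_unnormalizedFilter_le {S : Type*} [MeasurableSpace S] (κ : Kernel S S)
    [IsMarkovKernel κ] {pr : S → E} (hpr : Measurable pr) (σ : ℝ) [hσ : Fact (0 < σ)]
    (h : E →ᵇ Obs d) (f : Obs d →ᵇ ℝ) (G : E →ᵇ ℝ) {b τ : ℝ} (hτ : 0 < τ) :
    ∃ s : ℝ, 0 < s ∧ ∃ c : ℝ, 0 < c ∧ ∃ C : ℝ≥0∞, C ≠ ⊤ ∧
      ∀ V : Set S, MeasurableSet V → (∀ x ∈ V, κ x Vᶜ = 0) → (∀ x ∉ V, κ x V = 0) →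
      (∀ x ∈ V, obsMean σ h f (pr x) - b + ∫ z, G (pr z) ∂(κ x) ≤ G (pr x) - τ) →
      ∀ (m : Measure S) [IsFiniteMeasure m], m Vᶜ = 0 → ∀ n : ℕ,
        ∫⁻ y : Fin n → Obs d, (∏ k, ENNReal.ofReal (Real.exp (s * (f (y k) - b)))) *
          unnormalizedFilter κ m σ (fun x => h (pr x)) n y Set.univ
        ≤ C * ENNReal.ofReal (Real.exp (-(c * n))) * m Set.univ := by
  set M := ‖f‖ + ‖G‖ + 1 with hM
  have hfM : ‖f‖ ≤ M := by linarith [norm_nonneg G]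
  have hGM : ‖G‖ ≤ M := by linarith [norm_nonneg f]
  have hM0 : 0 < M := by positivity
  -- The first bound on `s` permits the quadratic expansions. The second makes their cost `4 s²
  -- (‖f‖² + ‖G‖²)` at most half of the drift gain `s τ`, leaving the rate `s * τ / 2`.
  set s := min (1 / (2 * M)) (τ / (16 * M ^ 2)) with hs
  have hs0 : 0 < s := by positivity
  have hs1 : s * M ≤ 1 / 2 := by
    calc s * M ≤ 1 / (2 * M) * M := by gcongr; exact min_le_left _ _
      _ = 1 / 2 := by field_simp
  have hs2 : 16 * M ^ 2 * s ≤ τ := by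
    calc 16 * M ^ 2 * s ≤ 16 * M ^ 2 * (τ / (16 * M ^ 2)) := by gcongr; exact min_le_right _ _
      _ = τ := by field_simp
  have hsf : 2 * (s * ‖f‖) ≤ 1 := by nlinarith
  have hsG : 2 * (s * ‖G‖) ≤ 1 := by nlinarith
  refine ⟨s, hs0, s * τ / 2, by positivity, ENNReal.ofReal (Real.exp (s * ‖G‖)) *
    ENNReal.ofReal (Real.exp (s * ‖G‖)), ENNReal.mul_ne_top ENNReal.ofReal_ne_top
    ENNReal.ofReal_ne_top, fun V hV hV1 hV2 hP m _ hm n => ?_⟩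
  have hhm : Measurable fun x => h (pr x) := h.continuous.measurable.comp hpr
  have hGp : Measurable fun x => G (pr x) := G.continuous.measurable.comp hpr
  set Q : S → ℝ := fun x => ∫ z, G (pr z) ∂(κ x) with hQ
  have hQm : Measurable Q :=
    (StronglyMeasurable.integral_kernel (κ := κ) hGp.stronglyMeasurable).measurable
  have hQb : ∀ x, |Q x| ≤ ‖G‖ := fun x => by
    simpa using norm_integral_le_of_norm_le_const (μ := κ x) (f := fun z => G (pr z)) (C := ‖G‖)
      (ae_of_all _ fun z => G.norm_coe_le_norm _)
  -- The weight uses `Q = κ G` rather than `G`: the observation is attached to the new state, so the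
  -- Poisson inequality turns `obsMean + Q` there into `G`, and averaging `exp (s G)` over the
  -- kernel returns `exp (s Q)` at the old state. The indicator makes the inequality trivial off
  -- `V`.
  set φ : S → ℝ≥0∞ := V.indicator fun x => ENNReal.ofReal (Real.exp (s * Q x)) with hφ
  have hφm : Measurable φ := (by fun_prop : Measurable fun x =>
    ENNReal.ofReal (Real.exp (s * Q x))).indicator hV
  have hwm : ∀ _ : ℕ, Measurable fun v => ENNReal.ofReal (Real.exp (s * (f v - b))) := fun _ => by
    have := f.continuous.measurable
    fun_prop
  have hstep : ∀ (_ : ℕ) x, ∫⁻ z, (φ z * ∫⁻ v, gaussDensity σ (v - h (pr z)) *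
      ENNReal.ofReal (Real.exp (s * (f v - b)))) ∂(κ x)
      ≤ ENNReal.ofReal (Real.exp (-(s * τ / 2))) * φ x := by
    intro _ x
    by_cases hx : x ∈ V
    · have hae : ∀ᵐ z ∂(κ x), z ∈ V := hV1 x hx
      calc _ ≤ ∫⁻ z, ENNReal.ofReal (Real.exp (-(s * τ) + 4 * s ^ 2 * ‖f‖ ^ 2)) *
            ENNReal.ofReal (Real.exp (s * G (pr z))) ∂(κ x) := by
            refine lintegral_mono_ae ?_
            filter_upwards [hae] with z hz
            rw [hφ, Set.indicator_of_mem hz]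
            calc _ ≤ ENNReal.ofReal (Real.exp (s * Q z)) * ENNReal.ofReal (Real.exp
                  (s * (obsMean σ h f (pr z) - b) + 4 * s ^ 2 * ‖f‖ ^ 2)) := by
                  gcongr
                  exact lintegral_gaussDensity_mul_exp_le σ h f b hs0.le hsf (pr z)
              _ ≤ _ := by
                  rw [← ENNReal.ofReal_mul (Real.exp_pos _).le,
                    ← ENNReal.ofReal_mul (Real.exp_pos _).le, ← Real.exp_add, ← Real.exp_add]
                  refine ENNReal.ofReal_le_ofReal (Real.exp_le_exp.2 ?_)
                  have := mul_le_mul_of_nonneg_left (hP z hz) hs0.le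
                  linarith
        _ = ENNReal.ofReal (Real.exp (-(s * τ) + 4 * s ^ 2 * ‖f‖ ^ 2)) *
            ∫⁻ z, ENNReal.ofReal (Real.exp (s * G (pr z))) ∂(κ x) :=
            lintegral_const_mul _ (by fun_prop)
        _ ≤ ENNReal.ofReal (Real.exp (-(s * τ) + 4 * s ^ 2 * ‖f‖ ^ 2)) *
            ENNReal.ofReal (Real.exp (s * Q x + 4 * s ^ 2 * ‖G‖ ^ 2)) := by
            gcongr
            exact lintegral_exp_mul_le (κ x) hGp (fun z => G.norm_coe_le_norm _) hs0.le hsG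
        _ ≤ _ := by
            rw [hφ, Set.indicator_of_mem hx, ← ENNReal.ofReal_mul (Real.exp_pos _).le,
                    ← ENNReal.ofReal_mul (Real.exp_pos _).le, ← Real.exp_add, ← Real.exp_add]
            refine ENNReal.ofReal_le_ofReal (Real.exp_le_exp.2 ?_)
            have h1 : ‖f‖ ^ 2 ≤ M ^ 2 := by gcongr
            have h2 : ‖G‖ ^ 2 ≤ M ^ 2 := by gcongr
            have h3 : 4 * s * (‖f‖ ^ 2 + ‖G‖ ^ 2) ≤ τ / 2 := by
              calc _ ≤ 4 * s * (M ^ 2 + M ^ 2) := by gcongr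
                _ = (16 * M ^ 2 * s) / 2 := by ring
                _ ≤ _ := by gcongr
            nlinarith [mul_le_mul_of_nonneg_left h3 hs0.le]
    · have hae : ∀ᵐ z ∂(κ x), z ∉ V := by
        rw [ae_iff]
        simpa using hV2 x hx
      refine le_of_eq_of_le ?_ zero_le
      rw [lintegral_congr_ae (g := fun _ => 0)]
      · simp
      · filter_upwards [hae] with z hz
        simp [hφ, hz]
  have hmain := lintegral_prod_mul_unnormalizedFilter_le κ m σ hhm hwm hφm
    (fun _ => ENNReal.ofReal (Real.exp (-(s * τ / 2)))) hstep n
  have hmass : ∀ y : Fin n → Obs d, unnormalizedFilter κ m σ (fun x => h (pr x)) n y Set.univ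
      ≤ ENNReal.ofReal (Real.exp (s * ‖G‖)) *
        ∫⁻ x, φ x ∂(unnormalizedFilter κ m σ (fun x => h (pr x)) n y) := by
    intro y
    rw [← lintegral_const_mul _ hφm, ← lintegral_one]
    refine lintegral_mono_ae ?_
    have hVae : ∀ᵐ x ∂(unnormalizedFilter κ m σ (fun x => h (pr x)) n y), x ∈ V := by
      rw [unnormalizedFilter_eq κ m σ hhm]
      exact fkFlow_apply_eq_zero κ hV hm hV1 n
    filter_upwards [hVae] with x hx
    rw [hφ, Set.indicator_of_mem hx, ← ENNReal.ofReal_mul (Real.exp_pos _).le, ← Real.exp_add,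
      ← ENNReal.ofReal_one]
    refine ENNReal.ofReal_le_ofReal (Real.one_le_exp ?_)
    nlinarith [(abs_le.1 (hQb x)).1]
  have hφint : ∫⁻ x, φ x ∂m ≤ ENNReal.ofReal (Real.exp (s * ‖G‖)) * m Set.univ := by
    rw [← lintegral_const]
    refine lintegral_mono fun x => ?_
    refine (Set.indicator_le_self' (fun _ _ => zero_le) x).trans ?_
    refine ENNReal.ofReal_le_ofReal (Real.exp_le_exp.2 ?_)
    gcongr
    exact (abs_le.1 (hQb x)).2
  have hprodm : Measurable fun y : Fin n → Obs d =>
      ∏ k, ENNReal.ofReal (Real.exp (s * (f (y k) - b))) :=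
    Finset.measurable_prod _ fun k _ => (hwm k).comp (measurable_pi_apply k)
  calc _ ≤ ∫⁻ y : Fin n → Obs d, ENNReal.ofReal (Real.exp (s * ‖G‖)) *
        ((∏ k, ENNReal.ofReal (Real.exp (s * (f (y k) - b)))) *
          ∫⁻ x, φ x ∂(unnormalizedFilter κ m σ (fun x => h (pr x)) n y)) := by
        refine lintegral_mono fun y => ?_
        rw [mul_left_comm]
        gcongr
        exact hmass y
    _ = ENNReal.ofReal (Real.exp (s * ‖G‖)) * ∫⁻ y : Fin n → Obs d,
        (∏ k, ENNReal.ofReal (Real.exp (s * (f (y k) - b)))) *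
          ∫⁻ x, φ x ∂(unnormalizedFilter κ m σ (fun x => h (pr x)) n y) :=
        lintegral_const_mul _ (hprodm.mul
          (measurable_lintegral_unnormalizedFilter κ m σ hhm n hφm))
    _ ≤ ENNReal.ofReal (Real.exp (s * ‖G‖)) * ((∏ _k ∈ Finset.range n,
        ENNReal.ofReal (Real.exp (-(s * τ / 2)))) *
        (ENNReal.ofReal (Real.exp (s * ‖G‖)) * m Set.univ)) := by
        gcongr
        exact hmain.trans (by gcongr)
    _ = _ := by
        rw [Finset.prod_const, Finset.card_range, ← ENNReal.ofReal_pow (Real.exp_pos _).le,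
          ← Real.exp_nat_mul, show (n : ℝ) * -(s * τ / 2) = -(s * τ / 2 * n) by ring]
        ring

end Exponential

/-! ### The Poisson inequality and its stability in the parameter -/

section Poisson

variable {E : Type*} [TopologicalSpace E] [MeasurableSpace E] [BorelSpace E] {d : ℕ}

lemma sum_iterate_fellerOp {κ : Kernel E E} [IsMarkovKernel κ] (hF : IsFeller κ) (f : E →ᵇ ℝ)
    (n : ℕ) (x : E) :
    f x + ∫ z, (∑ k ∈ Finset.range n, (fellerOp hF)^[k] f) z ∂(κ x)
      = (∑ k ∈ Finset.range n, (fellerOp hF)^[k] f) x + ((fellerOp hF)^[n] f) x := by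
  induction n with
  | zero => simp
  | succ n ih =>
    simp only [Finset.sum_range_succ, BoundedContinuousFunction.coe_add, Pi.add_apply]
    rw [integral_add (integrable_bcf _ _) (integrable_bcf _ _), ← add_assoc, ih,
      Function.iterate_succ_apply', fellerOp_apply]

variable [PolishSpace E]

/-- A strict solution of the Poisson inequality. -/
lemma exists_poisson {κ : Kernel E E} [IsMarkovKernel κ] (hF : IsFeller κ) (hM : IsMixing κ)
    (m : Measure E) [IsProbabilityMeasure m] (σ : ℝ) [Fact (0 < σ)] (h : E →ᵇ Obs d)
    (f : Obs d →ᵇ ℝ) {b : ℝ} (hb : ∫ y, f y ∂(limitingObsLaw κ σ h) < b) :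
    ∃ (G : E →ᵇ ℝ) (τ : ℝ), 0 < τ ∧
      ∀ x, obsMean σ h f x - b + ∫ z, G z ∂(κ x) ≤ G x - 2 * τ := by
  have hlim := isLimitingDistribution_limitingDistribution hF hM m
  have := hlim.1
  rw [integral_limitingObsLaw] at hb
  set c := ∫ x, obsMean σ h f x ∂(limitingDistribution κ)
  obtain ⟨n, hn⟩ := exists_abs_iterate_sub_le hF hM m (obsMean σ h f) (η := (b - c) / 2)
    (by linarith)
  -- The truncated potential solves the Poisson equation up to the `n`-th iterate, which is within
  -- `(b - c) / 2` of `c`. This leaves slack `(b - c) / 2 = 2 * τ`.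
  refine ⟨∑ k ∈ Finset.range n, (fellerOp hF)^[k] (obsMean σ h f), (b - c) / 4, by linarith,
    fun x => ?_⟩
  have h1 := sum_iterate_fellerOp hF (obsMean σ h f) n x
  have h2 := (abs_le.1 (hn x)).2
  linarith

lemma exists_exp_bound {κ : Kernel E E} [IsMarkovKernel κ] (hF : IsFeller κ) (hM : IsMixing κ)
    (m : Measure E) [IsProbabilityMeasure m] (σ : ℝ) [Fact (0 < σ)] (h : E →ᵇ Obs d)
    (f : Obs d →ᵇ ℝ) {b : ℝ} (hb : ∫ y, f y ∂(limitingObsLaw κ σ h) < b) :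
    ∃ s : ℝ, 0 < s ∧ ∃ c : ℝ, 0 < c ∧ ∃ C : ℝ≥0∞, C ≠ ⊤ ∧ ∀ n : ℕ,
      ∫⁻ y : Fin n → Obs d, (∏ k, ENNReal.ofReal (Real.exp (s * (f (y k) - b)))) *
        obsDensity κ m σ h n y ≤ C * ENNReal.ofReal (Real.exp (-(c * n))) := by
  obtain ⟨G, τ, hτ, hG⟩ := exists_poisson hF hM m σ h f hb
  obtain ⟨s, hs, c, hc, C, hC, H⟩ := lintegral_exp_unnormalizedFilter_le κ (measurable_id) σ h f G
    (b := b) hτ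
  refine ⟨s, hs, c, hc, C, hC, fun n => ?_⟩
  have := H Set.univ MeasurableSet.univ (by simp) (by simp)
    (fun x _ => (hG x).trans (by rw [id]; linarith)) m (by simp) n
  simpa [obsDensity_eq κ m σ h.continuous.measurable] using this

/-- Of the slack `2 * τ`, continuity of `K` at `θ₀` may use up `τ`, so one `G` serves every
parameter in `U`. As the parameter never moves, `U` is neither entered nor left, and the bound holds
for arbitrary mixtures over `U`. -/
lemma exists_nhds_exp_bound {T : Type*} [TopologicalSpace T] [MeasurableSpace T]
    [OpensMeasurableSpace T] (K : Kernel (E × T) E) [IsMarkovKernel K] (hK : KernelContinuous K)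
    (θ₀ : T) (hF : IsFeller (K.sectL θ₀)) (hM : IsMixing (K.sectL θ₀))
    (m : Measure E) [IsProbabilityMeasure m] (σ : ℝ) [Fact (0 < σ)] (h : E →ᵇ Obs d)
    (f : Obs d →ᵇ ℝ) {b : ℝ} (hb : ∫ y, f y ∂(limitingObsLaw (K.sectL θ₀) σ h) < b) :
    ∃ U : Set T, IsOpen U ∧ θ₀ ∈ U ∧
    ∃ s : ℝ, 0 < s ∧ ∃ c : ℝ, 0 < c ∧ ∃ C : ℝ≥0∞, C ≠ ⊤ ∧
      ∀ (M : Measure (E × T)) [IsFiniteMeasure M], M (Prod.snd ⁻¹' Uᶜ) = 0 → ∀ n : ℕ,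
      ∫⁻ y : Fin n → Obs d, (∏ k, ENNReal.ofReal (Real.exp (s * (f (y k) - b)))) *
        unnormalizedFilter (augmentedKernel K) M σ (fun p => h p.1) n y Set.univ
        ≤ C * ENNReal.ofReal (Real.exp (-(c * n))) * M Set.univ := by
  obtain ⟨G, τ, hτ, hG⟩ := exists_poisson hF hM m σ h f hb
  have hnear := Metric.tendstoUniformly_iff.1 (hK G θ₀) τ hτ
  obtain ⟨U, hUsub, hU, hθU⟩ := mem_nhds_iff.1 hnear
  obtain ⟨s, hs, c, hc, C, hC, H⟩ := lintegral_exp_unnormalizedFilter_le (augmentedKernel K)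
    measurable_fst σ h f G (b := b) hτ
  refine ⟨U, hU, hθU, s, hs, c, hc, C, hC, fun M _ hMU n => ?_⟩
  refine H (Prod.snd ⁻¹' U) (measurable_snd hU.measurableSet) (fun p hp => ?_) (fun p hp => ?_)
    (fun p hp => ?_) M hMU n
  · exact augmentedKernel_snd_preimage K p hU.measurableSet.compl (by simpa using hp)
  · exact augmentedKernel_snd_preimage K p hU.measurableSet hp
  · have hint : ∫ z, G z.1 ∂(augmentedKernel K p) = ∫ z, G z ∂(K p) := by
      have hmap : (augmentedKernel K p).map Prod.fst = K p := by
        rw [augmentedKernel, Kernel.prod_apply, Measure.map_fst_prod]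
        simp
      rw [← hmap, integral_map measurable_fst.aemeasurable
        G.continuous.measurable.aestronglyMeasurable]
    have h1 := hUsub hp p.1
    rw [dist_comm, Real.dist_eq] at h1
    have h2 := (abs_lt.1 h1).2
    have h3 := hG p.1
    rw [hint]
    change _ - b + ∫ z, G z ∂(K (p.1, p.2)) ≤ _
    rw [Kernel.sectL_apply] at h3
    linarith

end Poisson

/-! ### The observation density of the augmented system as a mixture -/

section Posterior

variable {E T : Type*} [MeasurableSpace E] [MeasurableSpace T] {d : ℕ}

/-- The augmented flow is a mixture over the parameter. -/
lemma lintegral_fkFlow_augmentedKernel (K : Kernel (E × T) E) [IsMarkovKernel K] (μ : Measure E)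
    [SFinite μ] (u : Measure T) [SFinite u] {g : ℕ → E → ℝ≥0∞} (hg : ∀ n, Measurable (g n)) (n : ℕ)
    {F : E × T → ℝ≥0∞} (hF : Measurable F) :
    ∫⁻ p, F p ∂(fkFlow (augmentedKernel K) (μ.prod u) (fun n p => g n p.1) n)
      = ∫⁻ θ, ∫⁻ x, F (x, θ) ∂(fkFlow (K.sectL θ) μ g n) ∂u := by
  have hgp : ∀ n, Measurable fun p : E × T => g n p.1 := fun n => (hg n).comp measurable_fst
  induction n generalizing F with
  | zero =>
    simp only [fkFlow_zero]
    exact lintegral_prod_symm' _ hF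
  | succ n ih =>
    have hgF : Measurable fun p : E × T => g n p.1 * F p := (hgp n).mul hF
    rw [lintegral_fkFlow_succ _ _ hgp n hF, ih hgF.lintegral_kernel]
    refine lintegral_congr fun θ => ?_
    rw [lintegral_fkFlow_succ _ _ hg n (f := fun x => F (x, θ)) (hF.comp measurable_prodMk_right)]
    refine lintegral_congr fun x => ?_
    rw [lintegral_augmentedKernel K (x, θ) hgF, Kernel.sectL_apply]

lemma obsDensity_augmentedKernel (K : Kernel (E × T) E) [IsMarkovKernel K] (μ : Measure E)
    [IsFiniteMeasure μ] (u : Measure T) [IsFiniteMeasure u] (σ : ℝ) {h : E → Obs d}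
    (hh : Measurable h) (n : ℕ) (y : Fin n → Obs d) :
    obsDensity (augmentedKernel K) (μ.prod u) σ (fun p => h p.1) n y
      = ∫⁻ θ, obsDensity (K.sectL θ) μ σ h n y ∂u := by
  have h1 := lintegral_fkFlow_augmentedKernel K μ u (measurable_likelihood σ hh (extendObs y)) n
    (F := fun _ => 1) measurable_const
  simp only [lintegral_one] at h1
  have hhf : Measurable fun p : E × T => h p.1 := hh.comp measurable_fst
  rw [obsDensity_eq _ _ _ hhf, unnormalizedFilter_eq _ _ σ hhf]
  simp only [obsDensity_eq _ _ _ hh, unnormalizedFilter_eq _ _ σ hh]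
  exact h1

lemma obsDensity_ne_top {S : Type*} [MeasurableSpace S] (κ : Kernel S S) [IsMarkovKernel κ]
    (m : Measure S) [IsFiniteMeasure m] {σ : ℝ} (hσ : 0 < σ) {h : S → Obs d}
    (hh : Measurable h) (n : ℕ) (y : Fin n → Obs d) : obsDensity κ m σ h n y ≠ ⊤ := by
  rw [obsDensity_eq κ m σ hh, unnormalizedFilter_eq κ m σ hh]
  have := isFiniteMeasure_fkFlow κ m (measurable_likelihood σ hh (extendObs y))
    (fun _ => ENNReal.ofReal_ne_top) (fun n x => gaussDensity_le hσ (extendObs y n - h x)) n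
  exact measure_ne_top _ _

lemma obsDensity_ne_zero {S : Type*} [MeasurableSpace S] (κ : Kernel S S) [IsMarkovKernel κ]
    (m : Measure S) [IsProbabilityMeasure m] {σ H : ℝ} (hσ : 0 < σ) {h : S → Obs d}
    (hh : Measurable h) (hH : ∀ x, ‖h x‖ ≤ H) (n : ℕ) (y : Fin n → Obs d) :
    obsDensity κ m σ h n y ≠ 0 := by
  rw [obsDensity_eq κ m σ hh, unnormalizedFilter_eq κ m σ hh]
  have h1 := le_fkFlow_univ κ m (measurable_likelihood σ hh (extendObs y))
    (G := fun n => gaussDensity σ (extendObs y n) / ratioBound σ H (extendObs y n))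
    (fun n x => ENNReal.div_le_of_le_mul (gaussDensity_le_sub hσ (hH x) _)) n
  refine ne_of_gt (lt_of_lt_of_le (pos_iff_ne_zero.2 ?_) h1)
  rw [measure_univ, mul_one]
  exact Finset.prod_ne_zero_iff.2 fun k _ =>
    (ENNReal.div_pos (gaussDensity_pos hσ _).ne' (ratioBound_ne_top _ _ _)).ne'

lemma lintegral_obsLaw {S : Type*} [MeasurableSpace S] (κ : Kernel S S) [IsMarkovKernel κ]
    (m : Measure S) [IsFiniteMeasure m] (σ : ℝ) {h : S → Obs d} (hh : Measurable h) (n : ℕ)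
    {F : (Fin n → Obs d) → ℝ≥0∞} (hF : Measurable F) :
    ∫⁻ y, F y ∂(obsLaw κ m σ h n) = ∫⁻ y, obsDensity κ m σ h n y * F y :=
  lintegral_withDensity_eq_lintegral_mul _ (measurable_obsDensity κ m σ hh n) hF

/-- The mixture density is at least the mass `u V` times the smallest density over `V`. This brings
the prior mass condition to bear on the mixture. -/
lemma density_ratio_le (K : Kernel (E × T) E) [IsMarkovKernel K] (μ μ' : Measure E)
    [IsProbabilityMeasure μ] [IsProbabilityMeasure μ'] (u : Measure T) [IsFiniteMeasure u]
    {σ H : ℝ} (hσ : 0 < σ) {h : E → Obs d} (hh : Measurable h) (hH : ∀ x, ‖h x‖ ≤ H)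
    {α : T} {V : Set T} (hV : MeasurableSet V) (hα : α ∈ V) (n : ℕ) (y : Fin n → Obs d) :
    obsDensity (K.sectL α) μ' σ h n y /
        obsDensity (augmentedKernel K) (μ.prod u) σ (fun p => h p.1) n y
      ≤ (⨆ θ ∈ V, obsDensity (K.sectL α) μ' σ h n y / obsDensity (K.sectL θ) μ σ h n y) / u V := by
  set q := obsDensity (K.sectL α) μ' σ h n y with hq
  have hq0 : q ≠ 0 := obsDensity_ne_zero _ _ hσ hh hH n y
  have hqt : q ≠ ⊤ := obsDensity_ne_top _ _ hσ hh n y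
  set R := ⨆ θ ∈ V, q / obsDensity (K.sectL θ) μ σ h n y with hR
  have hR0 : R ≠ 0 := by
    refine ne_of_gt (lt_of_lt_of_le ?_ (le_iSup₂_of_le α hα le_rfl))
    exact ENNReal.div_pos hq0 (obsDensity_ne_top _ _ hσ hh n y)
  rcases eq_or_ne (u V) 0 with hu | hu
  · rw [hu, ENNReal.div_zero hR0]; exact le_top
  rcases eq_or_ne R ⊤ with hRt | hRt
  · rw [hRt, ENNReal.top_div_of_ne_top (measure_ne_top _ _)]; exact le_top
  have hD : u V * (q / R) ≤ obsDensity (augmentedKernel K) (μ.prod u) σ (fun p => h p.1) n y := by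
    rw [obsDensity_augmentedKernel K μ u σ hh]
    calc u V * (q / R) = ∫⁻ _ in V, q / R ∂u := by rw [setLIntegral_const, mul_comm]
      _ ≤ ∫⁻ θ in V, obsDensity (K.sectL θ) μ σ h n y ∂u := by
          refine setLIntegral_mono' hV fun θ hθ => ?_
          refine ENNReal.div_le_of_le_mul ?_
          rw [mul_comm]
          refine (ENNReal.div_le_iff (obsDensity_ne_zero _ _ hσ hh hH n y)
            (obsDensity_ne_top _ _ hσ hh n y)).1 ?_
          exact le_iSup₂_of_le (f := fun θ (_ : θ ∈ V) => q / obsDensity (K.sectL θ) μ σ h n y)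
            θ hθ le_rfl
      _ ≤ _ := setLIntegral_le_lintegral _ _
  refine (ENNReal.div_le_div_left hD q).trans (le_of_eq ?_)
  rw [ENNReal.div_eq_div_iff hu (measure_ne_top _ _) (mul_ne_zero hu (ENNReal.div_pos hq0 hRt).ne')
    (ENNReal.mul_ne_top (measure_ne_top _ _) (ENNReal.div_ne_top hqt hR0)), mul_assoc,
    ENNReal.div_mul_cancel hR0 hRt]

end Posterior

/-! ### Posterior consistency -/

section Consistency

lemma tendsto_const_mul_exp_neg {C : ℝ≥0∞} (hC : C ≠ ⊤) {x : ℕ → ℝ} (hx : Tendsto x atTop atTop) :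
    Tendsto (fun n => C * ENNReal.ofReal (Real.exp (-(x n)))) atTop (𝓝 0) := by
  have h1 : Tendsto (fun n => ENNReal.ofReal (Real.exp (-(x n)))) atTop (𝓝 0) := by
    rw [← ENNReal.ofReal_zero]
    exact (ENNReal.continuous_ofReal.tendsto 0).comp
      (Real.tendsto_exp_neg_atTop_nhds_zero.comp hx)
  simpa using ENNReal.Tendsto.const_mul h1 (Or.inr hC)

/-- Three ways to be small: the data are atypical under the truth (`P₁ ≥ 1`); or the ratio `q / D`
exceeds `t`, handled by Markov with exponent `r`; or `q / D ≤ t`, which allows `q a / D` to be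
replaced by `t a`, where the data are atypical for the wrong parameters (`P₂ ≥ 1`). -/
lemma mul_div_le_three_terms {q a D P₁ P₂ t : ℝ≥0∞} {r : ℝ} (haD : a ≤ D) (ht0 : t ≠ 0)
    (ht : t ≠ ⊤) (hr : 0 < r) (hP : 1 ≤ P₁ ∨ 1 ≤ P₂) :
    q * (a / D) ≤ q * P₁ + t⁻¹ ^ r * (q * (q / D) ^ r) + t * (P₂ * a) := by
  have h1 : a / D ≤ 1 := ENNReal.div_le_of_le_mul (by simpa using haD)
  rcases hP with hP | hP
  · calc q * (a / D) ≤ q * P₁ := by gcongr; exact h1.trans hP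
      _ ≤ _ := by rw [add_assoc]; exact le_self_add
  · rcases le_or_gt (q / D) t with h2 | h2
    · calc q * (a / D) = (q / D) * (1 * a) := by simp only [div_eq_mul_inv, one_mul]; ring
        _ ≤ t * (P₂ * a) := by gcongr
        _ ≤ _ := le_add_self
    · have h3 : 1 ≤ t⁻¹ ^ r * (q / D) ^ r := by
        rw [← ENNReal.mul_rpow_of_nonneg _ _ hr.le]
        refine ENNReal.one_le_rpow ?_ hr
        rw [← ENNReal.inv_mul_cancel ht0 ht]
        gcongr
      calc q * (a / D) ≤ q * (t⁻¹ ^ r * (q / D) ^ r) := by gcongr; exact h1.trans h3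
        _ = t⁻¹ ^ r * (q * (q / D) ^ r) := by ring
        _ ≤ _ := by rw [add_right_comm]; exact le_add_self

/-- The empirical mean of `f` is either at least or at most `b`: a likelihood-free test between the
two hypotheses. -/
lemma one_le_prod_exp_or {d n : ℕ} (f : Obs d →ᵇ ℝ) (b : ℝ) {s s' : ℝ} (hs : 0 < s) (hs' : 0 < s')
    (y : Fin n → Obs d) :
    1 ≤ ∏ k, ENNReal.ofReal (Real.exp (s' * ((-f) (y k) - (-b)))) ∨
    1 ≤ ∏ k, ENNReal.ofReal (Real.exp (s * (f (y k) - b))) := by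
  rw [← ENNReal.ofReal_prod_of_nonneg fun _ _ => (Real.exp_pos _).le,
    ← ENNReal.ofReal_prod_of_nonneg fun _ _ => (Real.exp_pos _).le, ← Real.exp_sum, ← Real.exp_sum,
    ← Finset.mul_sum, ← Finset.mul_sum, ← ENNReal.ofReal_one]
  have h1 : ∑ k, ((-f) (y k) - -b) = -∑ k, (f (y k) - b) := by
    rw [← Finset.sum_neg_distrib]
    refine Finset.sum_congr rfl fun k _ => ?_
    simp; ring
  rw [h1]
  rcases le_total 0 (∑ k, (f (y k) - b)) with h2 | h2
  · exact Or.inr (ENNReal.ofReal_le_ofReal (Real.one_le_exp (by positivity)))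
  · exact Or.inl (ENNReal.ofReal_le_ofReal (Real.one_le_exp (by nlinarith)))

variable {E : Type*} [TopologicalSpace E] [PolishSpace E] [MeasurableSpace E] [BorelSpace E]
  {d : ℕ}

/-- The posterior mass of a neighbourhood of a wrong parameter tends to zero. -/
lemma exists_nhds_tendsto_posterior {T : Type*} [PseudoMetricSpace T] [MeasurableSpace T]
    [OpensMeasurableSpace T] (K : Kernel (E × T) E) [IsMarkovKernel K] (hK : KernelContinuous K)
    (hFeller : ∀ θ, IsFeller (K.sectL θ)) (hMixing : ∀ θ, IsMixing (K.sectL θ))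
    (μ μ' : Measure E) [IsProbabilityMeasure μ] [IsProbabilityMeasure μ']
    (u : Measure T) [IsProbabilityMeasure u] {σ : ℝ} (hσ : 0 < σ) (h : E →ᵇ Obs d)
    (α θ₀ : T) (hPrior : PriorMassCondition K μ μ' u α σ h)
    (hne : limitingObsLaw (K.sectL θ₀) σ h ≠ limitingObsLaw (K.sectL α) σ h) :
    ∃ U : Set T, IsOpen U ∧ θ₀ ∈ U ∧
      Tendsto (fun n => ∫⁻ y,
        obsDensity (augmentedKernel K) (μ.prod (u.restrict U)) σ (fun p => h p.1) n y /
          obsDensity (augmentedKernel K) (μ.prod u) σ (fun p => h p.1) n y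
        ∂(obsLaw (K.sectL α) μ' σ h n)) atTop (𝓝 0) := by
  have : Fact (0 < σ) := ⟨hσ⟩
  have hlim : ∀ θ, IsFiniteMeasure (limitingObsLaw (K.sectL θ) σ h) := fun θ => by
    have := (isLimitingDistribution_limitingDistribution (hFeller θ) (hMixing θ) μ).1
    unfold limitingObsLaw; infer_instance
  -- Bounded continuous functions separate finite measures; passing to `-f` if needed, `b` is placed
  -- strictly between the two means.
  obtain ⟨f, b, hb1, hb2⟩ : ∃ (f : Obs d →ᵇ ℝ) (b : ℝ),
      ∫ y, f y ∂(limitingObsLaw (K.sectL θ₀) σ h) < b ∧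
      ∫ y, (-f) y ∂(limitingObsLaw (K.sectL α) σ h) < -b := by
    by_contra! hcon
    refine hne (ext_of_forall_integral_eq_of_IsFiniteMeasure fun f => ?_)
    have key : ∀ f : Obs d →ᵇ ℝ, ∫ y, f y ∂(limitingObsLaw (K.sectL α) σ h)
        ≤ ∫ y, f y ∂(limitingObsLaw (K.sectL θ₀) σ h) := by
      intro f
      refine le_of_forall_gt_imp_ge_of_dense fun b hb => ?_
      have := hcon f b hb
      simp only [BoundedContinuousFunction.coe_neg, Pi.neg_apply, integral_neg] at this
      linarith
    refine le_antisymm ?_ (key f)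
    have := key (-f)
    simp only [BoundedContinuousFunction.coe_neg, Pi.neg_apply, integral_neg] at this
    linarith
  obtain ⟨s', hs', c', hc', C', hC', H'⟩ := exists_exp_bound (hFeller α) (hMixing α) μ' σ h (-f) hb2
  obtain ⟨U, hU, hθU, s, hs, c, hc, C, hC, H⟩ := exists_nhds_exp_bound K hK θ₀ (hFeller θ₀)
    (hMixing θ₀) μ σ h f hb1
  refine ⟨U, hU, hθU, ?_⟩
  obtain ⟨ε, p, hε, -, -, hp1, hp, hsup⟩ := hPrior
  obtain ⟨M, hM1, hM2⟩ := exists_between hsup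
  have hev := eventually_lt_of_limsup_lt hM1
  have hhm : Measurable h := h.continuous.measurable
  have hhf : Measurable fun q : E × T => h q.1 := hhm.comp measurable_fst
  have hHb : ∀ x, ‖h x‖ ≤ ‖h‖ := h.norm_coe_le_norm
  set q : (n : ℕ) → (Fin n → Obs d) → ℝ≥0∞ := fun n => obsDensity (K.sectL α) μ' σ h n with hq
  set D : (n : ℕ) → (Fin n → Obs d) → ℝ≥0∞ := fun n =>
    obsDensity (augmentedKernel K) (μ.prod u) σ (fun p => h p.1) n with hD
  set a : (n : ℕ) → (Fin n → Obs d) → ℝ≥0∞ := fun n =>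
    obsDensity (augmentedKernel K) (μ.prod (u.restrict U)) σ (fun p => h p.1) n with ha
  have hqm : ∀ n, Measurable (q n) := fun n => measurable_obsDensity _ _ σ hhm n
  have hDm : ∀ n, Measurable (D n) := fun n => measurable_obsDensity _ _ σ hhf n
  have ham : ∀ n, Measurable (a n) := fun n => measurable_obsDensity _ _ σ hhf n
  have haD : ∀ n y, a n y ≤ D n y := fun n y => by
    simp only [ha, hD]
    rw [obsDensity_augmentedKernel K μ u σ hhm, obsDensity_augmentedKernel K μ _ σ hhm]
    exact setLIntegral_le_lintegral _ _
  -- Half of the exponential rate goes to each side: `t` times the bound `exp (-c n)` still decays,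
  -- and `t ^ (-1 / p n) = exp (-(c / 2) n / p n)` tends to `0` because `p n / n` does.
  set t : ℕ → ℝ≥0∞ := fun n => ENNReal.ofReal (Real.exp (c * n / 2)) with ht
  have ht0 : ∀ n, t n ≠ 0 := fun n => (ENNReal.ofReal_pos.2 (Real.exp_pos _)).ne'
  have htt : ∀ n, t n ≠ ⊤ := fun n => ENNReal.ofReal_ne_top
  have hwm : ∀ (f : Obs d →ᵇ ℝ) (s b : ℝ) (n : ℕ), Measurable fun y : Fin n → Obs d =>
      ∏ k, ENNReal.ofReal (Real.exp (s * (f (y k) - b))) := fun f s b n => by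
    have := f.continuous.measurable
    fun_prop
  have hmain : ∀ᶠ n in atTop, ∫⁻ y, a n y / D n y ∂(obsLaw (K.sectL α) μ' σ h n)
      ≤ C' * ENNReal.ofReal (Real.exp (-(c' * n)))
        + M * ENNReal.ofReal (Real.exp (-(c / 2 * (p n / n)⁻¹)))
        + C * ENNReal.ofReal (Real.exp (-(c / 2 * n))) := by
    filter_upwards [hev, eventually_gt_atTop 0] with n hn hn0
    have hpn : 0 < 1 / p n := by have := hp1 n; positivity
    have hr1 : ∫⁻ y, q n y * (q n y / D n y) ^ (1 / p n) ≤ M := by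
      rw [← lintegral_obsLaw _ _ σ hhm n (F := fun y => (q n y / D n y) ^ (1 / p n))
        (((hqm n).div (hDm n)).pow_const _)]
      refine le_trans (lintegral_mono fun y => ?_) hn.le
      refine ENNReal.rpow_le_rpow ?_ hpn.le
      exact density_ratio_le K μ μ' u hσ hhm hHb Metric.isOpen_ball.measurableSet
        (Metric.mem_ball_self (hε n)) n y
    have hr2 : ∫⁻ y, (∏ k, ENNReal.ofReal (Real.exp (s * (f (y k) - b)))) * a n y
        ≤ C * ENNReal.ofReal (Real.exp (-(c * n))) := by
      have h1 := H (μ.prod (u.restrict U)) (by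
        have : (Prod.snd ⁻¹' Uᶜ : Set (E × T)) = Set.univ ×ˢ Uᶜ := by ext; simp
        rw [this, Measure.prod_prod, Measure.restrict_apply hU.measurableSet.compl]
        simp) n
      simp only [ha, obsDensity_eq _ _ σ hhf]
      refine h1.trans (mul_le_of_le_one_right' ?_)
      rw [← Set.univ_prod_univ, Measure.prod_prod]
      simpa using (measure_mono (Set.subset_univ U)).trans_eq (measure_univ (μ := u))
    have hr3 : ∫⁻ y, q n y * ∏ k, ENNReal.ofReal (Real.exp (s' * ((-f) (y k) - (-b))))
        ≤ C' * ENNReal.ofReal (Real.exp (-(c' * n))) := by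
      refine le_trans (le_of_eq (lintegral_congr fun y => mul_comm _ _)) (H' n)
    rw [lintegral_obsLaw _ _ σ hhm n (F := fun y => a n y / D n y) ((ham n).div (hDm n))]
    calc _ ≤ ∫⁻ y, (q n y * (∏ k, ENNReal.ofReal (Real.exp (s' * ((-f) (y k) - (-b)))))
          + (t n)⁻¹ ^ (1 / p n) * (q n y * (q n y / D n y) ^ (1 / p n))
          + t n * ((∏ k, ENNReal.ofReal (Real.exp (s * (f (y k) - b)))) * a n y)) :=
          lintegral_mono fun y => mul_div_le_three_terms (haD n y) (ht0 n) (htt n) hpn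
            (one_le_prod_exp_or f b hs hs' y)
      _ = (∫⁻ y, q n y * (∏ k, ENNReal.ofReal (Real.exp (s' * ((-f) (y k) - (-b))))))
          + (t n)⁻¹ ^ (1 / p n) * (∫⁻ y, q n y * (q n y / D n y) ^ (1 / p n))
          + t n * ∫⁻ y, (∏ k, ENNReal.ofReal (Real.exp (s * (f (y k) - b)))) * a n y := by
          have m1 : Measurable fun y =>
              q n y * (∏ k, ENNReal.ofReal (Real.exp (s' * ((-f) (y k) - (-b))))) :=
            (hqm n).mul (hwm (-f) s' (-b) n)
          have m2 : Measurable fun y => q n y * (q n y / D n y) ^ (1 / p n) :=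
            (hqm n).mul (((hqm n).div (hDm n)).pow_const _)
          have m3 : Measurable fun y =>
              (∏ k, ENNReal.ofReal (Real.exp (s * (f (y k) - b)))) * a n y :=
            (hwm f s b n).mul (ham n)
          rw [lintegral_add_right _ (m3.const_mul _), lintegral_add_right _ (m2.const_mul _),
            lintegral_const_mul _ m2, lintegral_const_mul _ m3]
      _ ≤ C' * ENNReal.ofReal (Real.exp (-(c' * n))) + (t n)⁻¹ ^ (1 / p n) * M
          + t n * (C * ENNReal.ofReal (Real.exp (-(c * n)))) := by gcongr
      _ = _ := by
          have e1 : (t n)⁻¹ ^ (1 / p n) = ENNReal.ofReal (Real.exp (-(c / 2 * (p n / n)⁻¹))) := by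
            rw [ht]
            simp only
            rw [← ENNReal.ofReal_inv_of_pos (Real.exp_pos _), ← Real.exp_neg,
              ENNReal.ofReal_rpow_of_pos (Real.exp_pos _), ← Real.exp_mul]
            congr 2
            field_simp
          have e2 : t n * ENNReal.ofReal (Real.exp (-(c * n)))
              = ENNReal.ofReal (Real.exp (-(c / 2 * n))) := by
            rw [ht]
            simp only
            rw [← ENNReal.ofReal_mul (Real.exp_pos _).le, ← Real.exp_add]
            congr 2
            ring
          rw [e1, ← e2]
          ring
  refine tendsto_of_tendsto_of_tendsto_of_le_of_le' tendsto_const_nhds ?_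
    (Eventually.of_forall fun n => zero_le) hmain
  have hinv : Tendsto (fun n : ℕ => (p n / n)⁻¹) atTop atTop := by
    refine Tendsto.inv_tendsto_nhdsGT_zero ?_
    rw [tendsto_nhdsWithin_iff]
    refine ⟨hp, ?_⟩
    filter_upwards [eventually_gt_atTop 0] with n hn
    have := hp1 n
    exact Set.mem_Ioi.2 (by positivity)
  have l1 := tendsto_const_mul_exp_neg hC'
    ((tendsto_natCast_atTop_atTop (R := ℝ)).const_mul_atTop hc')
  have l2 := tendsto_const_mul_exp_neg hM2.ne (hinv.const_mul_atTop (half_pos hc))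
  have l3 := tendsto_const_mul_exp_neg hC
    ((tendsto_natCast_atTop_atTop (R := ℝ)).const_mul_atTop (half_pos hc))
  simpa using (l1.add l2).add l3

/-- Posterior consistency. -/
lemma tendsto_posterior_compl_ball {T : Type*} [PseudoMetricSpace T] [CompactSpace T]
    [MeasurableSpace T] [OpensMeasurableSpace T] (K : Kernel (E × T) E) [IsMarkovKernel K]
    (hK : KernelContinuous K)
    (hFeller : ∀ θ, IsFeller (K.sectL θ)) (hMixing : ∀ θ, IsMixing (K.sectL θ))
    (μ μ' : Measure E) [IsProbabilityMeasure μ] [IsProbabilityMeasure μ']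
    (u : Measure T) [IsProbabilityMeasure u] {σ : ℝ} (hσ : 0 < σ) (h : E →ᵇ Obs d)
    (α : T) (hPrior : PriorMassCondition K μ μ' u α σ h) {δ : ℝ}
    (hne : ∀ θ, δ ≤ dist θ α →
      limitingObsLaw (K.sectL θ) σ h ≠ limitingObsLaw (K.sectL α) σ h) :
    Tendsto (fun n => ∫⁻ y,
        obsDensity (augmentedKernel K) (μ.prod (u.restrict (Metric.ball α δ)ᶜ)) σ
            (fun p => h p.1) n y /
          obsDensity (augmentedKernel K) (μ.prod u) σ (fun p => h p.1) n y
        ∂(obsLaw (K.sectL α) μ' σ h n)) atTop (𝓝 0) := by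
  have hmem : ∀ θ ∈ (Metric.ball α δ)ᶜ, δ ≤ dist θ α := fun θ hθ => by simpa using hθ
  choose! U hU hθU hlim using fun θ (hθ : δ ≤ dist θ α) =>
    exists_nhds_tendsto_posterior K hK hFeller hMixing μ μ' u hσ h α θ hPrior (hne θ hθ)
  have hcomp : IsCompact (Metric.ball α δ)ᶜ := Metric.isOpen_ball.isClosed_compl.isCompact
  obtain ⟨s, hs, hcov⟩ := hcomp.elim_nhds_subcover U fun θ hθ =>
    (hU θ (hmem θ hθ)).mem_nhds (hθU θ (hmem θ hθ))
  have hhm : Measurable h := h.continuous.measurable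
  have hhf : Measurable fun q : E × T => h q.1 := hhm.comp measurable_fst
  have hsum := tendsto_finsetSum s fun θ hθ => hlim θ (hmem θ (hs θ hθ))
  simp only [Finset.sum_const_zero] at hsum
  refine tendsto_of_tendsto_of_tendsto_of_le_of_le tendsto_const_nhds hsum (fun n => zero_le)
    fun n => ?_
  have hm : ∀ θ ∈ s, Measurable fun y =>
      obsDensity (augmentedKernel K) (μ.prod (u.restrict (U θ))) σ (fun p => h p.1) n y /
        obsDensity (augmentedKernel K) (μ.prod u) σ (fun p => h p.1) n y := fun θ _ =>
    (measurable_obsDensity _ _ σ hhf n).div (measurable_obsDensity _ _ σ hhf n)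
  rw [← lintegral_finsetSum s hm]
  refine lintegral_mono fun y => ?_
  simp only [div_eq_mul_inv, ← Finset.sum_mul, obsDensity_augmentedKernel K μ _ σ hhm]
  gcongr
  calc _ ≤ ∫⁻ θ in ⋃ x ∈ s, U x, obsDensity (K.sectL θ) μ σ h n y ∂u := lintegral_mono_set hcov
    _ ≤ _ := by
      classical
      clear hm hsum hcov hs
      induction s using Finset.cons_induction with
      | empty => simp
      | cons x s hx ih =>
        rw [Finset.sum_cons, Finset.cons_eq_insert, Finset.set_biUnion_insert]
        exact (lintegral_union_le _ _ _).trans (add_le_add_right ih _)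

end Consistency

/-! ### Combining forgetting with perturbation -/

section Stability

variable {S E : Type*} [MeasurableSpace S] [MeasurableSpace E]

lemma normalized_fkFlow_smul (κ : Kernel S S) {c : ℝ≥0∞} (hc0 : c ≠ 0) (hc : c ≠ ⊤)
    (m : Measure S) {g : ℕ → S → ℝ≥0∞} (hg : ∀ n, Measurable (g n)) (n : ℕ) (A : Set S) :
    (fkFlow κ (c • m) g n).real A / (fkFlow κ (c • m) g n).real Set.univ
      = (fkFlow κ m g n).real A / (fkFlow κ m g n).real Set.univ := by
  rw [fkFlow_smul κ c m hg, measureReal_ennreal_smul_apply, measureReal_ennreal_smul_apply,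
    mul_div_mul_left _ _ (ENNReal.toReal_pos hc0 hc).ne']

lemma isProbabilityMeasure_inv_smul {M : Measure S} [IsFiniteMeasure M] (hM : M ≠ 0) :
    IsProbabilityMeasure ((M Set.univ)⁻¹ • M) :=
  ⟨by rw [Measure.smul_apply, smul_eq_mul,
    ENNReal.inv_mul_cancel (by simpa using hM) (measure_ne_top _ _)]⟩

variable {ε : ℝ} {lam : Measure E}

/-- A flow with a wrong initial distribution and a slightly wrong kernel, compared with a
normalized flow whose kernel is mixing: the initial distribution is forgotten, and the error in
the kernel enters only through the last `j + 1` steps. -/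
lemma abs_fkFlow_sub_le (κ : Kernel S S) [IsMarkovKernel κ] (κ' : Kernel E E) [IsMarkovKernel κ']
    (hε : 0 < ε) (hε1 : ε ≤ 1) [IsFiniteMeasure lam] (hκ' : MixingWith κ' ε lam)
    {pr : S → E} (hpr : Measurable pr) (m : Measure S) [IsFiniteMeasure m]
    (b : Measure E) [IsProbabilityMeasure b]
    {g : ℕ → E → ℝ≥0∞} (hg : ∀ n, Measurable (g n)) {g₀ W : ℕ → ℝ≥0∞} (hg0 : ∀ n, g₀ n ≠ 0)
    (hg0' : ∀ n, g₀ n ≠ ⊤) (hW0 : ∀ n, W n ≠ 0) (hW : ∀ n, W n ≠ ⊤)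
    (hG : ∀ n x, g n x ≤ g₀ n * W n) (hG2 : ∀ n x, g₀ n ≤ g n x * W n)
    {V : Set S} (hV : MeasurableSet V)
    (hm : m Vᶜ = 0) (hκV : ∀ x ∈ V, κ x Vᶜ = 0) {δ : ℝ≥0∞} (hδ' : δ ≠ ⊤)
    (hδ : ∀ x ∈ V, ∀ f : E → ℝ≥0∞, Measurable f → (∀ z, f z ≤ 1) →
      ∫⁻ z, f (pr z) ∂(κ x) ≤ ∫⁻ z, f z ∂(κ' (pr x)) + δ ∧
      ∫⁻ z, f z ∂(κ' (pr x)) ≤ ∫⁻ z, f (pr z) ∂(κ x) + δ) (i j : ℕ)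
    {A : Set E} (hA : MeasurableSet A) :
    |(fkFlow κ m (fun n x => g n (pr x)) (i + (j + 1))).real (pr ⁻¹' A)
        - (fkFlow κ' b g (i + (j + 1))).real A / (fkFlow κ' b g (i + (j + 1))).real Set.univ
          * (fkFlow κ m (fun n x => g n (pr x)) (i + (j + 1))).real Set.univ|
      ≤ ((ε ^ 2)⁻¹ * (ε ^ 2)⁻¹ * (1 - ε ^ 2) ^ j
          + (2 * (j + 1 : ℕ) * δ * ∏ k ∈ Finset.range (j + 1), W (i + k) ^ 2).toReal)
        * (fkFlow κ m (fun n x => g n (pr x)) (i + (j + 1))).real Set.univ := by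
  have hgp : ∀ n, Measurable fun x => g n (pr x) := fun n => (hg n).comp hpr
  have hGt : ∀ n, g₀ n * W n ≠ ⊤ := fun n => ENNReal.mul_ne_top (hg0' n) (hW n)
  have hGl : ∀ n x, g₀ n / W n ≤ g n x := fun n x => ENNReal.div_le_of_le_mul (hG2 n x)
  have hG0 : ∀ n, g₀ n / W n ≠ 0 := fun n => (ENNReal.div_pos (hg0 n) (hW n)).ne'
  rw [fkFlow_add κ m, fkFlow_add κ' b]
  have hMf := isFiniteMeasure_fkFlow κ m hgp hGt (fun n x => hG n (pr x)) i
  have hNf := isFiniteMeasure_fkFlow κ' b hg hGt hG i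
  have hN0 : fkFlow κ' b g i ≠ 0 := by
    rw [← Measure.measure_univ_pos]
    refine lt_of_lt_of_le ?_ (le_fkFlow_univ κ' b hg hGl i)
    rw [measure_univ, mul_one]
    exact pos_iff_ne_zero.2 (Finset.prod_ne_zero_iff.2 fun k _ => hG0 k)
  set M := fkFlow κ m (fun n x => g n (pr x)) i with hMdef
  set N := fkFlow κ' b g i with hN
  -- `m` may be zero, when the prior does not charge the set; the conclusion is therefore multiplied
  -- by the mass rather than divided by it.
  by_cases hM : M = 0
  · have : fkFlow κ M (fun k x => g (i + k) (pr x)) (j + 1) = 0 := by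
      have := fkFlow_smul κ 0 (0 : Measure S) (fun k => hgp (i + k)) (j + 1)
      rw [hM]
      simpa using this
    simp [this]
  have hMp := isProbabilityMeasure_inv_smul hM
  have hNp := isProbabilityMeasure_inv_smul hN0
  have hMV : M Vᶜ = 0 := fkFlow_apply_eq_zero κ hV hm hκV i
  -- The intermediate term is the `κ'` flow started at time `i` from the projection of `M`: `h1`
  -- changes the kernel, `h2` then changes the initial law.
  have h1 := abs_normalized_perturb κ κ' hpr ((M Set.univ)⁻¹ • M) (fun k => hg (i + k))
    (fun k => hg0 (i + k)) (fun k => hg0' (i + k)) (fun k => hW0 (i + k)) (fun k => hW (i + k))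
    (fun k => hG (i + k)) (fun k => hG2 (i + k)) hV (by simp [hMV]) hκV hδ' hδ (j + 1) hA
  have hmp := Measure.isProbabilityMeasure_map (μ := (M Set.univ)⁻¹ • M) hpr.aemeasurable
  have h2 := abs_normalized_fkFlow_sub_le hε hε1 hκ' (a := ((M Set.univ)⁻¹ • M).map pr)
    (b := (N Set.univ)⁻¹ • N) (fun k => hg (i + k)) (fun k => hGt (i + k)) (fun k => hG (i + k))
    (fun k => hG0 (i + k)) (fun k => hGl (i + k)) j hA
  rw [normalized_fkFlow_smul κ (ENNReal.inv_ne_zero.2 (measure_ne_top _ _))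
    (ENNReal.inv_ne_top.2 (by simpa using hM)) M (fun k => hgp (i + k))] at h1
  rw [normalized_fkFlow_smul κ' (ENNReal.inv_ne_zero.2 (measure_ne_top N _))
    (ENNReal.inv_ne_top.2 (by simpa using hN0)) N (fun k => hg (i + k))] at h2
  have hFf := isFiniteMeasure_fkFlow κ M (fun k => hgp (i + k)) (fun k => hGt (i + k))
    (fun k x => hG (i + k) (pr x)) (j + 1)
  have hF : 0 < (fkFlow κ M (fun k x => g (i + k) (pr x)) (j + 1)).real Set.univ := by
    refine ENNReal.toReal_pos (ne_of_gt (lt_of_lt_of_le ?_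
      (le_fkFlow_univ κ M (fun k => hgp (i + k)) (fun k x => hGl (i + k) (pr x)) _)))
      (measure_ne_top _ _)
    refine ENNReal.mul_pos (Finset.prod_ne_zero_iff.2 fun k _ => hG0 (i + k)) (by simpa using hM)
  set Z := (fkFlow κ M (fun k x => g (i + k) (pr x)) (j + 1)).real Set.univ with hZ
  set a := (fkFlow κ M (fun k x => g (i + k) (pr x)) (j + 1)).real (pr ⁻¹' A) with ha
  have h3 := (abs_sub_le _ _ _).trans (add_le_add h1 h2)
  have h4 : ∀ p : ℝ, a - p * Z = (a / Z - p) * Z := fun p => by field_simp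
  rw [h4, abs_mul, abs_of_pos hF]
  refine mul_le_mul_of_nonneg_right (h3.trans_eq (add_comm _ _)) hF.le

end Stability

/-! ### Error of the marginal filter for fixed observations -/

section Final

variable {E : Type*} [MeasurableSpace E] {d : ℕ}

/-- Given the signal, the observations are independent, so each of the last `j` factors costs at
most `C` and each earlier one integrates to `1`. The bound does not depend on `i`. -/
lemma lintegral_obsLaw_prod_le (κ : Kernel E E) [IsMarkovKernel κ] (m : Measure E)
    [IsProbabilityMeasure m] {σ : ℝ} (hσ : 0 < σ) {h : E → Obs d} (hh : Measurable h)
    {w : Obs d → ℝ≥0∞} (hw : Measurable w) {C : ℝ≥0∞}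
    (hC : ∀ x, ∫⁻ v, gaussDensity σ (v - h x) * w v ≤ C) (i j : ℕ) :
    ∫⁻ y, ∏ k ∈ Finset.range j, w (extendObs y (i + k)) ∂(obsLaw κ m σ h (i + j)) ≤ C ^ j := by
  have : Fact (0 < σ) := ⟨hσ⟩
  set W : ℕ → Obs d → ℝ≥0∞ := fun k => if i ≤ k then w else 1 with hW
  have hWm : ∀ k, Measurable (W k) := fun k => by
    simp only [hW]; split_ifs; exacts [hw, measurable_one]
  have hprod : ∀ y : Fin (i + j) → Obs d,
      ∏ k ∈ Finset.range j, w (extendObs y (i + k)) = ∏ k : Fin (i + j), W k (y k) := by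
    intro y
    have h1 : ∀ k : Fin (i + j), W k (y k) = W k (extendObs y k) := fun k => by rw [extendObs_fin]
    rw [Finset.prod_congr rfl fun k _ => h1 k,
      ← Finset.prod_range (f := fun k => W k (extendObs y k)), Finset.prod_range_add,
      Finset.prod_eq_one (s := Finset.range i), one_mul]
    · simp [hW]
    · intro k hk
      simp [hW, not_le.2 (Finset.mem_range.1 hk)]
  have key := lintegral_prod_mul_unnormalizedFilter_le κ m σ hh hWm (φ := fun _ => 1)
    measurable_const (fun k => if i ≤ k then C else 1) (fun k x => by
      simp only [one_mul, mul_one]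
      calc _ ≤ ∫⁻ _, (if i ≤ k then C else 1) ∂(κ x) := by
            gcongr with z
            simp only [hW]
            split_ifs
            · exact hC z
            · simp [lintegral_gaussDensity_sub hσ]
        _ = _ := by simp) (i + j)
  simp only [lintegral_one, measure_univ, mul_one, ← obsDensity_eq κ m σ hh] at key
  rw [Finset.prod_range_add, Finset.prod_eq_one (s := Finset.range i), one_mul] at key
  · rw [lintegral_obsLaw κ m σ hh]
    · simp only [hprod]
      refine le_trans (le_of_eq (lintegral_congr fun y => mul_comm _ _)) (key.trans (by simp))
    · simp only [hprod]
      exact Finset.measurable_prod _ fun k _ => (hWm k).comp (measurable_pi_apply k)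
  · intro k hk
    simp [not_le.2 (Finset.mem_range.1 hk)]

lemma tvNorm_le {S : Type*} [MeasurableSpace S] {m₁ m₂ : Measure S} [IsFiniteMeasure m₁]
    [IsFiniteMeasure m₂] {R : ℝ≥0∞}
    (H : ∀ A, MeasurableSet A → ENNReal.ofReal |m₁.real A - m₂.real A| ≤ R) :
    tvNorm m₁ m₂ ≤ 2 * R := by
  have key : ∀ (P Q : Measure S) [IsFiniteMeasure P] [IsFiniteMeasure Q] (A : Set S),
      P A - Q A ≤ ENNReal.ofReal |P.real A - Q.real A| := by
    intro P Q _ _ A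
    rw [← ofReal_measureReal (μ := P), ← ofReal_measureReal (μ := Q),
      ← ENNReal.ofReal_sub _ measureReal_nonneg]
    exact ENNReal.ofReal_le_ofReal (le_abs_self _)
  unfold tvNorm
  gcongr
  refine iSup₂_le fun A hA => max_le ((key _ _ A).trans (H A hA)) ((key _ _ A).trans ?_)
  rw [abs_sub_comm]
  exact H A hA

variable {T : Type*} [MeasurableSpace T] {ε : ℝ} {lam : Measure E}

/-- The error of the marginal filter: a part that is forgotten, the effect of the wrong parameters
in `N` over the last `j + 1` steps, and the posterior mass of the parameters outside `N`. -/
lemma tvNorm_marginalFilter_le (K : Kernel (E × T) E) [IsMarkovKernel K] (μ μ' : Measure E)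
    [IsProbabilityMeasure μ] [IsProbabilityMeasure μ'] (u : Measure T) [IsProbabilityMeasure u]
    {σ H : ℝ} (hσ : 0 < σ) {h : E → Obs d} (hh : Measurable h) (hH : ∀ x, ‖h x‖ ≤ H) (α : T)
    (hε : 0 < ε) (hε1 : ε ≤ 1) [IsFiniteMeasure lam] (hα : MixingWith (K.sectL α) ε lam)
    {N : Set T} (hN : MeasurableSet N) {δ : ℝ≥0∞} (hδ' : δ ≠ ⊤)
    (hδ : ∀ θ ∈ N, ∀ x, ∀ f : E → ℝ≥0∞, Measurable f → (∀ z, f z ≤ 1) →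
      ∫⁻ z, f z ∂(K (x, θ)) ≤ ∫⁻ z, f z ∂(K (x, α)) + δ ∧
      ∫⁻ z, f z ∂(K (x, α)) ≤ ∫⁻ z, f z ∂(K (x, θ)) + δ) (i j : ℕ)
    {n : ℕ} (hn : n = i + (j + 1)) (y : Fin n → Obs d) :
    tvNorm (marginalFilter K μ u σ h n y) (optimalFilter (K.sectL α) μ' σ h n y)
      ≤ 2 * (ENNReal.ofReal ((ε ^ 2)⁻¹ * (ε ^ 2)⁻¹ * (1 - ε ^ 2) ^ j)
        + 2 * (j + 1 : ℕ) * δ *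
            ∏ k ∈ Finset.range (j + 1), ratioBound σ H (extendObs y (i + k)) ^ 2
        + obsDensity (augmentedKernel K) (μ.prod (u.restrict Nᶜ)) σ (fun p => h p.1) _ y /
          obsDensity (augmentedKernel K) (μ.prod u) σ (fun p => h p.1) _ y) := by
  have hhf : Measurable fun p : E × T => h p.1 := hh.comp measurable_fst
  have hHf : ∀ p : E × T, ‖h p.1‖ ≤ H := fun p => hH p.1
  set g := likelihood σ h (extendObs y) with hg
  have hgm : ∀ n, Measurable (g n) := measurable_likelihood σ hh _
  have hgpm : ∀ n, Measurable fun p : E × T => g n p.1 := fun n => (hgm n).comp measurable_fst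
  have hgp : likelihood σ (fun p : E × T => h p.1) (extendObs y) = fun n p => g n p.1 := rfl
  have hfin : ∀ (v : Measure T) [IsFiniteMeasure v],
      IsFiniteMeasure (fkFlow (augmentedKernel K) (μ.prod v) (fun n p => g n p.1) n) :=
    fun v _ => isFiniteMeasure_fkFlow _ _ hgpm (fun _ => ENNReal.ofReal_ne_top)
      (fun n x => gaussDensity_le hσ (extendObs y n - h x.1)) n
  set F₁ := fkFlow (augmentedKernel K) (μ.prod (u.restrict N)) (fun n p => g n p.1) n with hF₁
  set F₂ := fkFlow (augmentedKernel K) (μ.prod (u.restrict Nᶜ)) (fun n p => g n p.1) n with hF₂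
  set F := fkFlow (augmentedKernel K) (μ.prod u) (fun n p => g n p.1) n with hF
  set P := fkFlow (K.sectL α) μ' g n with hP
  have i1 : IsFiniteMeasure F₁ := hfin _
  have i2 : IsFiniteMeasure F₂ := hfin _
  have i3 : IsFiniteMeasure F := hfin _
  have i4 : IsFiniteMeasure P := isFiniteMeasure_fkFlow _ _ hgm (fun _ => ENNReal.ofReal_ne_top)
      (fun n x => gaussDensity_le hσ (extendObs y n - h x)) n
  have hsplit : F = F₁ + F₂ := by
    rw [hF₁, hF₂, ← fkFlow_add_measure _ _ _ hgpm, ← Measure.prod_add,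
      Measure.restrict_add_restrict_compl hN]
  have hD₂ : obsDensity (augmentedKernel K) (μ.prod (u.restrict Nᶜ)) σ (fun p => h p.1) n y
      = F₂ Set.univ := by
    rw [obsDensity_eq _ _ σ hhf, unnormalizedFilter_eq _ _ σ hhf, hgp]
  have hD : obsDensity (augmentedKernel K) (μ.prod u) σ (fun p => h p.1) n y = F Set.univ := by
    rw [obsDensity_eq _ _ σ hhf, unnormalizedFilter_eq _ _ σ hhf, hgp]
  have hF0 : F Set.univ ≠ 0 := by rw [← hD]; exact obsDensity_ne_zero _ _ hσ hhf hHf n y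
  have hP0 : P Set.univ ≠ 0 := by
    rw [hP, hg, ← unnormalizedFilter_eq _ _ σ hh, ← obsDensity_eq _ _ σ hh]
    exact obsDensity_ne_zero _ _ hσ hh hH n y
  have hopt : optimalFilter (K.sectL α) μ' σ h n y = (P Set.univ)⁻¹ • P := by
    rw [optimalFilter, unnormalizedFilter_eq _ _ σ hh]
  have hmarg : marginalFilter K μ u σ h n y = ((F Set.univ)⁻¹ • F).map Prod.fst := by
    rw [marginalFilter, optimalFilter, unnormalizedFilter_eq _ _ σ hhf, hgp]
  have q1 : IsProbabilityMeasure ((P Set.univ)⁻¹ • P) :=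
    isProbabilityMeasure_inv_smul (by simpa using hP0)
  have q2 : IsProbabilityMeasure ((F Set.univ)⁻¹ • F) :=
    isProbabilityMeasure_inv_smul (by simpa using hF0)
  rw [hopt, hmarg, hD₂, hD]
  refine tvNorm_le fun A hA => ?_
  have hR := abs_fkFlow_sub_le (augmentedKernel K) (K.sectL α) hε hε1 hα measurable_fst
    (μ.prod (u.restrict N)) μ' hgm (g₀ := fun n => gaussDensity σ (extendObs y n))
    (W := fun n => ratioBound σ H (extendObs y n)) (fun n => (gaussDensity_pos hσ _).ne')
    (fun n => gaussDensity_ne_top _ _) (fun n => ratioBound_ne_zero _ _ _)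
    (fun n => ratioBound_ne_top _ _ _) (fun n x => gaussDensity_sub_le hσ (hH x) _)
    (fun n x => gaussDensity_le_sub hσ (hH x) _) (V := Prod.snd ⁻¹' N) (measurable_snd hN)
    (by
      have : (Prod.snd ⁻¹' N : Set (E × T))ᶜ = Set.univ ×ˢ Nᶜ := by ext; simp
      rw [this, Measure.prod_prod, Measure.restrict_apply hN.compl]
      simp)
    (fun p hp => augmentedKernel_snd_preimage K p hN.compl (by simpa using hp)) hδ'
    (fun p hp f hf hf1 => by
      rw [lintegral_augmentedKernel K p (F := fun q => f q.1) (hf.comp measurable_fst), Kernel.sectL_apply]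
      exact hδ p.2 hp p.1 f hf hf1) i j hA
  set prod := ∏ k ∈ Finset.range (j + 1), ratioBound σ H (extendObs y (i + k)) ^ 2 with hprod
  have hpt : 2 * (j + 1 : ℕ) * δ * prod ≠ ⊤ := by
    refine ENNReal.mul_ne_top (ENNReal.mul_ne_top (by finiteness) hδ') ?_
    exact ENNReal.prod_ne_top fun k _ => ENNReal.pow_ne_top (ratioBound_ne_top _ _ _)
  have hc : 0 ≤ (ε ^ 2)⁻¹ * (ε ^ 2)⁻¹ * (1 - ε ^ 2) ^ j := by
    have : 0 ≤ 1 - ε ^ 2 := by nlinarith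
    positivity
  rw [map_measureReal_apply measurable_fst hA, measureReal_ennreal_smul_apply,
    measureReal_ennreal_smul_apply, hsplit, ENNReal.toReal_inv, ENNReal.toReal_inv]
  have hZpos : 0 < (F₁ + F₂).real Set.univ := by
    rw [← hsplit]; exact ENNReal.toReal_pos hF0 (measure_ne_top _ _)
  have hPpos : 0 < P.real Set.univ := ENNReal.toReal_pos hP0 (measure_ne_top _ _)
  rw [← hn, ← hF₁, ← hP] at hR
  have hp0 : 0 ≤ P.real A / P.real Set.univ := by positivity
  have hp1 : P.real A / P.real Set.univ ≤ 1 :=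
    (div_le_one hPpos).2 (measureReal_mono (Set.subset_univ A))
  have hf2 : F₂.real (Prod.fst ⁻¹' A) ≤ F₂.real Set.univ := measureReal_mono (Set.subset_univ _)
  have hf20 : 0 ≤ F₂.real (Prod.fst ⁻¹' A) := measureReal_nonneg
  have hz1 : 0 ≤ F₁.real Set.univ := measureReal_nonneg
  have hz2 : 0 ≤ F₂.real Set.univ := measureReal_nonneg
  have hq : F₂ Set.univ / (F₁ + F₂) Set.univ
      = ENNReal.ofReal (F₂.real Set.univ / (F₁ + F₂).real Set.univ) := by
    rw [ENNReal.ofReal_div_of_pos hZpos, ofReal_measureReal, ofReal_measureReal]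
  rw [hq, ← ENNReal.ofReal_toReal hpt, ← ENNReal.ofReal_add hc ENNReal.toReal_nonneg,
    ← ENNReal.ofReal_add (by positivity) (by positivity)]
  refine ENNReal.ofReal_le_ofReal ?_
  change |((F₁ + F₂).real Set.univ)⁻¹ * _ - (P.real Set.univ)⁻¹ * _| ≤ _
  set R := (ε ^ 2)⁻¹ * (ε ^ 2)⁻¹ * (1 - ε ^ 2) ^ j + (2 * (j + 1 : ℕ) * δ * prod).toReal with hRdef
  have hR0 : 0 ≤ R := add_nonneg hc ENNReal.toReal_nonneg
  rw [measureReal_add_apply] at hZpos ⊢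
  rw [measureReal_add_apply]
  set p := P.real A / P.real Set.univ with hpdef
  have hpe : (P.real Set.univ)⁻¹ * P.real A = p := by rw [hpdef, div_eq_inv_mul]
  rw [hpe]
  set a₁ := F₁.real (Prod.fst ⁻¹' A)
  set a₂ := F₂.real (Prod.fst ⁻¹' A)
  set z₁ := F₁.real Set.univ
  set z₂ := F₂.real Set.univ
  -- The part in `N` is at most `R * z₁` by `hR`; the part outside is at most `z₂` since `p` is in
  -- `[0, 1]`, and `z₂ / (z₁ + z₂)` is the posterior mass of `Nᶜ`.
  have e1 : (z₁ + z₂)⁻¹ * (a₁ + a₂) - p = ((a₁ - p * z₁) + (a₂ - p * z₂)) / (z₁ + z₂) := by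
    field_simp; ring
  have e2 : |a₂ - p * z₂| ≤ z₂ := by
    rw [abs_le]; constructor <;> nlinarith
  rw [e1, abs_div, abs_of_pos hZpos, div_le_iff₀ hZpos, add_mul, div_mul_cancel₀ _ hZpos.ne']
  have := (abs_add_le (a₁ - p * z₁) (a₂ - p * z₂)).trans (add_le_add hR e2)
  nlinarith

end Final

/-! ### The mean error and the choice of constants -/

section Main

lemma IsKernelDeriv.exists_lintegral_le {E : Type*} [TopologicalSpace E] [PolishSpace E]
    [MeasurableSpace E] [BorelSpace E] {B : Type*} [NormedAddCommGroup B] [NormedSpace ℝ B]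
    [MeasurableSpace B] {Θ : Set B}
    {K : Kernel (E × Θ) E} [IsMarkovKernel K] {θ₀ : Θ}
    {L : B →L[ℝ] (E →ᵇ ℝ) →L[ℝ] (E →ᵇ ℝ)} (hL : IsKernelDeriv K θ₀ L) :
    ∃ C : ℝ≥0, ∀ (θ : Θ) (x : E) (f : E → ℝ≥0∞), Measurable f → (∀ z, f z ≤ 1) →
      ∫⁻ z, f z ∂(K (x, θ)) ≤ ∫⁻ z, f z ∂(K (x, θ₀)) + ENNReal.ofReal (C * dist θ θ₀) ∧
      ∫⁻ z, f z ∂(K (x, θ₀)) ≤ ∫⁻ z, f z ∂(K (x, θ)) + ENNReal.ofReal (C * dist θ θ₀) := by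
  obtain ⟨C, hC⟩ := hL.exists_bound
  have hc : ∀ θ, 0 ≤ C * dist θ θ₀ := fun θ => by positivity
  refine ⟨C, fun θ x f hf hf1 => ⟨?_, ?_⟩⟩
  · exact lintegral_le_add_of_measure_le (fun A hA => measure_le_add_of_integral_le (hc θ)
      (fun f => (le_abs_self _).trans (hC f θ x)) hA) hf hf1
  · exact lintegral_le_add_of_measure_le (fun A hA => measure_le_add_of_integral_le (hc θ)
      (fun f => (le_abs_self _).trans ((abs_sub_comm _ _).trans_le (hC f θ x))) hA) hf hf1

variable {E : Type*} [MeasurableSpace E] {d : ℕ} {T : Type*} [MeasurableSpace T]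

/-- The mean error of the marginal filter. -/
lemma lintegral_tvNorm_marginalFilter_le {ε : ℝ} {lam : Measure E}
    (K : Kernel (E × T) E) [IsMarkovKernel K] (μ μ' : Measure E)
    [IsProbabilityMeasure μ] [IsProbabilityMeasure μ'] (u : Measure T) [IsProbabilityMeasure u]
    {σ H : ℝ} (hσ : 0 < σ) {h : E → Obs d} (hh : Measurable h) (hH : ∀ x, ‖h x‖ ≤ H) (α : T)
    (hε : 0 < ε) (hε1 : ε ≤ 1) [IsFiniteMeasure lam] (hα : MixingWith (K.sectL α) ε lam)
    {C : ℝ≥0∞} (hC : ∀ x : Obs d, ‖x‖ ≤ H →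
      ∫⁻ v : Obs d, gaussDensity σ (v - x) * ratioBound σ H v ^ 2 ≤ C)
    {N : Set T} (hN : MeasurableSet N) {δ : ℝ≥0∞} (hδ' : δ ≠ ⊤)
    (hδ : ∀ θ ∈ N, ∀ x, ∀ f : E → ℝ≥0∞, Measurable f → (∀ z, f z ≤ 1) →
      ∫⁻ z, f z ∂(K (x, θ)) ≤ ∫⁻ z, f z ∂(K (x, α)) + δ ∧
      ∫⁻ z, f z ∂(K (x, α)) ≤ ∫⁻ z, f z ∂(K (x, θ)) + δ) {n : ℕ} (j : ℕ) (hn : j + 1 ≤ n) :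
    ∫⁻ y, tvNorm (marginalFilter K μ u σ h n y) (optimalFilter (K.sectL α) μ' σ h n y)
        ∂(obsLaw (K.sectL α) μ' σ h n)
      ≤ 2 * (ENNReal.ofReal ((ε ^ 2)⁻¹ * (ε ^ 2)⁻¹ * (1 - ε ^ 2) ^ j)
        + 2 * (j + 1 : ℕ) * δ * C ^ (j + 1)
        + ∫⁻ y, obsDensity (augmentedKernel K) (μ.prod (u.restrict Nᶜ)) σ (fun p => h p.1) n y /
          obsDensity (augmentedKernel K) (μ.prod u) σ (fun p => h p.1) n y
          ∂(obsLaw (K.sectL α) μ' σ h n)) := by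
  obtain ⟨i, rfl⟩ : ∃ i, n = i + (j + 1) := ⟨n - (j + 1), by omega⟩
  have hhf : Measurable fun p : E × T => h p.1 := hh.comp measurable_fst
  have m1 : Measurable fun y : Fin (i + (j + 1)) → Obs d =>
      obsDensity (augmentedKernel K) (μ.prod (u.restrict Nᶜ)) σ (fun p => h p.1) _ y /
        obsDensity (augmentedKernel K) (μ.prod u) σ (fun p => h p.1) _ y :=
    (measurable_obsDensity _ _ σ hhf _).div (measurable_obsDensity _ _ σ hhf _)
  have m2 : Measurable fun y : Fin (i + (j + 1)) → Obs d =>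
      ∏ k ∈ Finset.range (j + 1), ratioBound σ H (extendObs y (i + k)) ^ 2 := by
    refine Finset.measurable_prod _ fun k hk => ((measurable_ratioBound σ H).comp ?_).pow_const 2
    have hk' : i + k < i + (j + 1) := by have := Finset.mem_range.1 hk; omega
    simpa only [extendObs, hk', dif_pos] using measurable_pi_apply _
  have h1 := lintegral_obsLaw_prod_le (K.sectL α) μ' hσ hh ((measurable_ratioBound σ H).pow_const 2)
    (fun x => hC _ (hH x)) i (j + 1)
  have h2 : obsLaw (K.sectL α) μ' σ h (i + (j + 1)) Set.univ ≤ 1 := by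
    have := lintegral_obsLaw_prod_le (K.sectL α) μ' hσ hh (measurable_const (a := (1 : ℝ≥0∞)))
      (C := 1) (fun x => by simp [lintegral_gaussDensity_sub hσ]) i (j + 1)
    simpa using this
  refine (lintegral_mono fun y => tvNorm_marginalFilter_le K μ μ' u hσ hh hH α hε hε1 hα hN hδ' hδ
    i j rfl y).trans ?_
  rw [lintegral_const_mul' _ _ ENNReal.ofNat_ne_top,
    lintegral_add_right _ m1, lintegral_add_right _ (m2.const_mul _), lintegral_const,
    lintegral_const_mul _ m2]
  gcongr
  exact mul_le_of_le_one_right' h2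

end Main

end AdaptiveFilter

theorem mainTheorem1
    {E : Type*} [TopologicalSpace E] [PolishSpace E] [MeasurableSpace E] [BorelSpace E]
    {B : Type*} [NormedAddCommGroup B] [NormedSpace ℝ B] [CompleteSpace B]
    [MeasurableSpace B] [BorelSpace B]
    (Θ : Set B) (hΘ : IsCompact Θ)
    (K : Kernel (E × Θ) E) [IsMarkovKernel K]
    (hFeller : ∀ θ : Θ, AdaptiveFilter.IsFeller (K.sectL θ))
    (hMixing : ∀ θ : Θ, AdaptiveFilter.IsMixing (K.sectL θ))
    {d : ℕ} (h : E →ᵇ AdaptiveFilter.Obs d) (σ : ℝ) (hσ : 0 < σ)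
    (α : Θ) (u : Measure Θ) [IsProbabilityMeasure u]
    (μ μ' : Measure E) [IsProbabilityMeasure μ] [IsProbabilityMeasure μ']
    (J : Θ → ProbabilityMeasure (AdaptiveFilter.Obs d) → ℝ≥0∞)
    (hPrior : AdaptiveFilter.PriorMassCondition K μ μ' u α σ h)
    (hLDP : ∀ θ : Θ, AdaptiveFilter.SatisfiesLDP
      (fun n => AdaptiveFilter.obsLaw (K.sectL θ) μ σ h n) (J θ))
    (hOpen : ∀ η : ℝ, 0 < η → ∃ ε : ℝ, 0 < ε ∧ ∀ θ : Θ,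
      levyProkhorovDist (AdaptiveFilter.limitingObsLaw (K.sectL θ) σ h)
        (AdaptiveFilter.limitingObsLaw (K.sectL α) σ h) ≤ ε → dist θ α < η)
    (hK : AdaptiveFilter.KernelContinuous K)
    (hJ : ∀ ν : ProbabilityMeasure (AdaptiveFilter.Obs d), Continuous (fun θ : Θ => J θ ν))
    (hLam : AdaptiveFilter.DerivMomentCondition K μ α)
    (hMoments : Integrable (fun y => y) (AdaptiveFilter.limitingObsLaw (K.sectL α) σ h) ∧
      Integrable (fun y => ‖y‖ ^ 2) (AdaptiveFilter.limitingObsLaw (K.sectL α) σ h)) :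
    Tendsto (fun n : ℕ =>
      ∫⁻ y, AdaptiveFilter.tvNorm
          (AdaptiveFilter.marginalFilter K μ u σ h n y)
          (AdaptiveFilter.optimalFilter (K.sectL α) μ' σ h n y)
        ∂(AdaptiveFilter.obsLaw (K.sectL α) μ' σ h n))
      atTop (𝓝 0) := by
  open AdaptiveFilter in
  have : CompactSpace Θ := isCompact_iff_compactSpace.1 hΘ
  -- Equal limiting laws have Lévy–Prokhorov distance `0`, so by `hOpen` the parameter would be
  -- closer to `α` than `δ`.
  have hne : ∀ δ : ℝ, 0 < δ → ∀ θ : Θ, δ ≤ dist θ α →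
      limitingObsLaw (K.sectL θ) σ h ≠ limitingObsLaw (K.sectL α) σ h := by
    intro δ hδ θ hθ heq
    obtain ⟨ε, hε, H⟩ := hOpen δ hδ
    refine absurd (H θ ?_) (not_lt.2 hθ)
    rw [heq, levyProkhorovDist, levyProkhorovEDist_self]
    simpa using hε.le
  obtain ⟨r, L, ℓ, hr, hL, -⟩ := hLam
  obtain ⟨C, hC⟩ := (hL α (Metric.mem_ball_self hr)).1.exists_lintegral_le
  obtain ⟨ε, lam, hε, hε1, hfin, hmix⟩ := (hMixing α).exists_mixingWith
  obtain ⟨C', hC'top, hC'⟩ := exists_lintegral_ratioBound_sq_le (d := d) hσ ‖h‖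
  rw [ENNReal.tendsto_nhds_zero]
  intro η hη
  obtain ⟨η', hη'0, hη'⟩ : ∃ η' : ℝ≥0∞, 0 < η' ∧ 2 * (η' + η' + η') ≤ η := by
    refine ⟨η / 6, ENNReal.div_pos hη.ne' (by norm_num), le_of_eq ?_⟩
    calc 2 * (η / 6 + η / 6 + η / 6) = 6 * (η / 6) := by ring
      _ = η := ENNReal.mul_div_cancel (by norm_num) (by norm_num)
  have hε2 : |1 - ε ^ 2| < 1 := by rw [abs_lt]; constructor <;> nlinarith
  have hj : Tendsto (fun j : ℕ => ENNReal.ofReal ((ε ^ 2)⁻¹ * (ε ^ 2)⁻¹ * (1 - ε ^ 2) ^ j)) atTop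
      (𝓝 0) := by
    rw [← ENNReal.ofReal_zero]
    refine (ENNReal.continuous_ofReal.tendsto 0).comp ?_
    simpa using (tendsto_pow_atTop_nhds_zero_of_abs_lt_one hε2).const_mul ((ε ^ 2)⁻¹ * (ε ^ 2)⁻¹)
  -- The window length must be fixed before `δ`, because the perturbation error contains `(j + 1) *
  -- C' ^ (j + 1)`.
  obtain ⟨j, hj⟩ := ((ENNReal.tendsto_nhds_zero.1 hj) η' hη'0).exists
  have hδ : Tendsto (fun δ : ℝ => 2 * (j + 1 : ℕ) * ENNReal.ofReal (C * δ) * C' ^ (j + 1))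
      (𝓝[>] 0) (𝓝 0) := by
    have h0 : Tendsto (fun δ : ℝ => ENNReal.ofReal (C * δ)) (𝓝[>] 0) (𝓝 0) := by
      have h1 : Tendsto (fun δ : ℝ => C * δ) (𝓝[>] 0) (𝓝 (C * 0)) :=
        (tendsto_nhdsWithin_of_tendsto_nhds tendsto_id).const_mul _
      rw [mul_zero] at h1
      rw [← ENNReal.ofReal_zero]
      exact (ENNReal.continuous_ofReal.tendsto 0).comp h1
    have h2 := ENNReal.Tendsto.mul_const (ENNReal.Tendsto.const_mul (a := 2 * ((j + 1 : ℕ) : ℝ≥0∞))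
      h0 (Or.inr (by finiteness))) (b := C' ^ (j + 1)) (Or.inr (ENNReal.pow_ne_top hC'top))
    simpa using h2
  obtain ⟨δ, hδ1, hδ0⟩ := (((ENNReal.tendsto_nhds_zero.1 hδ) η' hη'0).and
    self_mem_nhdsWithin).exists
  have hpost := tendsto_posterior_compl_ball K hK hFeller hMixing μ μ' u hσ h α hPrior
    (hne δ hδ0)
  filter_upwards [(ENNReal.tendsto_nhds_zero.1 hpost) η' hη'0, eventually_ge_atTop (j + 1)]
    with n hn1 hn2
  refine (lintegral_tvNorm_marginalFilter_le K μ μ' u hσ h.continuous.measurable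
    h.norm_coe_le_norm α hε hε1 hmix hC' (N := Metric.ball α δ) Metric.isOpen_ball.measurableSet
    (δ := ENNReal.ofReal (C * δ)) ENNReal.ofReal_ne_top ?_ j hn2).trans ?_
  · intro θ hθ x f hf hf1
    have h1 : ENNReal.ofReal (C * dist θ α) ≤ ENNReal.ofReal (C * δ) := by
      gcongr; exact (Metric.mem_ball.1 hθ).le
    obtain ⟨h2, h3⟩ := hC θ x f hf hf1
    exact ⟨h2.trans (by gcongr), h3.trans (by gcongr)⟩
  · refine le_trans ?_ hη'
    gcongr
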